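/- **Feynman diagrams.** A *Feynman diagram* of order $n$ is a finite graph with $2n$ vertices, each of degree 1 (*legs*) or 3, with a cyclic order on its legs (they are drawn on an oriented circle, the *Wilson line*) and a cyclic order on the three half-edges at each trivalent vertex, and with at least one leg on every connected component. Diagrams are taken up to isomorphism, and all cyclic orders are counterclockwise in drawings. A *chord diagram* with $n$ chords is a Feynman diagram with $2n$ legs and no trivalent vertices. **The Alexander–Conway series.** For a knot $K$ let $\Delta(K,t)\in\mathbb Z[t,t^{-1}]$ be its Alexander polynomial, normalised by $\Delta(K,t)=\Delta(K,t^{-1})$ and $\Delta(K,1)=1$. It is extended to singular knots with finitely many transverse double points by the alternating sum over all positive and negative resolutions of the double points. On chord diagrams with $n$ chords, the series $C$ is the symbol of this invariant: $C(D)$ is the coefficient of $z^n$ in $\Delta(K,e^z)$ for any singular knot $K$ with $n$ double points and chord diagram $D$. (Singular knots are represented as closures of singular braids.) $C$ is extended to all Feynman diagrams by the three-term relation $$C(D_Y)=C(D_{||})-C(D_X),$$ where $D_Y$ has a leg joined to a trivalent vertex whose half-edges are, in cyclic order, $a$ (to the leg), $b$, $c$; in $D_{||}$ and $D_X$ the leg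 and this vertex are removed and $b$, $c$ become legs, which take the place of the removed leg on the Wilson line in the order $c,b$ for $D_{||}$ and $b,c$ for $D_X$. **Bubbles.** A *bubble* with ends $p,p'$ consists of two different trivalent vertices with half-edges $(p,q,r)$ and $(p',q',r')$ in cyclic order, where $q$ is joined to $r'$ and $r$ to $q'$. An edge or arc *carries a bubble* if the bubble is inserted in it. **Proposition 7.1.** There is exactly one rational-valued function $C$ on Feynman diagrams with these properties, the Alexander–Conway series, and it satisfies the following relations. 1. If $F$ contains a chord that carries a bubble, both of its ends being legs, and $F_0$ is the diagram obtained by deleting this chord together with its bubble and its two legs, then $C(F)=-2\,C(F_0)$. 2. If $F$ contains a bubble one end of which is joined to a trivalent vertex, then $C(F)=0$. 3. If $F$ contains a tree fragment formed by a trivalent vertex joined to three further trivalent vertices (the four vertices being distinct; the six legs of the fragment are joined arbitrarily), then $C(F)=0$. 4. Let $F$ contain the fragment $K$ formed by two different trivalent vertices $u,v$ joined by an edge $\{a,b\}$, where the half-edges are in cyclic order $(a,1,2)$ at $u$ and $(b,3,4)$ at $v$. For $\{i,j,k,l\}=\{1,2,3,4\}$ let $F_{ij|kl}$ be the diagram obtained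 from $F$ by replacing $K$ by two disjoint arcs, an arc with a bubble that joins the ends $i,j$ and a plain arc that joins the ends $k,l$. Then $$C(F)=\tfrac12\Bigl(C(F_{13|24})+C(F_{24|13})-C(F_{23|14})-C(F_{14|23})\Bigr),$$ provided that the four diagrams on the right are Feynman diagrams (no closed loop without vertices arises, and each component has a leg). -/

import Mathlib

open scoped LaurentPolynomial PowerSeries

/-!
Feynman diagrams, the Alexander polynomial of closed braids, its extension to singular braids,
and the weight series that it defines on chord diagrams and on Feynman diagrams.
-/

/-- A Feynman diagram with set of half-edges `H`: a finite graph with vertices of degree 1 (legs)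
or 3, with a cyclic order on the three half-edges at each trivalent vertex and a cyclic order on
the legs, such that every connected component has a leg.
The two halves of an edge are exchanged by `edge`. The map `next` sends a half-edge to the
following one (counterclockwise) at the same vertex, so that the legs are its fixed points and the
trivalent vertices are its orbits with three elements. The cycle `wilson` lists the legs in the
order in which they lie on the oriented Wilson line. -/
structure FeynmanDiagram (H : Type) where
  finite : Finite H
  edge : H → H
  edge_edge : ∀ h, edge (edge h) = h
  edge_ne : ∀ h, edge h ≠ h
  next : H → H
  next_next_next : ∀ h, next (next (next h)) = h
  wilson : Cycle H
  nodup_wilson : wilson.Nodup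
  mem_wilson : ∀ h, h ∈ wilson ↔ next h = h
  exists_leg : ∀ h, ∃ l, next l = l ∧
    Relation.ReflTransGen (fun x y => y = edge x ∨ y = next x) h l

namespace FeynmanDiagram

variable {H H' : Type}

/-- Equivalence of Feynman diagrams: a bijection of half-edges that preserves all the structure. -/
def Equivalent (F : FeynmanDiagram H) (F' : FeynmanDiagram H') : Prop :=
  ∃ e : H ≃ H', (∀ h, e (F.edge h) = F'.edge (e h)) ∧ (∀ h, e (F.next h) = F'.next (e h)) ∧
    F.wilson.map e = F'.wilson

/-- The half-edge `h` is at a trivalent vertex. -/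
def Trivalent (F : FeynmanDiagram H) (h : H) : Prop := F.next h ≠ h

/-- The half-edges `h` and `k` are at the same vertex. -/
def SameVertex (F : FeynmanDiagram H) (h k : H) : Prop :=
  k = h ∨ k = F.next h ∨ k = F.next (F.next h)

/-- A chord diagram is a Feynman diagram without trivalent vertices. -/
def IsChordDiagram (F : FeynmanDiagram H) : Prop := ∀ h, F.next h = h

/-- `D` is obtained from `Y` as follows: the leg `l` of `Y` (whose Wilson line carries the leg `l`
followed by the legs in the list `L`) and the half-edge joined to it, at a trivalent vertex, are
deleted; the two other half-edges `F.next (F.edge l)` and `F.next (F.next (F.edge l))` at this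
vertex become legs, and these two, in the order `x`, `y`, take the place of `l` on the Wilson
line. Everything else is unchanged. -/
def IsOpening (Y : FeynmanDiagram H) (l : H) (L : List H) (x y : H) (D : FeynmanDiagram H') :
    Prop :=
  ∃ i : H' → H, Function.Injective i ∧
    (∀ h, h ∈ Set.range i ↔ h ≠ l ∧ h ≠ Y.edge l) ∧
    (∀ h, i (D.edge h) = Y.edge (i h)) ∧
    (∀ h, Y.SameVertex (Y.edge l) (i h) → D.next h = h) ∧
    (∀ h, ¬ Y.SameVertex (Y.edge l) (i h) → i (D.next h) = Y.next (i h)) ∧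
    Y.wilson = ↑(l :: L) ∧ D.wilson.map i = ↑(x :: y :: L)

/-- The half-edges `p` and `p'` are the two ends of a (planar) bubble: they are at different
trivalent vertices, and the two other half-edges at the vertex of `p` are joined to the two other
half-edges at the vertex of `p'`, without crossing. -/
def IsBubble (F : FeynmanDiagram H) (p p' : H) : Prop :=
  F.Trivalent p ∧ F.Trivalent p' ∧ ¬ F.SameVertex p p' ∧
    F.edge (F.next p) = F.next (F.next p') ∧ F.edge (F.next (F.next p)) = F.next p'

/-- `F₀` is obtained from `F` by deleting a chord that carries a bubble: its two legs `l` and `l'`,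
its two edges, and the bubble with ends `F.edge l` and `F.edge l'`. -/
def IsBubbleChordDeletion (F : FeynmanDiagram H) (l l' : H) (F₀ : FeynmanDiagram H') : Prop :=
  F.next l = l ∧ F.next l' = l' ∧ F.IsBubble (F.edge l) (F.edge l') ∧
    ∃ (i : H' → H) (A B : List H'), Function.Injective i ∧
      (∀ h, h ∈ Set.range i ↔ h ≠ l ∧ h ≠ l' ∧
        ¬ F.SameVertex (F.edge l) h ∧ ¬ F.SameVertex (F.edge l') h) ∧
      (∀ h, i (F₀.edge h) = F.edge (i h)) ∧
      (∀ h, i (F₀.next h) = F.next (i h)) ∧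
      F.wilson = ↑(l :: A.map i ++ l' :: B.map i) ∧ F₀.wilson = ↑(A ++ B)

/-- `F` contains the tree in which a central trivalent vertex (with half-edge `c`) is joined to
three more trivalent vertices, which are different from it and from each other. -/
def HasTripodTree (F : FeynmanDiagram H) (c : H) : Prop :=
  F.Trivalent c ∧
    (∀ h, F.SameVertex c h → F.Trivalent (F.edge h) ∧ ¬ F.SameVertex c (F.edge h)) ∧
    (∀ h k, F.SameVertex c h → F.SameVertex c k → h ≠ k →
      ¬ F.SameVertex (F.edge h) (F.edge k))

/-- `F` contains the fragment `K` with inner edge `{a, b}`: the trivalent vertices of `a` and of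
`b` are different and joined by an edge. The legs of the fragment, numbered 1, 2, 3, 4 from left to
right in the planar picture of two arches joined by an edge, are `next a`, `next (next a)`,
`next b`, `next (next b)`. -/
def HasK (F : FeynmanDiagram H) (a b : H) : Prop :=
  F.Trivalent a ∧ F.Trivalent b ∧ ¬ F.SameVertex a b ∧ F.edge a = b

/-- `G` is obtained from `F`, which contains the fragment `K` with inner edge `{a, b}`, by putting
in the place of `K` the fragment that consists of two disjoint arcs: one arc carries a bubble and
joins the legs `p` and `p'` of the fragment, the other is a plain edge which joins the legs `q`
and `q'`. Here `p` and `q` are the legs of `K` at the vertex of `a`, and `p'` and `q'` are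
those at the vertex of `b`. The half-edges and the vertices of `F` are kept: the two vertices of
`K` become those of the bubble, with ends `p` and `p'`. The last condition on `F` says that
`q` and `q'` are not joined outside the fragment (else the plain arc would close up to a loop
without vertices, and there is no Feynman diagram `G`). -/
def IsKReplacement (F : FeynmanDiagram H) (a b p p' q q' : H) (G : FeynmanDiagram H) : Prop :=
  F.edge q ≠ q' ∧
    G.next = F.next ∧ G.wilson = F.wilson ∧ G.IsBubble p p' ∧
    G.edge (F.edge q) = F.edge q' ∧
    ∀ h, h ≠ a → h ≠ b → h ≠ q → h ≠ q' → h ≠ F.edge q → h ≠ F.edge q' → G.edge h = F.edge h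

end FeynmanDiagram

/-! ### Alexander polynomial of closed braids and singular braids -/

/-- The (unreduced) Burau matrix of the generator `i` of the braid group on `m + 1` strands (if the
second argument is `true`) or of its inverse (if it is `false`): it is the identity outside the
block of the rows and columns `i`, `i + 1`, where it is `[1 - t, t; 1, 0]`, respectively
`[0, 1; t⁻¹, 1 - t⁻¹]`. -/
noncomputable def burau {m : ℕ} (i : Fin m) : Bool → Matrix (Fin (m + 1)) (Fin (m + 1)) ℤ[T;T⁻¹]
  | true => fun j k =>
      if j = i.castSucc then
        if k = i.castSucc then 1 - LaurentPolynomial.T 1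
        else if k = i.succ then LaurentPolynomial.T 1 else 0
      else if j = i.succ then (if k = i.castSucc then 1 else 0)
      else if j = k then 1 else 0
  | false => fun j k =>
      if j = i.castSucc then (if k = i.succ then 1 else 0)
      else if j = i.succ then
        if k = i.castSucc then LaurentPolynomial.T (-1)
        else if k = i.succ then 1 - LaurentPolynomial.T (-1) else 0
      else if j = k then 1 else 0

/-- The exponent sum (writhe) of a braid word. -/
def writhe {m : ℕ} (w : List (Fin m × Bool)) : ℤ :=
  (w.map fun c => if c.2 then (1 : ℤ) else -1).sum

/-- The Alexander polynomial of the closure of the braid word `w` on `m + 1` strands, when this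
closure is a knot: the minor of the Alexander matrix `1 - burau w` (computed from the presentation
of the knot group by the braid), normalised by a power of `t` so that
`Δ(t) = Δ(t⁻¹)` and `Δ(1) = 1`. For knots the number `m - writhe w` is even. -/
noncomputable def alexander {m : ℕ} (w : List (Fin m × Bool)) : ℤ[T;T⁻¹] :=
  LaurentPolynomial.T (((m : ℤ) - writhe w) / 2) *
    ((1 - (w.map fun c => burau c.1 c.2).prod).submatrix Fin.succ Fin.succ).det

/-- The crossings of a singular braid. -/
inductive CrossingKind
  | positive
  | negative
  | singular

/-- The letters of a singular braid on `m + 1` strands: `(i, k)` is a crossing (or a transverse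
double point) between the strands in the positions `i` and `i + 1`. -/
abbrev SingularBraid (m : ℕ) : Type := List (Fin m × CrossingKind)

namespace SingularBraid

variable {m : ℕ}

/-- The permutation of a singular braid: the strand which starts in the position `p` ends in the
position `endpoint w p`. -/
def endpoint : SingularBraid m → Equiv.Perm (Fin (m + 1))
  | [] => 1
  | c :: w => endpoint w * Equiv.swap c.1.castSucc c.1.succ

/-- The closure of the singular braid is a (singular) knot, i.e. it has one component. -/
def ClosesToKnot (w : SingularBraid m) : Prop := ∀ p q, ∃ k : ℕ, (endpoint w ^ k) p = q

/-- The numbers of the double points which are met by the strand that starts in the position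
`p`; the letters of the word are numbered from `k` on. -/
def encounters : SingularBraid m → ℕ → Fin (m + 1) → List ℕ
  | [], _, _ => []
  | (i, .singular) :: w, k, p =>
      if p = i.castSucc ∨ p = i.succ then
        k :: encounters w (k + 1) (Equiv.swap i.castSucc i.succ p)
      else encounters w (k + 1) p
  | (i, _) :: w, k, p => encounters w (k + 1) (Equiv.swap i.castSucc i.succ p)

/-- The sequence of double points met when one travels once along the singular knot. Each double
point occurs in it twice. -/
def gaussWord (w : SingularBraid m) : List ℕ :=
  (List.range (m + 1)).flatMap fun r => encounters w 0 ((endpoint w ^ r) 0)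

/-- The number of double points. -/
def numSingular : SingularBraid m → ℕ
  | [] => 0
  | (_, .singular) :: w => numSingular w + 1
  | _ :: w => numSingular w

/-- The braids obtained by resolving every double point in the two possible ways, with the sign
`(-1) ^ (number of double points which are resolved negatively)`. -/
def resolutions : SingularBraid m → List (ℤ × List (Fin m × Bool))
  | [] => [(1, [])]
  | (i, .positive) :: w => (resolutions w).map fun r => (r.1, (i, true) :: r.2)
  | (i, .negative) :: w => (resolutions w).map fun r => (r.1, (i, false) :: r.2)
  | (i, .singular) :: w =>
      ((resolutions w).map fun r => (r.1, (i, true) :: r.2)) ++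
        (resolutions w).map fun r => (-r.1, (i, false) :: r.2)

/-- The extension of the Alexander polynomial to singular knots: the alternating sum over all
resolutions of the double points. -/
noncomputable def alexander (w : SingularBraid m) : ℤ[T;T⁻¹] :=
  ((resolutions w).map fun r => r.1 • _root_.alexander r.2).sum

/-- The expansion of the Alexander polynomial of a singular knot at `t = e^z`, as a power series
in `z`. -/
noncomputable def alexanderSeries (w : SingularBraid m) : ℚ⟦X⟧ :=
  LaurentPolynomial.eval₂ (Int.castRingHom ℚ⟦X⟧) (PowerSeries.isUnit_exp ℚ).unit (alexander w)

/-- `D` is the chord diagram of the singular knot which is the closure of `w`: the legs of `D` on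
its circle correspond to the passages through double points, and the chords join the two
passages through the same double point. -/
def HasChordDiagram (w : SingularBraid m) {H : Type} (D : FeynmanDiagram H) : Prop :=
  D.IsChordDiagram ∧ ∃ f : H → ℕ, D.wilson.map f = ↑(gaussWord w) ∧
    ∀ h k, f h = f k ↔ k = h ∨ k = D.edge h

end SingularBraid

/-- `C` is the Vassiliev series of the Alexander-Conway polynomial, as a function on Feynman
diagrams. On a chord diagram `D` with `n` chords it is the symbol of the Alexander-Conway
invariant: the value, on any singular knot with `n` double points and chord diagram `D`, of the
coefficient of `z ^ n` in `Δ(e^z)`. It is extended to all Feynman diagrams (up to equivalence) by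
the three-term relation `C(D_Y) = C(D_||) - C(D_X)` at the legs. -/
structure IsAlexanderConwaySeries (C : (H : Type) → FeynmanDiagram H → ℚ) : Prop where
  equivalent : ∀ (H H' : Type) (F : FeynmanDiagram H) (F' : FeynmanDiagram H'),
    F.Equivalent F' → C H F = C H' F'
  symbol : ∀ (m : ℕ) (w : SingularBraid m) (H : Type) (D : FeynmanDiagram H),
    w.ClosesToKnot → w.HasChordDiagram D →
      C H D = PowerSeries.coeff w.numSingular w.alexanderSeries
  three_term : ∀ (H H₁ H₂ : Type) (Y : FeynmanDiagram H) (P : FeynmanDiagram H₁)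
    (X : FeynmanDiagram H₂) (l : H) (L : List H),
    Y.next l = l → Y.Trivalent (Y.edge l) →
    Y.IsOpening l L (Y.next (Y.next (Y.edge l))) (Y.next (Y.edge l)) P →
    Y.IsOpening l L (Y.next (Y.edge l)) (Y.next (Y.next (Y.edge l))) X →
    C H Y = C H₁ P - C H₂ X

/-! The series has an explicit formula. Regard the Wilson line as one more vertex, whose cyclic
order is that of the legs. A choice of the given or the reversed cyclic order at every trivalent
vertex then makes the diagram a ribbon graph, and `conway` is the signed count of the choices for
which its boundary is connected; each vertex that keeps its given order contributes a factor -1.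
Boundary components are the orbits of `tour` (cross an edge, then turn), so everything becomes a
question of when a map has a single orbit. The main tool is that this depends only on the first
return map to a set that every orbit meets (`singleOrbit_iff_of_return`).

Existence: by the skein relation, the alternating sum over the resolutions of n double points is, up
to a power of t, (1 - t)^n times the Alexander minor of the braid in which all double points are
smoothed. At t = e^z its coefficient of z^n is (-1)^n times the minor at t = 1. There the Burau
matrices become permutation matrices, and the minor is 1 if the smoothing is a knot and 0 otherwise;
in the first case n is even. The components of the smoothing correspond to the boundary components
of the ribbon graph of the chord diagram (`singleOrbit_smoothPerm_iff`). The three-term relation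
holds because contracting the edge from a leg to a trivalent vertex does not change the number of
boundary components, and the two cyclic orders at the vertex give the two orders of the new legs
(`conway_three_term`).

Uniqueness: every chord diagram is realised by the closure of a singular braid, and the three-term
relation reduces any other diagram to diagrams with fewer half-edges.

Relations: by uniqueness they need only be shown for `conway`. Equal choices at the two vertices of
a bubble create a separate boundary component. Opposite choices make the boundary turn back at both
ends and carry the sign -1, so a bubble amounts to cutting its arc, with the factor -2. For a chord
between two legs this is relation 1. At a trivalent vertex where a cut arc ends, the cyclic order no
longer matters, so the two choices cancel; this is relation 2.

For the fragment `K`, the outside enters only through a permutation of the six half-edges which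
exchanges the two halves of the inner edge. The alternating sum over the four choices at the two
vertices is minus a signed sum of four patterns in which one arc is cut and the other is joined.
This is a finite identity (`vertexTurns_visitsAll`). Each pattern is -1/2 times the value of the
corresponding replacement diagram (`HasK.conway_replacement`), whence relation 4. In relation 3
every pattern has a cut arc that ends at a further trivalent vertex, so it vanishes as in relation
2. -/

/-! ### Maps with a single orbit, and first return maps -/

/-- A map has a single orbit if all its invariant predicates are constant. For a bijection of a
finite set this means that it is a single cycle. -/
def SingleOrbit {X : Type*} (f : X → X) : Prop :=
  ∀ c : X → Prop, (∀ x, c (f x) ↔ c x) → ∀ x y, c x → c y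

/-- `y` is the first point outside `Z` on the forward orbit of `x`. -/
inductive FirstExit {X : Type*} (f : X → X) (Z : Set X) : X → X → Prop
  | here {x : X} (hx : x ∉ Z) : FirstExit f Z x x
  | step {x y : X} (hx : x ∈ Z) (h : FirstExit f Z (f x) y) : FirstExit f Z x y

namespace FirstExit

variable {X : Type*} {f : X → X} {Z : Set X} {x y y' : X}

theorem notMem (h : FirstExit f Z x y) : y ∉ Z := by
  induction h with
  | here hx => exact hx
  | step _ _ ih => exact ih

theorem unique (h : FirstExit f Z x y) (h' : FirstExit f Z x y') : y = y' := by
  induction h with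
  | here hx =>
    cases h' with
    | here _ => rfl
    | step hx' _ => exact absurd hx' hx
  | step hx _ ih =>
    cases h' with
    | here hx' => exact absurd hx hx'
    | step _ h' => exact ih h'

theorem invariant (h : FirstExit f Z x y) {c : X → Prop} (hc : ∀ x, c (f x) ↔ c x) :
    c x ↔ c y := by
  induction h with
  | here _ => rfl
  | step _ _ ih => rw [← hc, ih]

theorem exists_of_iterate (n : ℕ) : ∀ x, f^[n] x ∉ Z → ∃ y, FirstExit f Z x y := by
  induction n with
  | zero => exact fun x hx => ⟨x, .here hx⟩
  | succ n ih =>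
    intro x hx
    by_cases h : x ∈ Z
    · obtain ⟨y, hy⟩ := ih (f x) hx
      exact ⟨y, .step h hy⟩
    · exact ⟨x, .here h⟩

/-- Walking back from `y` retraces the path through `Z` and arrives at `x`. This is what makes first
return maps of injective maps injective. -/
theorem inverse {g : X → X} (hg : ∀ x, g (f x) = x) (h : FirstExit f Z x y) :
    ∀ z, FirstExit g Z (g x) z → FirstExit g Z (g y) z := by
  induction h with
  | here _ => exact fun z hz => hz
  | step hx _ ih =>
    intro z hz
    apply ih
    rw [hg]
    exact .step hx hz

end FirstExit

/-- A map has a single orbit if and only if its first return map has. -/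
theorem singleOrbit_iff_of_return {X Y : Type*} {f : X → X} {Z : Set X} (i : Y → X) {φ : Y → Y}
    (hi : Function.Injective i) (hZ : ∀ x, x ∉ Z ↔ x ∈ Set.range i)
    (hφ : ∀ y, FirstExit f Z (f (i y)) (i (φ y))) (hf : ∀ x ∈ Z, ∃ y, FirstExit f Z x y) :
    SingleOrbit f ↔ SingleOrbit φ := by
  have hf' : ∀ x, ∃ y, FirstExit f Z x (i y) := by
    intro x
    by_cases hx : x ∈ Z
    · obtain ⟨y, hy⟩ := hf x hx
      obtain ⟨z, rfl⟩ := (hZ y).1 hy.notMem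
      exact ⟨z, hy⟩
    · obtain ⟨z, rfl⟩ := (hZ x).1 hx
      exact ⟨z, .here hx⟩
  have hiZ : ∀ y, i y ∉ Z := fun y => (hZ _).2 ⟨y, rfl⟩
  constructor
  · intro h c hc x y hx
    -- An invariant predicate of the return map is extended to all points by its value at the first
    -- exit.
    have := h (fun x => ∃ y, FirstExit f Z x (i y) ∧ c y) ?_ (i x) (i y)
      ⟨x, .here (hiZ x), hx⟩
    · obtain ⟨z, hz, hcz⟩ := this
      rwa [hi ((FirstExit.here (hiZ y)).unique hz)]
    · intro x
      by_cases hx : x ∈ Z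
      · constructor
        · rintro ⟨y, hy, hcy⟩
          exact ⟨y, .step hx hy, hcy⟩
        · rintro ⟨y, hy, hcy⟩
          cases hy with
          | here h => exact absurd hx h
          | step _ hy => exact ⟨y, hy, hcy⟩
      · obtain ⟨y, rfl⟩ := (hZ x).1 hx
        constructor
        · rintro ⟨z, hz, hcz⟩
          refine ⟨y, .here hx, ?_⟩
          rwa [← hi ((hφ y).unique hz), hc] at hcz
        · rintro ⟨z, hz, hcz⟩
          refine ⟨φ y, hφ y, ?_⟩
          rwa [hc, hi ((FirstExit.here (hiZ y)).unique hz)]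
  · intro h c hc x y hx
    obtain ⟨x', hx'⟩ := hf' x
    obtain ⟨y', hy'⟩ := hf' y
    rw [hy'.invariant hc]
    refine h (fun y => c (i y)) (fun y => ?_) x' y' ((hx'.invariant hc).1 hx)
    rw [← (hφ y).invariant hc, hc]

/-- Two maps with the same first return map outside `Z`. -/
theorem singleOrbit_congr_of_return {X : Type*} {f g : X → X} {Z : Set X}
    (h : ∀ x, x ∉ Z → ∃ y, FirstExit f Z (f x) y ∧ FirstExit g Z (g x) y)
    (hf : ∀ x ∈ Z, ∃ y, FirstExit f Z x y) (hg : ∀ x ∈ Z, ∃ y, FirstExit g Z x y) :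
    SingleOrbit f ↔ SingleOrbit g := by
  choose! r hr using h
  have hrZ : ∀ x : {x // x ∉ Z}, r x ∉ Z := fun x => (hr x x.2).1.notMem
  rw [singleOrbit_iff_of_return (f := f) (Z := Z) (Subtype.val : {x // x ∉ Z} → X)
      (φ := fun x => ⟨r x, hrZ x⟩) Subtype.val_injective (by simp) (fun x => (hr x x.2).1) hf,
    singleOrbit_iff_of_return (f := g) (Z := Z) (Subtype.val : {x // x ∉ Z} → X)
      (φ := fun x => ⟨r x, hrZ x⟩) Subtype.val_injective (by simp) (fun x => (hr x x.2).2) hg]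

/-- This vacuous case gives the bare Wilson line, without legs, the value 1, as for the unknot. -/
theorem singleOrbit_of_isEmpty {X : Type*} [IsEmpty X] (f : X → X) : SingleOrbit f :=
  fun _ _ x => isEmptyElim x

theorem not_singleOrbit {X : Type*} {f : X → X} (c : X → Prop) (hc : ∀ x, c (f x) ↔ c x) {x y : X}
    (hx : c x) (hy : ¬ c y) : ¬ SingleOrbit f :=
  fun h => hy (h c hc x y hx)

theorem SingleOrbit.of_iterate {X : Type*} {f : X → X} (x₀ : X) (h : ∀ y, ∃ n : ℕ, f^[n] x₀ = y) :
    SingleOrbit f := by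
  intro c hc x y hx
  have key : ∀ n, c (f^[n] x₀) ↔ c x₀ := by
    intro n
    induction n with
    | zero => rfl
    | succ n ih => rw [Function.iterate_succ_apply', hc, ih]
  obtain ⟨n, rfl⟩ := h x
  obtain ⟨k, rfl⟩ := h y
  rw [key] at hx ⊢
  exact hx

theorem exists_iterate_succ_eq {X : Type*} [Finite X] {f : X → X} (hf : Function.Injective f)
    (x : X) : ∃ n : ℕ, f^[n + 1] x = x := by
  obtain ⟨n, hn, h⟩ := Function.mem_periodicPts.1 (hf.mem_periodicPts x)
  obtain ⟨k, rfl⟩ := Nat.exists_eq_succ_of_ne_zero hn.ne'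
  exact ⟨k, h⟩

theorem SingleOrbit.exists_iterate {X : Type*} [Finite X] {f : X → X} (h : SingleOrbit f)
    (hf : Function.Injective f) (x y : X) : ∃ n : ℕ, f^[n] x = y := by
  refine h (fun y => ∃ n : ℕ, f^[n] x = y) (fun y => ⟨?_, ?_⟩) x y ⟨0, rfl⟩
  · rintro ⟨n, hn⟩
    obtain ⟨k, hk⟩ := exists_iterate_succ_eq hf y
    refine ⟨k + n, ?_⟩
    rw [Function.iterate_add_apply, hn, ← Function.iterate_succ_apply, hk]
  · rintro ⟨n, rfl⟩
    exact ⟨n + 1, Function.iterate_succ_apply' _ _ _⟩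

/-- The orbit of `0` is everything, as a decidable condition. -/
def visitsAll {k : ℕ} (f : Fin (k + 1) → Fin (k + 1)) : Bool :=
  decide (∀ r, r ∈ List.iterate f 0 (k + 1))

/-- The period of `0` is at most `k + 1`, so that many iterates exhaust its orbit; this makes the
condition decidable. -/
theorem singleOrbit_iff_visitsAll {k : ℕ} {f : Fin (k + 1) → Fin (k + 1)}
    (hf : Function.Injective f) : SingleOrbit f ↔ visitsAll f = true := by
  rw [visitsAll, decide_eq_true_iff]
  constructor
  · intro h r
    obtain ⟨n, hn⟩ := h.exists_iterate hf 0 r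
    rw [List.mem_iterate]
    refine ⟨n % Function.minimalPeriod f 0, ?_, ?_⟩
    · refine (Nat.mod_lt _ (Function.minimalPeriod_pos_of_mem_periodicPts
        (hf.mem_periodicPts 0))).trans_le ?_
      simpa using Function.minimalPeriod_le_card (f := f) (x := (0 : Fin (k + 1)))
    · rw [← hn, Function.iterate_mod_minimalPeriod_eq]
  · intro h
    refine .of_iterate 0 fun y => ?_
    obtain ⟨n, -, hn⟩ := List.mem_iterate.1 (h y)
    exact ⟨n, hn.symm⟩

open Classical in
/-- The map `ψ`, followed by the map `τ` on the points `i 0`, ..., `i (k - 1)`. -/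
noncomputable def insertMap {X : Type*} {k : ℕ} (ψ : X → X) (i : Fin k → X) (τ : Fin k → Fin k)
    (x : X) : X :=
  if h : ∃ r, ψ x = i r then i (τ h.choose) else ψ x

theorem insertMap_of_eq {X : Type*} {k : ℕ} {ψ : X → X} {i : Fin k → X}
    (hi : Function.Injective i) (τ : Fin k → Fin k) {x : X} {r : Fin k} (h : ψ x = i r) :
    insertMap ψ i τ x = i (τ r) := by
  have h' : ∃ r, ψ x = i r := ⟨r, h⟩
  rw [insertMap, dif_pos h', hi (h'.choose_spec.symm.trans h)]

theorem insertMap_of_ne {X : Type*} {k : ℕ} {ψ : X → X} {i : Fin k → X} (τ : Fin k → Fin k) {x : X}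
    (h : ψ x ∉ Set.range i) : insertMap ψ i τ x = ψ x := by
  rw [insertMap, dif_neg]
  rintro ⟨r, hr⟩
  exact h ⟨r, hr.symm⟩

/-- Only the first return map of `ψ` to the points `i r` matters for the number of orbits of
`ψ` composed with maps of these points. -/
theorem exists_return_insertMap {X : Type*} [Finite X] {k : ℕ} {ψ : X → X}
    (hψ : Function.Injective ψ) {i : Fin k → X} (hi : Function.Injective i) (hk : 0 < k) :
    (∀ τ : Fin k → Fin k, ¬ SingleOrbit (insertMap ψ i τ)) ∨
      ∃ π : Fin k → Fin k, Function.Injective π ∧ (∀ r s, ψ (i r) = i s → π r = s) ∧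
        ∀ τ : Fin k → Fin k, SingleOrbit (insertMap ψ i τ) ↔ SingleOrbit (τ ∘ π) := by
  set Z : Set X := (Set.range i)ᶜ with hZdef
  have hiZ : ∀ r, i r ∉ Z := fun r h => h ⟨r, rfl⟩
  have hret : ∀ r, ∃ s, FirstExit ψ Z (ψ (i r)) (i s) := by
    intro r
    obtain ⟨n, hn⟩ := exists_iterate_succ_eq hψ (i r)
    rw [Function.iterate_succ_apply] at hn
    obtain ⟨y, hy⟩ := FirstExit.exists_of_iterate (Z := Z) n (ψ (i r)) (by rw [hn]; exact hiZ r)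
    have := hy.notMem
    rw [hZdef, Set.notMem_compl_iff] at this
    obtain ⟨s, rfl⟩ := this
    exact ⟨s, hy⟩
  -- Either every orbit of `ψ` meets the marked points, or some orbit avoids them and survives
  -- unchanged in every modified map.
  by_cases hall : ∀ x, ∃ r, FirstExit ψ Z x (i r)
  · right
    choose π hπ using hret
    obtain ⟨g, hg⟩ := (Finite.injective_iff_bijective.1 hψ).surjective.hasRightInverse
    have hg' : ∀ x, g (ψ x) = x := fun x => hψ (hg _)
    refine ⟨π, ?_, ?_, ?_⟩
    · intro r s hrs
      have h1 := (hπ r).inverse hg' (i r) (by rw [hg']; exact .here (hiZ r))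
      have h2 := (hπ s).inverse hg' (i s) (by rw [hg']; exact .here (hiZ s))
      rw [hrs] at h1
      exact hi (h1.unique h2)
    · intro r s hrs
      have := hπ r
      rw [hrs] at this
      exact hi (this.unique (.here (hiZ s)))
    · intro τ
      have key : ∀ x y, FirstExit ψ Z x y → ∀ x', ψ x' = x → ∀ r, y = i r →
          FirstExit (insertMap ψ i τ) Z (insertMap ψ i τ x') (i (τ r)) := by
        intro x y h
        induction h with
        | here hx =>
          rintro x' hx' r rfl
          rw [insertMap_of_eq hi τ hx']
          exact .here (hiZ _)
        | step hx h ih =>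
          rintro x' rfl r rfl
          rw [insertMap_of_ne τ hx]
          exact .step hx (ih _ rfl r rfl)
      refine singleOrbit_iff_of_return (Z := Z) i hi (by simp [hZdef]) ?_ ?_
      · intro r
        exact key _ _ (hπ r) _ rfl _ rfl
      · intro x hx
        obtain ⟨r, hr⟩ := hall x
        cases hr with
        | here h => exact absurd hx h
        | step _ h => exact ⟨_, .step hx (key _ _ h _ rfl _ rfl)⟩
  · left
    intro τ
    push Not at hall
    obtain ⟨x, hx⟩ := hall
    -- The points from which `ψ` leads to a marked point form a set that is invariant under every
    -- modified map, because `τ` only permits jumps between marked points.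
    refine not_singleOrbit (fun x => ∃ r, FirstExit ψ Z x (i r)) ?_
      (x := i ⟨0, hk⟩) (y := x) ⟨⟨0, hk⟩, .here (hiZ _)⟩ (fun ⟨r, hr⟩ => hx r hr)
    intro x
    have step : (∃ r, FirstExit ψ Z (insertMap ψ i τ x) (i r)) ↔
        ∃ r, FirstExit ψ Z (ψ x) (i r) := by
      by_cases h : ∃ r, ψ x = i r
      · obtain ⟨r, hr⟩ := h
        rw [insertMap_of_eq hi τ hr, hr]
        exact ⟨fun _ => ⟨_, .here (hiZ _)⟩, fun _ => ⟨_, .here (hiZ _)⟩⟩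
      · rw [insertMap_of_ne]
        rintro ⟨r, hr⟩
        exact h ⟨r, hr.symm⟩
    rw [step]
    by_cases hx : x ∈ Z
    · constructor
      · rintro ⟨r, hr⟩
        exact ⟨r, .step hx hr⟩
      · rintro ⟨r, hr⟩
        cases hr with
        | here h => exact absurd hx h
        | step _ h => exact ⟨r, h⟩
    · have : x ∈ Set.range i := by simpa [hZdef] using hx
      obtain ⟨r, rfl⟩ := this
      exact ⟨fun _ => ⟨r, .here hx⟩, fun _ => hret r⟩

/-- The indicator of a proposition. -/
noncomputable def indicator01 (p : Prop) : ℚ :=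
  open Classical in if p then 1 else 0

theorem indicator01_true {p : Prop} (h : p) : indicator01 p = 1 := by simp [indicator01, h]

theorem indicator01_false {p : Prop} (h : ¬ p) : indicator01 p = 0 := by simp [indicator01, h]

namespace FeynmanDiagram

variable {H H' : Type} (F : FeynmanDiagram H)

/-! ### The formula for the Alexander-Conway series -/

theorem next_injective : Function.Injective F.next := fun x y h => by
  rw [← F.next_next_next x, h, F.next_next_next]

theorem edge_injective : Function.Injective F.edge := fun x y h => by
  rw [← F.edge_edge x, h, F.edge_edge]

theorem next_next_eq_self_iff {h : H} : F.next (F.next h) = h ↔ F.next h = h := by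
  constructor
  · intro e
    have := F.next_next_next h
    rwa [e] at this
  · intro e
    rw [e, e]

/-- The cyclic permutation of the legs along the Wilson line. -/
noncomputable def around : Equiv.Perm H :=
  open Classical in F.wilson.formPerm F.nodup_wilson

theorem around_of_trivalent {h : H} (hh : F.Trivalent h) : F.around h = h := by
  classical
  exact Cycle.formPerm_eq_self_of_notMem F.wilson F.nodup_wilson h
    (fun hm => hh ((F.mem_wilson h).1 hm))

theorem around_eq_formPerm [DecidableEq H] {L : List H} (h : F.wilson = ↑L) :
    F.around = L.formPerm := by
  have key : ∀ (c : Cycle H) (hc : c.Nodup), c = ↑L → c.formPerm hc = L.formPerm := by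
    rintro _ hc rfl
    exact Cycle.formPerm_coe L hc
  rw [← key _ F.nodup_wilson h, around]
  congr!

theorem Trivalent.next {F : FeynmanDiagram H} {h : H} (hh : F.Trivalent h) :
    F.Trivalent (F.next h) := fun e => hh (F.next_injective e)

theorem trivalent_next_iff {h : H} : F.Trivalent (F.next h) ↔ F.Trivalent h :=
  ⟨fun hh e => hh (by rw [e, e]), Trivalent.next⟩

theorem trivalent_around_iff {h : H} : F.Trivalent (F.around h) ↔ F.Trivalent h := by
  constructor
  · intro hh
    have := F.around_of_trivalent hh
    rwa [F.around.injective this] at hh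
  · intro hh
    rwa [F.around_of_trivalent hh]

/-- The set of half-edges at the vertex of `h`. -/
def vertex (h : H) : Set H := {k | F.SameVertex h k}

theorem mem_vertex {h k : H} :
    k ∈ F.vertex h ↔ k = h ∨ k = F.next h ∨ k = F.next (F.next h) := Iff.rfl

theorem self_mem_vertex (h : H) : h ∈ F.vertex h := Or.inl rfl

theorem next_mem_vertex_iff {h k : H} : F.next k ∈ F.vertex h ↔ k ∈ F.vertex h := by
  simp only [mem_vertex]
  constructor
  · rintro (e | e | e)
    · right; right
      rw [← e, F.next_next_next]
    · left
      exact F.next_injective e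
    · right; left
      exact F.next_injective e
  · rintro (e | e | e) <;> subst e <;> simp [F.next_next_next]

theorem vertex_eq_of_mem {h k : H} (hk : k ∈ F.vertex h) : F.vertex k = F.vertex h := by
  ext x
  rcases hk with rfl | rfl | rfl <;> simp only [mem_vertex, F.next_next_next] <;> tauto

theorem mem_vertex_comm {h k : H} : k ∈ F.vertex h ↔ h ∈ F.vertex k :=
  ⟨fun hk => F.vertex_eq_of_mem hk ▸ F.self_mem_vertex h,
    fun hk => F.vertex_eq_of_mem hk ▸ F.self_mem_vertex k⟩

theorem trivalent_iff_of_mem_vertex {h k : H} (hk : k ∈ F.vertex h) :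
    F.Trivalent k ↔ F.Trivalent h := by
  rcases hk with rfl | rfl | rfl <;> simp only [trivalent_next_iff]

theorem disjoint_vertex {h k : H} (hk : k ∉ F.vertex h) :
    Disjoint (F.vertex k) (F.vertex h) := by
  rw [Set.disjoint_left]
  intro x hx hx'
  rw [← F.vertex_eq_of_mem hx', F.vertex_eq_of_mem hx] at hk
  exact hk (F.self_mem_vertex k)

theorem ncard_vertex {h : H} (hh : F.Trivalent h) : (F.vertex h).ncard = 3 := by
  rw [Set.ncard_eq_three]
  refine ⟨h, F.next h, F.next (F.next h), fun e => hh e.symm, fun e => hh ?_,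
    fun e => hh (F.next_injective e.symm), rfl⟩
  exact F.next_next_eq_self_iff.1 e.symm

/-- The sets of trivalent vertices (as sets of half-edges), as choices of the vertices at which
the cyclic order is not reversed. -/
def orientations : Set (Set H) := {S | (∀ h ∈ S, F.Trivalent h) ∧ ∀ h ∈ S, F.next h ∈ S}

theorem next_mem_iff {S : Set H} (hS : S ∈ F.orientations) {h : H} : F.next h ∈ S ↔ h ∈ S := by
  refine ⟨fun hh => ?_, hS.2 h⟩
  have := hS.2 _ (hS.2 _ hh)
  rwa [F.next_next_next] at this

theorem vertex_subset {S : Set H} (hS : S ∈ F.orientations) {h : H} (hh : h ∈ S) :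
    F.vertex h ⊆ S := by
  rintro k (rfl | rfl | rfl)
  exacts [hh, hS.2 _ hh, hS.2 _ (hS.2 _ hh)]

theorem disjoint_vertex_of_notMem {S : Set H} (hS : S ∈ F.orientations) {h : H} (hh : h ∉ S) :
    Disjoint S (F.vertex h) := by
  rw [Set.disjoint_left]
  intro k hk hk'
  exact hh (F.vertex_subset hS hk (F.mem_vertex_comm.1 hk'))

theorem union_vertex_mem {S : Set H} (hS : S ∈ F.orientations) {h : H} (hh : F.Trivalent h) :
    S ∪ F.vertex h ∈ F.orientations := by
  constructor
  · rintro k (hk | hk)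
    · exact hS.1 k hk
    · exact (F.trivalent_iff_of_mem_vertex hk).2 hh
  · rintro k (hk | hk)
    · exact Or.inl (hS.2 k hk)
    · exact Or.inr (F.next_mem_vertex_iff.2 hk)

theorem diff_vertex_mem {S : Set H} (hS : S ∈ F.orientations) (h : H) :
    S \ F.vertex h ∈ F.orientations := by
  constructor
  · exact fun k hk => hS.1 k hk.1
  · exact fun k hk => ⟨hS.2 k hk.1, fun h' => hk.2 (F.next_mem_vertex_iff.1 h')⟩

open Classical in
/-- The following half-edge at the same vertex, in the cyclic order at the vertices in `S` and in
the reversed cyclic order at the other vertices. -/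
noncomputable def turn (S : Set H) (h : H) : H :=
  if h ∈ S then F.next h else F.next (F.next h)

theorem turn_of_mem {S : Set H} {h : H} (hh : h ∈ S) : F.turn S h = F.next h := if_pos hh

theorem turn_of_notMem {S : Set H} {h : H} (hh : h ∉ S) : F.turn S h = F.next (F.next h) :=
  if_neg hh

theorem turn_union_vertex (S : Set H) {p h : H} (hh : h ∈ F.vertex p) :
    F.turn (S ∪ F.vertex p) h = F.next h := F.turn_of_mem (Or.inr hh)

theorem turn_of_leg (S : Set H) {l : H} (hl : F.next l = l) : F.turn S l = l := by
  by_cases h : l ∈ S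
  · rw [turn_of_mem _ h, hl]
  · rw [turn_of_notMem _ h, hl, hl]

theorem turn_mem_vertex_iff (S : Set H) {h k : H} :
    F.turn S k ∈ F.vertex h ↔ k ∈ F.vertex h := by
  by_cases hk : k ∈ S
  · rw [turn_of_mem _ hk, next_mem_vertex_iff]
  · rw [turn_of_notMem _ hk, next_mem_vertex_iff, next_mem_vertex_iff]

theorem turn_mem_iff {S S' : Set H} (hS' : S' ∈ F.orientations) {k : H} :
    F.turn S k ∈ S' ↔ k ∈ S' := by
  by_cases hk : k ∈ S
  · rw [turn_of_mem _ hk, next_mem_iff _ hS']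
  · rw [turn_of_notMem _ hk, next_mem_iff _ hS', next_mem_iff _ hS']

theorem trivalent_turn_iff (S : Set H) {h : H} : F.Trivalent (F.turn S h) ↔ F.Trivalent h := by
  by_cases hk : h ∈ S
  · rw [turn_of_mem _ hk, trivalent_next_iff]
  · rw [turn_of_notMem _ hk, trivalent_next_iff, trivalent_next_iff]

theorem turn_injective {S : Set H} (hS : S ∈ F.orientations) : Function.Injective (F.turn S) := by
  intro x y h
  have : x ∈ S ↔ y ∈ S := by rw [← F.turn_mem_iff (S := S) hS, h, F.turn_mem_iff hS]
  by_cases hx : x ∈ S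
  · rw [turn_of_mem _ hx, turn_of_mem _ (this.1 hx)] at h
    exact F.next_injective h
  · rw [turn_of_notMem _ hx, turn_of_notMem _ (mt this.2 hx)] at h
    exact F.next_injective (F.next_injective h)

/-- The boundary walk of the ribbon graph of `F`: cross an edge, then turn at the vertex. The
Wilson line is regarded as one more vertex. -/
noncomputable def tour (S : Set H) (h : H) : H := F.around (F.turn S (F.edge h))

theorem tour_injective {S : Set H} (hS : S ∈ F.orientations) : Function.Injective (F.tour S) :=
  F.around.injective.comp ((F.turn_injective hS).comp F.edge_injective)

theorem tour_of_trivalent (S : Set H) {h : H} (hh : F.Trivalent (F.edge h)) :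
    F.tour S h = F.turn S (F.edge h) :=
  F.around_of_trivalent ((F.trivalent_turn_iff S).2 hh)

theorem tour_of_leg (S : Set H) {h : H} (hh : F.next (F.edge h) = F.edge h) :
    F.tour S h = F.around (F.edge h) := by
  rw [tour, F.turn_of_leg S hh]

/-- The alternating sum of `g` over the choices of cyclic orders with the reversed order on the
vertices that meet `P`. -/
noncomputable def orientationSum (P : Set H) (g : Set H → ℚ) : ℚ :=
  ∑ᶠ S ∈ {S | S ∈ F.orientations ∧ Disjoint S P}, (-1) ^ S.ncard * g S

/-- The value of the Alexander-Conway series: an alternating sum over the choices of cyclic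
orders at the trivalent vertices, which counts the ribbon graphs with one boundary component. -/
noncomputable def conway : ℚ :=
  F.orientationSum ∅ fun S => indicator01 (SingleOrbit (F.tour S))

variable {F}

theorem orientationSum_congr {P : Set H} {g g' : Set H → ℚ}
    (h : ∀ S ∈ F.orientations, Disjoint S P → g S = g' S) :
    F.orientationSum P g = F.orientationSum P g' :=
  finsum_mem_congr rfl fun S hS => by rw [h S hS.1 hS.2]

theorem orientationSum_sub (P : Set H) (g g' : Set H → ℚ) :
    F.orientationSum P (fun S => g S - g' S) = F.orientationSum P g - F.orientationSum P g' := by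
  have := F.finite
  rw [orientationSum, orientationSum, orientationSum, ← finsum_mem_sub_distrib]
  · simp only [mul_sub]
  · exact Set.toFinite _

theorem orientationSum_add (P : Set H) (g g' : Set H → ℚ) :
    F.orientationSum P (fun S => g S + g' S) = F.orientationSum P g + F.orientationSum P g' := by
  have := F.finite
  rw [orientationSum, orientationSum, orientationSum, ← finsum_mem_add_distrib]
  · simp only [mul_add]
  · exact Set.toFinite _

theorem orientationSum_const_mul (P : Set H) (r : ℚ) (g : Set H → ℚ) :
    F.orientationSum P (fun S => r * g S) = r * F.orientationSum P g := by
  have := F.finite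
  rw [orientationSum, orientationSum, mul_finsum_mem]
  · exact finsum_mem_congr rfl fun S _ => by ring

/-- The alternating sum over the two cyclic orders at one trivalent vertex. -/
theorem orientationSum_eq_vertex {P : Set H} {p : H} (hp : F.Trivalent p)
    (hP : Disjoint (F.vertex p) P) (g : Set H → ℚ) :
    F.orientationSum P g =
      F.orientationSum (P ∪ F.vertex p) (fun S => g S - g (S ∪ F.vertex p)) := by
  have := F.finite
  have key : {S | S ∈ F.orientations ∧ Disjoint S P} =
      {S | S ∈ F.orientations ∧ Disjoint S (P ∪ F.vertex p)} ∪
        (fun S => S ∪ F.vertex p) '' {S | S ∈ F.orientations ∧ Disjoint S (P ∪ F.vertex p)} := by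
    ext S
    constructor
    · rintro ⟨hS, hSP⟩
      by_cases h : p ∈ S
      · right
        refine ⟨S \ F.vertex p, ⟨F.diff_vertex_mem hS p, ?_⟩, ?_⟩
        · rw [Set.disjoint_union_right]
          exact ⟨hSP.mono_left Set.sdiff_subset, Set.disjoint_sdiff_left⟩
        · exact Set.sdiff_union_of_subset (F.vertex_subset hS h)
      · left
        refine ⟨hS, ?_⟩
        rw [Set.disjoint_union_right]
        exact ⟨hSP, F.disjoint_vertex_of_notMem hS h⟩
    · rintro (⟨hS, hSP⟩ | ⟨S, ⟨hS, hSP⟩, rfl⟩)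
      · rw [Set.disjoint_union_right] at hSP
        exact ⟨hS, hSP.1⟩
      · rw [Set.disjoint_union_right] at hSP
        refine ⟨F.union_vertex_mem hS hp, ?_⟩
        rw [Set.disjoint_union_left]
        exact ⟨hSP.1, hP⟩
  have hinj : Set.InjOn (fun S => S ∪ F.vertex p)
      {S | S ∈ F.orientations ∧ Disjoint S (P ∪ F.vertex p)} := by
    rintro S ⟨-, hS⟩ S' ⟨-, hS'⟩ h
    rw [Set.disjoint_union_right] at hS hS'
    simp only at h
    rw [← hS.2.sdiff_eq_left, ← hS'.2.sdiff_eq_left, ← Set.union_sdiff_right, h,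
      Set.union_sdiff_right]
  rw [orientationSum, key, finsum_mem_union _ (Set.toFinite _) (Set.toFinite _),
    finsum_mem_image hinj, ← finsum_mem_add_distrib (Set.toFinite _)]
  · refine finsum_mem_congr rfl fun S hS => ?_
    have hd := (Set.disjoint_union_right.1 hS.2).2
    -- A vertex adds three half-edges to `S`, an odd number, so the sign counts vertices.
    rw [Set.ncard_union_eq hd, F.ncard_vertex hp]
    ring
  · rw [Set.disjoint_left]
    rintro _ ⟨-, h⟩ ⟨S, -, rfl⟩
    rw [Set.disjoint_union_right] at h
    exact Set.disjoint_left.1 h.2 (Or.inr (F.self_mem_vertex p)) (F.self_mem_vertex p)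

/-- Comparison of the sums for two diagrams, one of which is a part of the other. -/
theorem orientationSum_image {F : FeynmanDiagram H} {D : FeynmanDiagram H'} (i : H' → H)
    (hi : Function.Injective i) {P : Set H}
    (hD : ∀ S' : Set H', S' ∈ D.orientations ↔ i '' S' ∈ F.orientations ∧ Disjoint (i '' S') P)
    (hF : ∀ S ∈ F.orientations, Disjoint S P → S ⊆ Set.range i) (g : Set H → ℚ) :
    F.orientationSum P g = D.orientationSum ∅ fun S' => g (i '' S') := by
  have : {S | S ∈ F.orientations ∧ Disjoint S P} =
      (fun S' => i '' S') '' {S | S ∈ D.orientations ∧ Disjoint S ∅} := by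
    ext S
    constructor
    · rintro ⟨hS, hSP⟩
      have h := Set.image_preimage_eq_of_subset (hF S hS hSP)
      refine ⟨i ⁻¹' S, ⟨(hD _).2 ?_, Set.disjoint_empty _⟩, h⟩
      rw [h]
      exact ⟨hS, hSP⟩
    · rintro ⟨S', ⟨hS', -⟩, rfl⟩
      exact (hD S').1 hS'
  rw [orientationSum, this, finsum_mem_image (hi.image_injective.injOn), orientationSum]
  exact finsum_mem_congr rfl fun S _ => by rw [Set.ncard_image_of_injective _ hi]

end FeynmanDiagram

/-! ### Relabelling cyclic lists, and invariance under equivalence -/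

theorem List.formPerm_map_apply {α β : Type*} [DecidableEq α] [DecidableEq β] {i : α → β}
    (hi : Function.Injective i) (L : List α) (x : α) :
    (L.map i).formPerm (i x) = i (L.formPerm x) := by
  induction L with
  | nil => simp
  | cons a L ih =>
    cases L with
    | nil => simp
    | cons b L =>
      simp only [List.map_cons, List.formPerm_cons_cons, Equiv.Perm.coe_mul,
        Function.comp_apply] at ih ⊢
      rw [ih, ← hi.map_swap]

/-- Renaming `l` to `y` in a cycle conjugates it by the transposition of `l` and `y`. An opening
renames the leg `l` of the Wilson line to `y` and then inserts `x` in front of it. -/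
theorem List.formPerm_replace_head {α : Type*} [DecidableEq α] {l y : α} {L : List α} (hl : l ∉ L)
    (hy : y ∉ L) (z : α) :
    (y :: L).formPerm (Equiv.swap l y z) = Equiv.swap l y ((l :: L).formPerm z) := by
  rw [← List.formPerm_map_apply (Equiv.swap l y).injective, List.map_cons, Equiv.swap_apply_left]
  congr 3
  conv_lhs => rw [← List.map_id L]
  refine List.map_congr_left fun z hz => ?_
  rw [Equiv.swap_apply_of_ne_of_ne, id]
  · rintro rfl
    exact hl hz
  · rintro rfl
    exact hy hz

namespace FeynmanDiagram

variable {H H' : Type}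

theorem around_map {D : FeynmanDiagram H'} [DecidableEq H] {i : H' → H}
    (hi : Function.Injective i) {L : List H} (hL : D.wilson.map i = ↑L) (h : H') :
    i (D.around h) = L.formPerm (i h) := by
  classical
  obtain ⟨K, hK⟩ := Quotient.exists_rep D.wilson
  have hK' : D.wilson = (K : Cycle H') := hK.symm
  rw [D.around_eq_formPerm hK', ← List.formPerm_map_apply hi]
  rw [hK'] at hL
  have hn : K.Nodup := by
    have := D.nodup_wilson
    rwa [hK'] at this
  have hr : K.map i ~r L := Cycle.coe_eq_coe.1 hL
  rw [List.formPerm_eq_of_isRotated (hn.map hi) hr]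

theorem conway_eq_of_equivalent {F : FeynmanDiagram H} {F' : FeynmanDiagram H'}
    (h : F.Equivalent F') : F.conway = F'.conway := by
  classical
  obtain ⟨e, hedge, hnext, hw⟩ := h
  have htri : ∀ h, F'.Trivalent (e h) ↔ F.Trivalent h := by
    intro h
    rw [Trivalent, Trivalent, ← hnext, e.injective.ne_iff]
  have horient : ∀ S, S ∈ F.orientations ↔ e '' S ∈ F'.orientations := by
    intro S
    simp only [orientations, Set.mem_ofPred_eq, Set.forall_mem_image, htri, ← hnext,
      e.injective.mem_set_image]
  have hF' : F'.conway = F.orientationSum ∅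
      fun S => indicator01 (SingleOrbit (F'.tour (e '' S))) := by
    refine orientationSum_image e e.injective (fun S => ?_) (fun S _ _ => ?_) _
    · rw [horient]
      simp
    · simp
  rw [hF']
  refine orientationSum_congr fun S _ _ => ?_
  congr 1
  have hturn : ∀ h, e (F.turn S h) = F'.turn (e '' S) (e h) := by
    intro h
    by_cases hS : h ∈ S
    · rw [turn_of_mem _ hS, turn_of_mem _ (Set.mem_image_of_mem e hS), hnext]
    · rw [turn_of_notMem _ hS, turn_of_notMem _ (by simpa using hS), hnext, hnext]
  have haround : ∀ h, e (F.around h) = F'.around (e h) := by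
    intro h
    obtain ⟨K, hK⟩ := Quotient.exists_rep F'.wilson
    have hK' : F'.wilson = (K : Cycle H') := hK.symm
    rw [around_map e.injective (hw.trans hK'), F'.around_eq_formPerm hK']
  rw [singleOrbit_iff_of_return (Z := ∅) e (φ := F.tour S) e.injective (by simp) _ (by simp)]
  intro h
  have : F'.tour (e '' S) (e h) = e (F.tour S h) := by
    rw [tour, tour, haround, hturn, hedge]
  rw [this]
  exact .here (by simp)

/-! ### Contracting the edge at a leg: the three-term relation -/

section Opening

variable {Y : FeynmanDiagram H} {D : FeynmanDiagram H'} {l : H} {i : H' → H}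

theorem orientations_opening (hi : Function.Injective i)
    (hleg : ∀ h, Y.SameVertex (Y.edge l) (i h) → D.next h = h)
    (hnext : ∀ h, ¬ Y.SameVertex (Y.edge l) (i h) → i (D.next h) = Y.next (i h)) (S' : Set H') :
    S' ∈ D.orientations ↔
      i '' S' ∈ Y.orientations ∧ Disjoint (i '' S') (Y.vertex (Y.edge l)) := by
  constructor
  · intro hS
    have hv : ∀ h ∈ S', ¬ Y.SameVertex (Y.edge l) (i h) := fun h hh hv => hS.1 h hh (hleg h hv)
    refine ⟨⟨?_, ?_⟩, ?_⟩
    · rintro _ ⟨h, hh, rfl⟩ e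
      rw [← hnext h (hv h hh)] at e
      exact hS.1 h hh (hi e)
    · rintro _ ⟨h, hh, rfl⟩
      exact ⟨_, hS.2 h hh, hnext h (hv h hh)⟩
    · rw [Set.disjoint_left]
      rintro _ ⟨h, hh, rfl⟩
      exact hv h hh
  · rintro ⟨⟨h1, h2⟩, h3⟩
    have hv : ∀ h ∈ S', ¬ Y.SameVertex (Y.edge l) (i h) := fun h hh hv =>
      Set.disjoint_left.1 h3 ⟨h, hh, rfl⟩ hv
    refine ⟨fun h hh e => ?_, fun h hh => ?_⟩
    · refine h1 (i h) ⟨h, hh, rfl⟩ ?_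
      rw [← hnext h (hv h hh), e]
    · obtain ⟨k, hk, e⟩ := h2 (i h) ⟨h, hh, rfl⟩
      rw [← hnext h (hv h hh)] at e
      rwa [← hi e]

/-- Contracting the edge between `l` and `a` merges the trivalent vertex with the Wilson line. If
the turns at the vertex are `a`, `x`, `y`, `a`, then `l` is followed by `x`, and `a` by the
successor of `l` on the Wilson line. Skipping `l` and `a` thus leaves the walk on the Wilson line
with `x`, `y` in the place of `l`. -/
theorem singleOrbit_tour_opening {L : List H} {x y : H} (hl : Y.next l = l)
    (ha : Y.Trivalent (Y.edge l)) (hi : Function.Injective i)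
    (hrange : ∀ h, h ∈ Set.range i ↔ h ≠ l ∧ h ≠ Y.edge l)
    (hedge : ∀ h, i (D.edge h) = Y.edge (i h))
    (hleg : ∀ h, Y.SameVertex (Y.edge l) (i h) → D.next h = h)
    (hnext : ∀ h, ¬ Y.SameVertex (Y.edge l) (i h) → i (D.next h) = Y.next (i h))
    (hwY : Y.wilson = ↑(l :: L)) (hwD : D.wilson.map i = ↑(x :: y :: L))
    {S : Set H} (hx : Y.turn S (Y.edge l) = x)
    (hy : Y.turn S x = y) (hya : Y.turn S y = Y.edge l)
    {S' : Set H'} (hSS' : ∀ h, ¬ Y.SameVertex (Y.edge l) (i h) → (i h ∈ S ↔ h ∈ S')) :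
    SingleOrbit (Y.tour S) ↔ SingleOrbit (D.tour S') := by
  classical
  set a := Y.edge l with ha_def
  have hxv : x ∈ Y.vertex a := by
    rw [← hx, turn_mem_vertex_iff]
    exact Y.self_mem_vertex a
  have hyv : y ∈ Y.vertex a := by
    rw [← hy, turn_mem_vertex_iff]
    exact hxv
  have hlv : l ∉ Y.vertex a := fun h => (Y.trivalent_iff_of_mem_vertex h).2 ha hl
  have hxt := (Y.trivalent_iff_of_mem_vertex hxv).2 ha
  have hyt := (Y.trivalent_iff_of_mem_vertex hyv).2 ha
  have hvertex : ∀ h ∈ Y.vertex a, h = a ∨ h = x ∨ h = y := by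
    rintro h (rfl | rfl | rfl)
    · exact Or.inl rfl
    · by_cases h : a ∈ S
      · rw [turn_of_mem _ h] at hx
        exact Or.inr (Or.inl hx)
      · rw [turn_of_notMem _ h] at hx
        subst hx
        by_cases h : Y.next (Y.next a) ∈ S
        · rw [turn_of_mem _ h, Y.next_next_next] at hy
          subst hy
          by_cases h : a ∈ S
          · rw [turn_of_mem _ h] at hya
            exact absurd hya ha
          · rw [turn_of_notMem _ h] at hya
            exact absurd (Y.next_next_eq_self_iff.1 hya) ha
        · rw [turn_of_notMem _ h, Y.next_next_next] at hy
          exact Or.inr (Or.inr hy)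
    · by_cases h : a ∈ S
      · rw [turn_of_mem _ h] at hx
        subst hx
        by_cases h : Y.next a ∈ S
        · rw [turn_of_mem _ h] at hy
          exact Or.inr (Or.inr hy)
        · rw [turn_of_notMem _ h, Y.next_next_next] at hy
          subst hy
          by_cases h : a ∈ S
          · rw [turn_of_mem _ h] at hya
            exact absurd hya ha
          · rw [turn_of_notMem _ h] at hya
            exact absurd (Y.next_next_eq_self_iff.1 hya) ha
      · rw [turn_of_notMem _ h] at hx
        exact Or.inr (Or.inl hx)
  have hYn : (l :: L).Nodup := by
    have := Y.nodup_wilson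
    rwa [hwY] at this
  have hmem : ∀ h ∈ l :: L, Y.next h = h := by
    intro h hh
    rw [← Y.mem_wilson, hwY]
    exact hh
  have hxL : x ∉ l :: L := fun h => hxt (hmem x h)
  have hyL : y ∉ l :: L := fun h => hyt (hmem y h)
  have haL : a ∉ l :: L := fun h => ha (hmem a h)
  have hlL : l ∉ L := (List.nodup_cons.1 hYn).1
  have hyL' : y ∉ L := fun h => hyL (List.mem_cons_of_mem _ h)
  have hxy : x ≠ y := by
    rintro rfl
    by_cases h : x ∈ S
    · rw [turn_of_mem _ h] at hy
      exact hxt hy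
    · rw [turn_of_notMem _ h] at hy
      exact hxt (Y.next_next_eq_self_iff.1 hy)
  have hxl : x ≠ l := fun h => hlv (h ▸ hxv)
  have hyl : y ≠ l := fun h => hlv (h ▸ hyv)
  have hal : a ≠ l := fun h => hlv (h ▸ Y.self_mem_vertex a)
  have hturn_ne : ∀ z ∈ Y.vertex a, Y.turn S z ≠ z := by
    intro z hz e
    have hzt := (Y.trivalent_iff_of_mem_vertex hz).2 ha
    by_cases h : z ∈ S
    · rw [turn_of_mem _ h] at e
      exact hzt e
    · rw [turn_of_notMem _ h] at e
      exact hzt (Y.next_next_eq_self_iff.1 e)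
  have hxa : x ≠ a := fun h => hturn_ne a (Y.self_mem_vertex a) (hx.trans h)
  have hya' : y ≠ a := fun h => hturn_ne y hyv (hya.trans h.symm)
  have hYa : ∀ z, Y.around z = (l :: L).formPerm z := by
    intro z
    rw [Y.around_eq_formPerm hwY]
  have hDa := around_map (D := D) hi hwD
  -- the images of a point under the two Wilson cycles
  have hform : ∀ z, z ≠ x → z ≠ y → ∀ z', Equiv.swap l y z = z' → z' ≠ x →
      (x :: y :: L).formPerm z' = if Y.around z = l then x else Y.around z := by
    intro z hzx hzy z' hz' hzx'
    rw [List.formPerm_cons_cons, Equiv.Perm.mul_apply, ← hz',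
      List.formPerm_replace_head hlL hyL', ← hYa]
    have h1 : Y.around z ≠ x := by
      intro h
      rw [← Y.around_of_trivalent hxt] at h
      exact hzx (Y.around.injective h)
    have h2 : Y.around z ≠ y := by
      intro h
      rw [← Y.around_of_trivalent hyt] at h
      exact hzy (Y.around.injective h)
    split_ifs with h
    · rw [h, Equiv.swap_apply_left, Equiv.swap_apply_right]
    · rw [Equiv.swap_apply_of_ne_of_ne h h2, Equiv.swap_apply_of_ne_of_ne h1 h2]
  have htl : Y.tour S l = x := by
    rw [tour_of_trivalent _ _ ha, ← ha_def, hx]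
  have hxZ : x ∉ ({l, a} : Set H) := by simp [hxl, hxa]
  have hyZ : y ∉ ({l, a} : Set H) := by simp [hyl, hya']
  have hYta : Y.tour S a = Y.around l := by
    rw [tour, ha_def, Y.edge_edge, Y.turn_of_leg S hl]
  have harnd : ∀ z, z ≠ a → Y.around z ≠ a := by
    intro z hz h
    rw [← Y.around_of_trivalent ha] at h
    exact hz (Y.around.injective h)
  -- A walk that would reach `l` on the Wilson line proceeds to `x`; all other successors are
  -- unaffected. This includes the case in which `l` is the only leg and follows itself.
  have hexit : ∀ z, z ≠ a → FirstExit (Y.tour S) {l, a} (Y.around z)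
      (if Y.around z = l then x else Y.around z) := by
    intro z hz
    split_ifs with h
    · rw [h]
      refine .step (by simp) ?_
      rw [htl]
      exact .here hxZ
    · exact .here (by simp [h, harnd z hz])
  refine singleOrbit_iff_of_return (Z := {l, a}) i hi (fun h => by rw [hrange]; simp) ?_ ?_
  · intro h
    set k := D.edge h with hk
    have hik : i k = Y.edge (i h) := hedge h
    have hika : i k ≠ a := ((hrange _).1 ⟨k, rfl⟩).2
    have hikl : i k ≠ l := ((hrange _).1 ⟨k, rfl⟩).1
    by_cases hkv : i k ∈ Y.vertex a
    · have hD : D.tour S' h = D.around k := tour_of_leg _ _ (hleg k hkv)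
      rw [hD, hDa, tour_of_trivalent _ _ (by rwa [← hik, Y.trivalent_iff_of_mem_vertex hkv]), ← hik]
      rcases hvertex _ hkv with h | h | h
      · exact absurd h hika
      · rw [h, hy, List.formPerm_cons_cons, Equiv.Perm.mul_apply, List.formPerm_apply_of_notMem,
          Equiv.swap_apply_left]
        · exact .here hyZ
        · intro hm
          rcases List.mem_cons.1 hm with hm | hm
          · exact hxy hm
          · exact hxL (List.mem_cons_of_mem _ hm)
      · rw [h, hya, hform l hxl.symm hyl.symm y (Equiv.swap_apply_left _ _) hxy.symm]
        refine .step (by simp) ?_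
        rw [hYta]
        exact hexit l hal.symm
    · have hturn : i (D.turn S' k) = Y.turn S (i k) := by
        by_cases hkS : k ∈ S'
        · rw [turn_of_mem _ hkS, turn_of_mem _ ((hSS' k hkv).2 hkS), hnext k hkv]
        · rw [turn_of_notMem _ hkS, turn_of_notMem _ (mt (hSS' k hkv).1 hkS), ← hnext k hkv,
            ← hnext]
          rw [hnext k hkv]
          exact fun h => hkv (Y.next_mem_vertex_iff.1 h)
      have hnv : i (D.turn S' k) ∉ Y.vertex a := by
        rw [hturn, turn_mem_vertex_iff]
        exact hkv
      have hzx : i (D.turn S' k) ≠ x := fun h => hnv (h ▸ hxv)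
      have hzy : i (D.turn S' k) ≠ y := fun h => hnv (h ▸ hyv)
      have hzl : i (D.turn S' k) ≠ l := ((hrange _).1 ⟨_, rfl⟩).1
      have hza : i (D.turn S' k) ≠ a := ((hrange _).1 ⟨_, rfl⟩).2
      rw [show D.tour S' h = D.around (D.turn S' k) from rfl, hDa,
        hform _ hzx hzy _ (Equiv.swap_apply_of_ne_of_ne hzl hzy) hzx, tour, ← hik, ← hturn]
      exact hexit _ hza
  · intro z hz
    rcases hz with rfl | rfl
    · refine ⟨x, .step (by simp) ?_⟩
      rw [htl]
      exact .here hxZ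
    · refine ⟨if Y.around l = l then x else Y.around l, .step (by simp) ?_⟩
      rw [hYta]
      exact hexit l hal.symm

end Opening

/-- The sum splits according to the order at the vertex joined to the leg. The reversed order has
sign +1 and contracts to `P`, the given order has sign -1 and contracts to `X`. -/
theorem conway_three_term {H₁ H₂ : Type} {Y : FeynmanDiagram H} {P : FeynmanDiagram H₁}
    {X : FeynmanDiagram H₂} {l : H} {L : List H} (hl : Y.next l = l)
    (ha : Y.Trivalent (Y.edge l))
    (hP : Y.IsOpening l L (Y.next (Y.next (Y.edge l))) (Y.next (Y.edge l)) P)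
    (hX : Y.IsOpening l L (Y.next (Y.edge l)) (Y.next (Y.next (Y.edge l))) X) :
    Y.conway = P.conway - X.conway := by
  have hsub : ∀ {K : Type} (i : K → H), (∀ h, h ∈ Set.range i ↔ h ≠ l ∧ h ≠ Y.edge l) →
      ∀ S ∈ Y.orientations, Disjoint S (Y.vertex (Y.edge l)) → S ⊆ Set.range i := by
    intro K i hi S hS hd h hh
    rw [hi]
    constructor
    · rintro rfl
      exact hS.1 h hh hl
    · rintro rfl
      exact Set.disjoint_left.1 hd hh (Y.self_mem_vertex _)
  rw [conway, orientationSum_eq_vertex ha (Set.disjoint_empty _), Set.empty_union,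
    orientationSum_sub]
  congr 1
  · obtain ⟨i, hi, hr, he, hleg, hn, hwY, hwD⟩ := hP
    rw [orientationSum_image i hi (orientations_opening hi hleg hn) (hsub i hr)]
    refine orientationSum_congr fun S' hS' _ => ?_
    congr 1
    rw [orientations_opening hi hleg hn] at hS'
    have hnm : ∀ h ∈ Y.vertex (Y.edge l), h ∉ i '' S' := fun h hh hh' =>
      Set.disjoint_left.1 hS'.2 hh' hh
    rw [singleOrbit_tour_opening hl ha hi hr he hleg hn hwY hwD (S' := S')]
    · rw [turn_of_notMem _ (hnm _ (Y.self_mem_vertex _))]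
    · rw [turn_of_notMem _ (hnm _ (Or.inr (Or.inr rfl))), Y.next_next_next]
    · rw [turn_of_notMem _ (hnm _ (Or.inr (Or.inl rfl))), Y.next_next_next]
    · exact fun h _ => hi.mem_set_image
  · obtain ⟨i, hi, hr, he, hleg, hn, hwY, hwD⟩ := hX
    rw [orientationSum_image i hi (orientations_opening hi hleg hn) (hsub i hr)]
    refine orientationSum_congr fun S' hS' _ => ?_
    congr 1
    rw [singleOrbit_tour_opening hl ha hi hr he hleg hn hwY hwD (S' := S')]
    · rw [turn_union_vertex _ _ (Or.inl rfl)]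
    · rw [turn_union_vertex _ _ (Or.inr (Or.inl rfl))]
    · rw [turn_union_vertex _ _ (Or.inr (Or.inr rfl)), Y.next_next_next]
    · intro h hv
      rw [Set.mem_union, hi.mem_set_image]
      exact or_iff_left hv

end FeynmanDiagram

/-! ### Moving a segment of an orbit -/

theorem FirstExit.trans {X : Type*} {f : X → X} {Z Z' : Set X} {x y z : X}
    (h : FirstExit f Z x y) (hZ : Z ⊆ Z') (h' : FirstExit f Z' y z) : FirstExit f Z' x z := by
  induction h with
  | here _ => exact h'
  | step hx _ ih => exact .step (hZ hx) (ih h')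

/-- Moving a segment of an orbit, which leads from `c` to `d`, to another place. -/
theorem singleOrbit_congr_of_flip {X : Type*} {f g : X → X} {Z : Set X} {c d y z : X}
    (hyZ : y ∉ Z) (hzZ : z ∉ Z) (hyc : y ≠ c) (hyd : y ≠ d) (hzc : z ≠ c)
    (hzd : z ≠ d) (hfc : FirstExit f Z (f c) d) (hgc : FirstExit g Z (g c) d)
    (hfd : f d = z) (hgd : g d = y) (hfZ : ∀ x ∈ Z, ∃ t, FirstExit f Z x t)
    (hgZ : ∀ x ∈ Z, ∃ t, FirstExit g Z x t)
    (h : ∀ x, x ∉ Z → x ≠ c → x ≠ d → (f x = c ∧ g x = z) ∨ (f x = y ∧ g x = c) ∨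
      ∃ t, t ≠ c ∧ t ≠ d ∧ FirstExit f Z (f x) t ∧ FirstExit g Z (g x) t) :
    SingleOrbit f ↔ SingleOrbit g := by
  -- Under `f` the segment is followed by `z`, under `g` by `y`. Once `c` and `d` are skipped too,
  -- under both maps the point that `f` sends to `c` is followed by `z`, and the point that `g`
  -- sends to `c` by `y`.
  set Z' : Set X := insert c (insert d Z) with hZ'
  have hsub : Z ⊆ Z' := fun x hx => by simp [hZ', hx]
  have hyZ' : y ∉ Z' := by simp [hZ', hyZ, hyc, hyd]
  have hzZ' : z ∉ Z' := by simp [hZ', hzZ, hzc, hzd]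
  have fd : FirstExit f Z' d z := .step (by simp [hZ']) (by rw [hfd]; exact .here hzZ')
  have gd : FirstExit g Z' d y := .step (by simp [hZ']) (by rw [hgd]; exact .here hyZ')
  have fc : FirstExit f Z' c z := .step (by simp [hZ']) (hfc.trans hsub fd)
  have gc : FirstExit g Z' c y := .step (by simp [hZ']) (hgc.trans hsub gd)
  have key : ∀ {k : X → X} {w : X}, (∀ x ∈ Z, ∃ t, FirstExit k Z x t) → FirstExit k Z' c w →
      FirstExit k Z' d w → ∀ x ∈ Z', ∃ t, FirstExit k Z' x t := by
    intro k w hk hc hd x hx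
    rcases hx with rfl | rfl | hx
    · exact ⟨w, hc⟩
    · exact ⟨w, hd⟩
    · obtain ⟨t, ht⟩ := hk x hx
      by_cases htc : t = c
      · subst htc
        exact ⟨w, ht.trans hsub hc⟩
      by_cases htd : t = d
      · subst htd
        exact ⟨w, ht.trans hsub hd⟩
      exact ⟨t, ht.trans hsub (.here (by simp [hZ', htc, htd, ht.notMem]))⟩
  refine singleOrbit_congr_of_return (Z := Z') ?_ (key hfZ fc fd) (key hgZ gc gd)
  intro x hx
  simp only [hZ', Set.mem_insert_iff, not_or] at hx
  rcases h x hx.2.2 hx.1 hx.2.1 with ⟨h1, h2⟩ | ⟨h1, h2⟩ | ⟨t, htc, htd, h1, h2⟩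
  · exact ⟨z, by rwa [h1], by rw [h2]; exact .here hzZ'⟩
  · exact ⟨y, by rw [h1]; exact .here hyZ', by rwa [h2]⟩
  · have ht : t ∉ Z' := by simp [hZ', htc, htd, h1.notMem]
    exact ⟨t, h1.trans hsub (.here ht), h2.trans hsub (.here ht)⟩

namespace FeynmanDiagram

variable {H H' : Type} {F : FeynmanDiagram H}

/-! ### Bubbles -/

theorem IsBubble.symm {p p' : H} (h : F.IsBubble p p') : F.IsBubble p' p := by
  obtain ⟨h1, h2, h3, h4, h5⟩ := h
  refine ⟨h2, h1, fun h => h3 (F.mem_vertex_comm.1 h), ?_, ?_⟩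
  · rw [← h5, F.edge_edge]
  · rw [← h4, F.edge_edge]

/-- The half-edges in the interior of a bubble. -/
def bubbleInterior (F : FeynmanDiagram H) (p p' : H) : Set H :=
  {F.next p, F.next (F.next p), F.next p', F.next (F.next p')}

theorem bubbleInterior_comm (p p' : H) : F.bubbleInterior p p' = F.bubbleInterior p' p := by
  ext x
  simp only [bubbleInterior, Set.mem_insert_iff, Set.mem_singleton_iff]
  tauto

theorem mem_vertex_union_iff {p p' x : H} : x ∈ F.vertex p ∪ F.vertex p' ↔
    x = p ∨ x = p' ∨ x ∈ F.bubbleInterior p p' := by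
  simp only [Set.mem_union, mem_vertex, bubbleInterior, Set.mem_insert_iff,
    Set.mem_singleton_iff]
  tauto

theorem IsBubble.notMem_interior {p p' : H} (h : F.IsBubble p p') :
    p ∉ F.bubbleInterior p p' := by
  obtain ⟨h1, h2, h3, h4, h5⟩ := h
  simp only [bubbleInterior, Set.mem_insert_iff, Set.mem_singleton_iff, not_or]
  refine ⟨fun e => h1 e.symm, fun e => h1 (F.next_next_eq_self_iff.1 e.symm), fun e => ?_,
    fun e => ?_⟩
  · exact h3 (F.mem_vertex_comm.1 (Or.inr (Or.inl e)))
  · exact h3 (F.mem_vertex_comm.1 (Or.inr (Or.inr e)))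

theorem IsBubble.edge_mem_interior_iff {p p' x : H} (h : F.IsBubble p p') :
    F.edge x ∈ F.bubbleInterior p p' ↔ x ∈ F.bubbleInterior p p' := by
  have key : ∀ x ∈ F.bubbleInterior p p', F.edge x ∈ F.bubbleInterior p p' := by
    obtain ⟨h1, h2, h3, h4, h5⟩ := h
    rintro x (rfl | rfl | rfl | rfl)
    · rw [h4]
      simp [bubbleInterior]
    · rw [h5]
      simp [bubbleInterior]
    · rw [← h5, F.edge_edge]
      simp [bubbleInterior]
    · rw [← h4, F.edge_edge]
      simp [bubbleInterior]
  refine ⟨fun hx => ?_, key x⟩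
  rw [← F.edge_edge x]
  exact key _ hx

theorem IsBubble.notMem_vertex {p p' : H} (h : F.IsBubble p p') : p' ∉ F.vertex p := h.2.2.1

/-- With opposite orders the walk that enters at `p` runs through `next p` and `next p'` and leaves
at `p`. The walk that enters at `p'` runs through `next (next p')` and `next (next p)` and leaves at
`p'`. -/
theorem IsBubble.exit_of_mem {p p' : H} (h : F.IsBubble p p') {S : Set H}
    (hS : S ∈ F.orientations) (hp : p ∈ S) (hp' : p' ∉ S) :
    (∀ x, F.edge x = p → FirstExit (F.tour S) (F.bubbleInterior p p') (F.tour S x) p) ∧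
    (∀ x, F.edge x = p' → FirstExit (F.tour S) (F.bubbleInterior p p') (F.tour S x) p') ∧
    ∀ x ∈ F.bubbleInterior p p', FirstExit (F.tour S) (F.bubbleInterior p p') x p ∨
      FirstExit (F.tour S) (F.bubbleInterior p p') x p' := by
  have hpi := h.notMem_interior
  have hpi' := h.symm.notMem_interior
  rw [bubbleInterior_comm] at hpi'
  obtain ⟨h1, h2, h3, h4, h5⟩ := h
  have hin : ∀ k ∈ F.vertex p, k ∈ S := fun k hk => F.vertex_subset hS hp hk
  have hout : ∀ k ∈ F.vertex p', k ∉ S := fun k hk hk' =>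
    hp' (F.vertex_subset hS hk' (F.mem_vertex_comm.1 hk))
  have e1 : F.edge (F.next (F.next p')) = F.next p := by rw [← h4, F.edge_edge]
  have e2 : F.edge (F.next p') = F.next (F.next p) := by rw [← h5, F.edge_edge]
  have t1 : F.tour S (F.next p) = F.next p' := by
    rw [tour_of_trivalent, h4, F.turn_of_notMem (hout _ (Or.inr (Or.inr rfl))),
      F.next_next_next]
    rw [h4]
    exact h2.next.next
  have t2 : F.tour S (F.next p') = p := by
    rw [tour_of_trivalent, e2, F.turn_of_mem (hin _ (Or.inr (Or.inr rfl))), F.next_next_next]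
    rw [e2]
    exact h1.next.next
  have t3 : F.tour S (F.next (F.next p')) = F.next (F.next p) := by
    rw [tour_of_trivalent, e1, F.turn_of_mem (hin _ (Or.inr (Or.inl rfl)))]
    rw [e1]
    exact h1.next
  have t4 : F.tour S (F.next (F.next p)) = p' := by
    rw [tour_of_trivalent, h5, F.turn_of_notMem (hout _ (Or.inr (Or.inl rfl))), F.next_next_next]
    rw [h5]
    exact h2.next
  have x2 : FirstExit (F.tour S) (F.bubbleInterior p p') (F.next p') p :=
    .step (by simp [bubbleInterior]) (by rw [t2]; exact .here hpi)
  have x1 : FirstExit (F.tour S) (F.bubbleInterior p p') (F.next p) p :=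
    .step (by simp [bubbleInterior]) (by rw [t1]; exact x2)
  have x4 : FirstExit (F.tour S) (F.bubbleInterior p p') (F.next (F.next p)) p' :=
    .step (by simp [bubbleInterior]) (by rw [t4]; exact .here hpi')
  have x3 : FirstExit (F.tour S) (F.bubbleInterior p p') (F.next (F.next p')) p' :=
    .step (by simp [bubbleInterior]) (by rw [t3]; exact x4)
  refine ⟨fun x hx => ?_, fun x hx => ?_, ?_⟩
  · rw [tour_of_trivalent _ _ (by rwa [hx]), hx, F.turn_of_mem hp]
    exact x1
  · rw [tour_of_trivalent _ _ (by rwa [hx]), hx, F.turn_of_notMem hp']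
    exact x3
  · rintro x (rfl | rfl | rfl | rfl)
    exacts [Or.inl x1, Or.inr x4, Or.inl x2, Or.inr x3]

/-- If the two vertices of a bubble have opposite orientations, the boundary walk of the ribbon
graph turns back at the two ends of the bubble. -/
theorem IsBubble.exit {p p' : H} (h : F.IsBubble p p') {S : Set H}
    (hS : S ∈ F.orientations) (hp : ¬ (p ∈ S ↔ p' ∈ S)) :
    (∀ x, F.edge x = p → FirstExit (F.tour S) (F.bubbleInterior p p') (F.tour S x) p) ∧
    (∀ x, F.edge x = p' → FirstExit (F.tour S) (F.bubbleInterior p p') (F.tour S x) p') ∧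
    ∀ x ∈ F.bubbleInterior p p', FirstExit (F.tour S) (F.bubbleInterior p p') x p ∨
      FirstExit (F.tour S) (F.bubbleInterior p p') x p' := by
  by_cases h1 : p ∈ S
  · exact h.exit_of_mem hS h1 (by tauto)
  · have := h.symm.exit_of_mem hS (by tauto) h1
    rw [bubbleInterior_comm p' p] at this
    exact ⟨this.2.1, this.1, fun x hx => (this.2.2 x hx).symm⟩

/-- If the two vertices of a bubble have the same orientation, there is a separate boundary
component inside. -/
theorem IsBubble.not_singleOrbit {p p' : H} (h : F.IsBubble p p') {S : Set H}
    (hS : S ∈ F.orientations) (hp : p ∈ S ↔ p' ∈ S) : ¬ SingleOrbit (F.tour S) := by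
  have hpi := h.notMem_interior
  simp only [bubbleInterior, Set.mem_insert_iff, Set.mem_singleton_iff, not_or] at hpi
  obtain ⟨h1, h2, h3, h4, h5⟩ := h
  have e1 : F.edge (F.next (F.next p')) = F.next p := by rw [← h4, F.edge_edge]
  have e2 : F.edge (F.next p') = F.next (F.next p) := by rw [← h5, F.edge_edge]
  -- Two inner half-edges that are exchanged by the walk form an orbit which misses `p`.
  have key : ∀ x y, F.tour S x = y → F.tour S y = x → p ≠ x → p ≠ y →
      ¬ SingleOrbit (F.tour S) := by
    intro x y hxy hyx hx hy
    refine _root_.not_singleOrbit (fun z => z = x ∨ z = y) (x := x) (y := p) ?_ (Or.inl rfl)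
      (by tauto)
    intro z
    constructor
    · rintro (e | e)
      · right
        rw [← hyx] at e
        exact F.tour_injective hS e
      · left
        rw [← hxy] at e
        exact F.tour_injective hS e
    · rintro (rfl | rfl)
      · exact Or.inr hxy
      · exact Or.inl hyx
  by_cases hpS : p ∈ S
  · refine key (F.next (F.next p)) (F.next (F.next p')) ?_ ?_ hpi.2.1 hpi.2.2.2
    · rw [tour_of_trivalent, h5,
        F.turn_of_mem (F.vertex_subset hS (hp.1 hpS) (Or.inr (Or.inl rfl)))]
      rw [h5]
      exact h2.next
    · rw [tour_of_trivalent, e1, F.turn_of_mem (F.vertex_subset hS hpS (Or.inr (Or.inl rfl)))]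
      rw [e1]
      exact h1.next
  · have hp'S : p' ∉ S := mt hp.2 hpS
    refine key (F.next p) (F.next p') ?_ ?_ hpi.1 hpi.2.2.1
    · rw [tour_of_trivalent, h4, F.turn_of_notMem, F.next_next_next]
      · exact fun hh => hp'S ((F.next_mem_iff hS).1 ((F.next_mem_iff hS).1 hh))
      · rw [h4]
        exact h2.next.next
    · rw [tour_of_trivalent, e2, F.turn_of_notMem, F.next_next_next]
      · exact fun hh => hpS ((F.next_mem_iff hS).1 ((F.next_mem_iff hS).1 hh))
      · rw [e2]
        exact h1.next.next

theorem orientationSum_eq_two_vertices {p p' : H} (hp : F.Trivalent p) (hp' : F.Trivalent p')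
    (hpp' : p' ∉ F.vertex p) (g : Set H → ℚ) : F.orientationSum ∅ g =
      F.orientationSum (F.vertex p ∪ F.vertex p') fun S => g S - g (S ∪ F.vertex p) -
        (g (S ∪ F.vertex p') - g (S ∪ F.vertex p' ∪ F.vertex p)) := by
  rw [orientationSum_eq_vertex hp (Set.disjoint_empty _), Set.empty_union,
    orientationSum_eq_vertex hp' (F.disjoint_vertex hpp')]

/-- The two contributions of a bubble. -/
theorem IsBubble.conway_eq {p p' : H} (h : F.IsBubble p p') : F.conway =
    F.orientationSum (F.vertex p ∪ F.vertex p') fun S =>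
      -indicator01 (SingleOrbit (F.tour (S ∪ F.vertex p))) -
        indicator01 (SingleOrbit (F.tour (S ∪ F.vertex p'))) := by
  rw [conway, orientationSum_eq_two_vertices h.1 h.2.1 h.notMem_vertex]
  refine orientationSum_congr fun S hS hd => ?_
  rw [Set.disjoint_union_right] at hd
  have hpS : p ∉ S := fun hh => Set.disjoint_left.1 hd.1 hh (F.self_mem_vertex p)
  have hp'S : p' ∉ S := fun hh => Set.disjoint_left.1 hd.2 hh (F.self_mem_vertex p')
  rw [indicator01_false (h.not_singleOrbit hS (by tauto)),
    indicator01_false (h.not_singleOrbit (S := S ∪ F.vertex p' ∪ F.vertex p)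
      (F.union_vertex_mem (F.union_vertex_mem hS h.2.1) h.1) ?_)]
  · ring
  · exact iff_of_true (Or.inr (F.self_mem_vertex p)) (Or.inl (Or.inr (F.self_mem_vertex p')))

theorem IsBubble.mixed {p p' : H} (h : F.IsBubble p p') {S : Set H}
    (hd : Disjoint S (F.vertex p ∪ F.vertex p')) :
    ¬ (p ∈ S ∪ F.vertex p ↔ p' ∈ S ∪ F.vertex p) ∧
      ¬ (p ∈ S ∪ F.vertex p' ↔ p' ∈ S ∪ F.vertex p') := by
  have h1 := Set.disjoint_right.1 hd (Or.inl (F.self_mem_vertex p))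
  have h2 := Set.disjoint_right.1 hd (Or.inr (F.self_mem_vertex p'))
  have h3 := h.notMem_vertex
  have h4 := h.symm.notMem_vertex
  have h5 := F.self_mem_vertex p
  have h6 := F.self_mem_vertex p'
  simp only [Set.mem_union]
  tauto

/-- The bubble is not a connected component. -/
theorem IsBubble.edge_ne_end {p p' : H} (h : F.IsBubble p p') : F.edge p' ≠ p := by
  intro e
  have e' : F.edge p = p' := by rw [← e, F.edge_edge]
  obtain ⟨l, hl, hr⟩ := F.exists_leg p
  -- If the two ends were joined, the half-edges at the two vertices would be closed under `edge`
  -- and `next`, so no path from `p` could reach a leg.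
  have key : ∀ x, Relation.ReflTransGen (fun x y => y = F.edge x ∨ y = F.next x) p x →
      x ∈ F.vertex p ∪ F.vertex p' := by
    intro x hx
    induction hx with
    | refl => exact Or.inl (F.self_mem_vertex p)
    | tail _ hyz ih =>
      rcases hyz with rfl | rfl
      · rcases mem_vertex_union_iff.1 ih with rfl | rfl | hy
        · rw [e']
          exact Or.inr (F.self_mem_vertex p')
        · rw [e]
          exact Or.inl (F.self_mem_vertex p)
        · exact mem_vertex_union_iff.2 (Or.inr (Or.inr (h.edge_mem_interior_iff.2 hy)))
      · exact ih.imp F.next_mem_vertex_iff.2 F.next_mem_vertex_iff.2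
  rcases key l hr with hv | hv
  · exact (F.trivalent_iff_of_mem_vertex hv).2 h.1 hl
  · exact (F.trivalent_iff_of_mem_vertex hv).2 h.2.1 hl

theorem turn_union_of_notMem {S : Set H} {p k : H} (hk : k ∉ F.vertex p) :
    F.turn (S ∪ F.vertex p) k = F.turn S k := by
  by_cases h : k ∈ S
  · rw [turn_of_mem _ h, turn_of_mem _ (Set.mem_union_left _ h)]
  · rw [turn_of_notMem _ h, turn_of_notMem]
    rintro (h' | h')
    exacts [h h', hk h']

theorem tour_union_of_notMem {S : Set H} {p x : H} (hk : F.edge x ∉ F.vertex p) :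
    F.tour (S ∪ F.vertex p) x = F.tour S x := by
  rw [tour, tour, turn_union_of_notMem hk]

theorem tour_mem_vertex_iff (S : Set H) {x p : H} (hp : F.Trivalent p) :
    F.tour S x ∈ F.vertex p ↔ F.edge x ∈ F.vertex p := by
  constructor
  · intro h
    have h1 := (F.trivalent_iff_of_mem_vertex h).2 hp
    rw [tour, trivalent_around_iff] at h1
    rw [tour, F.around_of_trivalent h1, turn_mem_vertex_iff] at h
    exact h
  · intro h
    have h1 := (F.trivalent_iff_of_mem_vertex h).2 hp
    rw [F.tour_of_trivalent S h1, turn_mem_vertex_iff]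
    exact h

/-- For opposite orders in the bubble, the arc from the trivalent vertex of `c` to `p'` is a dead
end. Reversing the order at that vertex merely decides on which of the two remaining passages
through it the dead end is visited. The number of orbits being one or not is unaffected, while the
sign changes, so the terms cancel in pairs. -/
theorem IsBubble.conway_eq_zero {p p' : H} (h : F.IsBubble p p')
    (hc : F.Trivalent (F.edge p')) : F.conway = 0 := by
  set c := F.edge p' with hcdef
  have hec : F.edge c = p' := F.edge_edge p'
  set Z := F.bubbleInterior p p' with hZ
  have hcuv : c ∉ F.vertex p ∪ F.vertex p' := by
    rw [mem_vertex_union_iff]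
    rintro (e | e | e)
    · exact h.edge_ne_end e
    · exact F.edge_ne p' e
    · rw [hcdef, h.edge_mem_interior_iff, bubbleInterior_comm] at e
      exact h.symm.notMem_interior e
  have hdisj : Disjoint (F.vertex c) (F.vertex p ∪ F.vertex p') := by
    rw [Set.disjoint_union_right]
    exact ⟨F.disjoint_vertex fun hh => hcuv (Or.inl hh),
      F.disjoint_vertex fun hh => hcuv (Or.inr hh)⟩
  have hw : ∀ k ∈ F.vertex c, k ∉ F.vertex p ∪ F.vertex p' := fun k hk =>
    Set.disjoint_left.1 hdisj hk
  have hwZ : ∀ k ∈ F.vertex c, k ∉ Z ∧ k ≠ p ∧ k ≠ p' := by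
    intro k hk
    have := hw k hk
    rw [mem_vertex_union_iff] at this
    tauto
  have hy : F.next c ∈ F.vertex c := Or.inr (Or.inl rfl)
  have hz : F.next (F.next c) ∈ F.vertex c := Or.inr (Or.inr rfl)
  have flip : ∀ S ∈ F.orientations, ¬ (p ∈ S ↔ p' ∈ S) → c ∉ S →
      (SingleOrbit (F.tour S) ↔ SingleOrbit (F.tour (S ∪ F.vertex c))) := by
    intro S hS hpp hcS
    have hS' := F.union_vertex_mem hS hc
    have hpp' : ¬ (p ∈ S ∪ F.vertex c ↔ p' ∈ S ∪ F.vertex c) := by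
      have h1 : p ∉ F.vertex c := fun hh => (hwZ _ hh).2.1 rfl
      have h2 : p' ∉ F.vertex c := fun hh => (hwZ _ hh).2.2 rfl
      simp only [Set.mem_union]
      tauto
    have hwS : ∀ k ∈ F.vertex c, k ∉ S := fun k hk hkS =>
      hcS (F.vertex_subset hS hkS (F.mem_vertex_comm.1 hk))
    have hb := h.exit hS hpp
    have hb' := h.exit hS' hpp'
    -- The segment that moves is the excursion into the dead end: from `c` through the bubble to
    -- `p'`.
    refine singleOrbit_congr_of_flip (Z := Z) (c := c) (d := p') (y := F.next c)
      (z := F.next (F.next c)) (hwZ _ hy).1 (hwZ _ hz).1 hc ?_ ?_ (hwZ _ hz).2.2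
      (hb.2.1 c hec) (hb'.2.1 c hec) ?_ ?_ ?_ ?_ ?_
    · exact (hwZ _ hy).2.2
    · exact fun e => hc (F.next_next_eq_self_iff.1 e)
    · rw [F.tour_of_trivalent _ hc, ← hcdef, F.turn_of_notMem hcS]
    · rw [F.tour_of_trivalent _ hc, ← hcdef, F.turn_union_vertex _ (F.self_mem_vertex c)]
    · exact fun x hx => (hb.2.2 x hx).elim (fun e => ⟨_, e⟩) (fun e => ⟨_, e⟩)
    · exact fun x hx => (hb'.2.2 x hx).elim (fun e => ⟨_, e⟩) (fun e => ⟨_, e⟩)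
    · intro x hxZ hxc hxp'
      by_cases hxw : F.edge x ∈ F.vertex c
      · have ht := (F.trivalent_iff_of_mem_vertex hxw).2 hc
        rw [F.tour_of_trivalent _ ht, F.tour_of_trivalent _ ht, F.turn_of_notMem (hwS _ hxw),
          F.turn_union_vertex _ hxw]
        rcases hxw with e | e | e
        · exact absurd (F.edge_injective (e.trans hcdef)) hxp'
        · rw [e]
          exact Or.inl ⟨F.next_next_next c, rfl⟩
        · rw [e, F.next_next_next]
          exact Or.inr (Or.inl ⟨rfl, F.next_next_next c⟩)
      · right; right
        by_cases hxp : F.edge x = p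
        · exact ⟨p, fun e => hcuv (Or.inl (e ▸ F.self_mem_vertex p)),
            fun e => h.notMem_vertex (e ▸ F.self_mem_vertex p), hb.1 x hxp, hb'.1 x hxp⟩
        · have hnot : F.edge x ∉ F.vertex p ∪ F.vertex p' := by
            rw [mem_vertex_union_iff]
            rintro (e | e | e)
            · exact hxp e
            · rw [← hec] at e
              exact hxc (F.edge_injective e)
            · exact hxZ (h.edge_mem_interior_iff.1 e)
          have hnot' : F.tour S x ∉ F.vertex p ∪ F.vertex p' := by
            rw [Set.mem_union, tour_mem_vertex_iff _ h.1, tour_mem_vertex_iff _ h.2.1]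
            exact hnot
          have hZ' := mt mem_vertex_union_iff.2 hnot'
          rw [not_or, not_or] at hZ'
          rw [tour_union_of_notMem hxw]
          refine ⟨F.tour S x, fun e => hxw ?_, hZ'.2.1, .here hZ'.2.2, .here hZ'.2.2⟩
          rw [← tour_mem_vertex_iff S hc, e]
          exact F.self_mem_vertex c
  rw [h.conway_eq, orientationSum_eq_vertex hc hdisj]
  rw [orientationSum_congr (g' := fun _ => 0 * 0), orientationSum_const_mul, zero_mul]
  intro S hS hd
  rw [Set.disjoint_union_right] at hd
  have hm := h.mixed hd.1
  have hcS : c ∉ S := Set.disjoint_right.1 hd.2 (F.self_mem_vertex c)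
  have h1 := flip _ (F.union_vertex_mem hS h.1) hm.1
    (by rintro (e | e); exacts [hcS e, hcuv (Or.inl e)])
  have h2 := flip _ (F.union_vertex_mem hS h.2.1) hm.2
    (by rintro (e | e); exacts [hcS e, hcuv (Or.inr e)])
  rw [h1, h2, Set.union_right_comm S _ (F.vertex p), Set.union_right_comm S _ (F.vertex p')]
  ring

end FeynmanDiagram

/-! ### Deleting a chord with a bubble -/

/-- Deleting a point from a cycle gives the first return map to the remaining points. -/
theorem List.formPerm_eq_of_cons {α : Type*} [DecidableEq α] {l : α} {L : List α}
    (h : (l :: L).Nodup) {z : α} (hz : z ≠ l) :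
    L.formPerm z =
      if (l :: L).formPerm z = l then (l :: L).formPerm l else (l :: L).formPerm z := by
  cases L with
  | nil => simp [hz]
  | cons y L =>
    have hl : l ∉ y :: L := (List.nodup_cons.1 h).1
    have hlp : (y :: L).formPerm l = l := List.formPerm_apply_of_notMem hl
    have hne : (y :: L).formPerm z ≠ l := by
      intro e
      rw [← hlp] at e
      exact hz (((y :: L).formPerm).injective e)
    simp only [List.formPerm_cons_cons, Equiv.Perm.mul_apply, hlp, Equiv.swap_apply_left]
    by_cases hy : (y :: L).formPerm z = y
    · rw [hy, Equiv.swap_apply_right, if_pos rfl]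
    · rw [Equiv.swap_apply_of_ne_of_ne hne hy, if_neg hne]

/-- This guarantees that a walk along the Wilson line which skips the two deleted legs does not run
for ever from one to the other. -/
theorem List.formPerm_two_heads {α : Type*} [DecidableEq α] {l l' : α} {A B : List α}
    (h : (l :: A ++ l' :: B).Nodup) (hAB : A ++ B ≠ []) :
    ¬ ((l :: A ++ l' :: B).formPerm l = l' ∧ (l :: A ++ l' :: B).formPerm l' = l) := by
  rintro ⟨h1, h2⟩
  cases A with
  | cons a A =>
    rw [List.cons_append, List.cons_append] at h1 h
    rw [List.formPerm_apply_head _ _ _ h] at h1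
    subst h1
    simp at h
  | nil =>
    cases B with
    | nil => exact hAB rfl
    | cons b B =>
      have hb : l' ∉ b :: B := by
        simp at h
        simp
        tauto
      have hbl : b ≠ l := by
        simp at h
        tauto
      have hbl' : b ≠ l' := fun e => hb (by simp [e])
      simp only [List.cons_append, List.nil_append, List.formPerm_cons_cons,
        Equiv.Perm.mul_apply, List.formPerm_apply_of_notMem hb, Equiv.swap_apply_left] at h2
      rw [Equiv.swap_apply_of_ne_of_ne hbl hbl'] at h2
      exact hbl h2

namespace FeynmanDiagram

variable {H H' : Type} {F : FeynmanDiagram H}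

/-- Removing two points of the Wilson line. -/
theorem around_deletion {F₀ : FeynmanDiagram H'} [DecidableEq H] {i : H' → H}
    (hi : Function.Injective i) {l l' : H} {A B : List H'}
    (hw : F.wilson = ↑(l :: A.map i ++ l' :: B.map i)) (hw₀ : F₀.wilson = ↑(A ++ B))
    (h : H') (hl : i h ≠ l) (hl' : i h ≠ l') :
    let W₁ := fun z => if F.around z = l then F.around l else F.around z
    i (F₀.around h) = if W₁ (i h) = l' then W₁ l' else W₁ (i h) := by
  have hn : (l :: A.map i ++ l' :: B.map i).Nodup := by
    have := F.nodup_wilson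
    rwa [hw] at this
  have hll' : l' ≠ l := by
    rintro rfl
    simp at hn
  have hn₁ : (A.map i ++ l' :: B.map i).Nodup := (List.nodup_cons.1 hn).2
  have hrot : (A.map i ++ l' :: B.map i) ~r (l' :: B.map i ++ A.map i) := List.isRotated_append
  have hn₂ : (l' :: (B.map i ++ A.map i)).Nodup := hrot.nodup_iff.1 hn₁
  have hW₁ : ∀ z, z ≠ l → (l' :: (B.map i ++ A.map i)).formPerm z =
      if F.around z = l then F.around l else F.around z := by
    intro z hz
    have h1 := List.formPerm_eq_of_cons (L := A.map i ++ l' :: B.map i) hn hz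
    have h2 : F.around = (l :: (A.map i ++ l' :: B.map i)).formPerm := F.around_eq_formPerm hw
    rw [← h2, List.formPerm_eq_of_isRotated hn₁ hrot] at h1
    exact h1
  intro W₁
  have hm : F₀.wilson.map i = ↑(B.map i ++ A.map i) := by
    rw [hw₀, Cycle.map_coe, List.map_append, Cycle.coe_eq_coe]
    exact List.isRotated_append
  rw [around_map hi hm, List.formPerm_eq_of_cons hn₂ hl', hW₁ _ hl, hW₁ _ hll']

/-- Crossing an edge of the chord that carries the bubble: the walk returns to the leg. -/
theorem IsBubbleChordDeletion.conway_eq {F₀ : FeynmanDiagram H'} {l l' : H}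
    (h : F.IsBubbleChordDeletion l l' F₀) : F.conway = -2 * F₀.conway := by
  classical
  obtain ⟨hl, hl', hb, i, A, B, hi, hr, hedge, hnext, hw, hw₀⟩ := h
  set p := F.edge l with hp
  set p' := F.edge l' with hp'
  have hep : F.edge p = l := F.edge_edge l
  have hep' : F.edge p' = l' := F.edge_edge l'
  have hlp : l ∉ F.vertex p ∪ F.vertex p' := by
    rintro (hh | hh)
    exacts [(F.trivalent_iff_of_mem_vertex hh).2 hb.1 hl,
      (F.trivalent_iff_of_mem_vertex hh).2 hb.2.1 hl]
  have hlp' : l' ∉ F.vertex p ∪ F.vertex p' := by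
    rintro (hh | hh)
    exacts [(F.trivalent_iff_of_mem_vertex hh).2 hb.1 hl',
      (F.trivalent_iff_of_mem_vertex hh).2 hb.2.1 hl']
  have hi_uv : ∀ h, i h ∉ F.vertex p ∪ F.vertex p' := fun h hh => by
    have := (hr (i h)).1 ⟨h, rfl⟩
    exact hh.elim this.2.2.1 this.2.2.2
  have hil : ∀ h, i h ≠ l := fun h => ((hr (i h)).1 ⟨h, rfl⟩).1
  have hil' : ∀ h, i h ≠ l' := fun h => ((hr (i h)).1 ⟨h, rfl⟩).2.1
  have hn : (l :: A.map i ++ l' :: B.map i).Nodup := by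
    have := F.nodup_wilson
    rwa [hw] at this
  have hll' : l ≠ l' := by
    rintro rfl
    simp at hn
  have horient : ∀ S' : Set H', S' ∈ F₀.orientations ↔
      i '' S' ∈ F.orientations ∧ Disjoint (i '' S') (F.vertex p ∪ F.vertex p') := by
    intro S'
    have hd : Disjoint (i '' S') (F.vertex p ∪ F.vertex p') := by
      rw [Set.disjoint_left]
      rintro _ ⟨h, -, rfl⟩
      exact hi_uv h
    rw [and_iff_left hd]
    simp only [orientations, Set.mem_ofPred_eq, Set.forall_mem_image, Trivalent, ← hnext,
      hi.mem_set_image, hi.ne_iff]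
  have hsub : ∀ S ∈ F.orientations, Disjoint S (F.vertex p ∪ F.vertex p') →
      S ⊆ Set.range i := by
    intro S hS hd k hk
    rw [hr]
    refine ⟨?_, ?_, fun hh => Set.disjoint_left.1 hd hk (Or.inl hh),
      fun hh => Set.disjoint_left.1 hd hk (Or.inr hh)⟩
    · rintro rfl
      exact hS.1 _ hk hl
    · rintro rfl
      exact hS.1 _ hk hl'
  have main : ∀ (S : Set H) (S' : Set H'), S ∈ F.orientations → ¬ (p ∈ S ↔ p' ∈ S) →
      (∀ h, i h ∈ S ↔ h ∈ S') → (SingleOrbit (F.tour S) ↔ SingleOrbit (F₀.tour S')) := by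
    intro S S' hS hpp' hSS'
    obtain ⟨x1, x2, x3⟩ := hb.exit hS hpp'
    have tp : F.tour S p = F.around l := by rw [F.tour_of_leg S (by rwa [hep]), hep]
    have tp' : F.tour S p' = F.around l' := by rw [F.tour_of_leg S (by rwa [hep']), hep']
    cases isEmpty_or_nonempty H' with
    | inl hempty =>
      -- No point is left outside the deleted part, so there is no return map to compare with. The
      -- walk goes from `l` via the bubble to `p`, then to `l'`, `p'` and back to `l`, hence it is a
      -- single orbit, as is the empty walk.
      refine iff_of_true ?_ (singleOrbit_of_isEmpty _)
      have hw' : F.wilson = ↑[l, l'] := by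
        rw [hw, List.eq_nil_iff_forall_not_mem.2 fun x (_ : x ∈ A) => isEmptyElim x,
          List.eq_nil_iff_forall_not_mem.2 fun x (_ : x ∈ B) => isEmptyElim x]
        rfl
      have hal : F.around l = l' := by rw [F.around_eq_formPerm hw']; simp
      have hal' : F.around l' = l := by rw [F.around_eq_formPerm hw']; simp
      intro c hc
      have cl : c l ↔ c p := by rw [← hc l, (x1 l rfl).invariant hc]
      have cl' : c l' ↔ c p' := by rw [← hc l', (x2 l' rfl).invariant hc]
      have cp : c p ↔ c l' := by rw [← hc p, tp, hal]
      have all : ∀ x, c x ↔ c p := by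
        intro x
        have hx : x ∉ Set.range i := fun ⟨y, _⟩ => isEmptyElim y
        rw [hr] at hx
        have hx' : x = l ∨ x = l' ∨ x ∈ F.vertex p ∪ F.vertex p' := by
          by_contra hcon
          simp only [not_or, Set.mem_union] at hcon
          exact hx ⟨hcon.1, hcon.2.1, hcon.2.2⟩
        rw [mem_vertex_union_iff] at hx'
        rcases hx' with rfl | rfl | rfl | rfl | hx'
        · exact cl
        · exact cp.symm
        · rfl
        · exact (cp.trans cl').symm
        · rcases x3 x hx' with e | e
          · exact e.invariant hc
          · exact (e.invariant hc).trans (cp.trans cl').symm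
      intro x y hx
      rwa [all, ← all x]
    | inr hne =>
      have hABne : A.map i ++ B.map i ≠ [] := by
        obtain ⟨h₀⟩ := hne
        obtain ⟨k, hk, -⟩ := F₀.exists_leg h₀
        have hk' := (F₀.mem_wilson k).2 hk
        rw [hw₀, Cycle.mem_coe_iff] at hk'
        rw [← List.map_append]
        intro e
        rw [List.map_eq_nil_iff] at e
        rw [e] at hk'
        simp at hk'
      set Z : Set H := insert l (insert l' (F.vertex p ∪ F.vertex p')) with hZ
      have hBZ : F.bubbleInterior p p' ⊆ Z := fun x hx =>
        Or.inr (Or.inr (mem_vertex_union_iff.2 (Or.inr (Or.inr hx))))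
      have hpZ : p ∈ Z := Or.inr (Or.inr (Or.inl (F.self_mem_vertex p)))
      have hpZ' : p' ∈ Z := Or.inr (Or.inr (Or.inr (F.self_mem_vertex p')))
      -- From `l` the walk is reflected by the bubble, leaves at `p` and crosses back to the Wilson
      -- line at the successor of `l`. The chord therefore only delays the walk; likewise at `l'`.
      have ep : ∀ t, FirstExit (F.tour S) Z (F.around l) t → FirstExit (F.tour S) Z p t :=
        fun t ht => .step hpZ (by rwa [tp])
      have ep' : ∀ t, FirstExit (F.tour S) Z (F.around l') t → FirstExit (F.tour S) Z p' t :=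
        fun t ht => .step hpZ' (by rwa [tp'])
      have el : ∀ t, FirstExit (F.tour S) Z (F.around l) t → FirstExit (F.tour S) Z l t :=
        fun t ht => .step (Or.inl rfl) ((x1 l rfl).trans hBZ (ep t ht))
      have el' : ∀ t, FirstExit (F.tour S) Z (F.around l') t → FirstExit (F.tour S) Z l' t :=
        fun t ht => .step (Or.inr (Or.inl rfl)) ((x2 l' rfl).trans hBZ (ep' t ht))
      have hrange : ∀ x, x ∉ Z ↔ x ∈ Set.range i := by
        intro x
        rw [hr, hZ]
        simp only [Set.mem_insert_iff, not_or, Set.mem_union]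
        rfl
      have hlegs : ∀ k, F.next k = k → k = l ∨ k = l' ∨ k ∉ Z := by
        intro k hk
        have hkv : k ∉ F.vertex p ∪ F.vertex p' := by
          rintro (hh | hh)
          exacts [(F.trivalent_iff_of_mem_vertex hh).2 hb.1 hk,
            (F.trivalent_iff_of_mem_vertex hh).2 hb.2.1 hk]
        simp only [hZ, Set.mem_insert_iff]
        tauto
      have haround_leg : ∀ k, F.next k = k → F.next (F.around k) = F.around k := by
        intro k hk
        by_contra hcon
        exact (F.trivalent_around_iff.1 hcon) hk
      have hnot := List.formPerm_two_heads hn hABne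
      rw [← F.around_eq_formPerm hw] at hnot
      have hfix : ∀ k, k = l ∨ k = l' → F.around k ≠ k := by
        intro k hk e
        rw [F.around_eq_formPerm hw, List.formPerm_apply_mem_eq_self_iff _ hn] at e
        · simp at e
        · rcases hk with rfl | rfl <;> simp
      -- the exits from the two legs
      have exl : ∃ t, FirstExit (F.tour S) Z (F.around l) t := by
        rcases hlegs _ (haround_leg l hl) with e | e | e
        · exact absurd e (hfix l (Or.inl rfl))
        · rw [e]
          rcases hlegs _ (haround_leg l' hl') with e' | e' | e'
          · exact absurd ⟨e, e'⟩ hnot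
          · exact absurd e' (hfix l' (Or.inr rfl))
          · exact ⟨_, el' _ (.here e')⟩
        · exact ⟨_, .here e⟩
      have exl' : ∃ t, FirstExit (F.tour S) Z (F.around l') t := by
        rcases hlegs _ (haround_leg l' hl') with e | e | e
        · rw [e]
          exact exl.imp el
        · exact absurd e (hfix l' (Or.inr rfl))
        · exact ⟨_, .here e⟩
      refine singleOrbit_iff_of_return (Z := Z) i hi hrange ?_ ?_
      · intro h
        set k := F₀.edge h with hk
        have hik : i k = F.edge (i h) := hedge h
        have hturn : i (F₀.turn S' k) = F.turn S (i k) := by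
          by_cases hkS : k ∈ S'
          · rw [turn_of_mem _ hkS, turn_of_mem _ ((hSS' k).2 hkS), hnext]
          · rw [turn_of_notMem _ hkS, turn_of_notMem _ (mt (hSS' k).1 hkS), hnext, hnext]
        set z := F₀.turn S' k with hz
        have htour : F.tour S (i h) = F.around (i z) := by
          rw [tour, ← hik, hturn]
        have hres : i (F₀.tour S' h) = _ := around_deletion hi hw hw₀ z (hil z) (hil' z)
        have hrZ : i (F₀.tour S' h) ∉ Z := (hrange _).2 ⟨_, rfl⟩
        have hinj : ∀ x y, F.around x = F.around y → x = y := fun x y e => F.around.injective e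
        rw [htour]
        generalize hu : i (F₀.tour S' h) = u at hres hrZ
        by_cases h1 : F.around (i z) = l
        · have h2 : F.around l' ≠ l := fun e => hil' z (hinj _ _ (h1.trans e.symm))
          simp only [h1, h2, if_true, if_false] at hres
          rw [h1]
          apply el
          split_ifs at hres with h3
          · rw [h3]
            apply el'
            rw [← hres]
            exact .here hrZ
          · rw [← hres]
            exact .here hrZ
        · simp only [h1, if_false] at hres
          by_cases h2 : F.around (i z) = l'
          · rw [if_pos h2] at hres
            rw [h2]
            apply el'
            split_ifs at hres with h3
            · rw [h3]
              apply el
              rw [← hres]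
              exact .here hrZ
            · rw [← hres]
              exact .here hrZ
          · rw [if_neg h2] at hres
            rw [← hres]
            exact .here hrZ
      · intro x hx
        rcases hx with rfl | rfl | hx
        · exact exl.imp el
        · exact exl'.imp el'
        · rcases mem_vertex_union_iff.1 hx with rfl | rfl | hx
          · exact exl.imp ep
          · exact exl'.imp ep'
          · rcases x3 x hx with e | e
            · exact exl.imp fun t ht => e.trans hBZ (ep t ht)
            · exact exl'.imp fun t ht => e.trans hBZ (ep' t ht)
  rw [hb.conway_eq, orientationSum_image i hi horient hsub, conway, ← orientationSum_const_mul]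
  refine orientationSum_congr fun S' hS' _ => ?_
  obtain ⟨hS, hd⟩ := (horient S').1 hS'
  have hm := hb.mixed hd
  have hu : ∀ h, i h ∉ F.vertex p := fun h hh => hi_uv h (Or.inl hh)
  have hv : ∀ h, i h ∉ F.vertex p' := fun h hh => hi_uv h (Or.inr hh)
  -- The two mixed choices at the bubble restrict to the same choice on the rest, and each enters
  -- with sign -1: this is the factor -2.
  rw [main _ S' (F.union_vertex_mem hS hb.1) hm.1 (fun h => by
      rw [Set.mem_union, hi.mem_set_image]; exact or_iff_left (hu h)),
    main _ S' (F.union_vertex_mem hS hb.2.1) hm.2 (fun h => by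
      rw [Set.mem_union, hi.mem_set_image]; exact or_iff_left (hv h))]
  ring

end FeynmanDiagram

/-! ### The finite identity for the fragment `K` -/

/-- The cyclic orders at the two vertices of the fragment `K`, with the half-edges numbered
`a, b, 1, 2, 3, 4`. -/
def vertexTurns (s t : Bool) : Fin 6 → Fin 6 :=
  ![bif s then 2 else 3, bif t then 4 else 5, bif s then 3 else 0, bif s then 0 else 2,
    bif t then 5 else 1, bif t then 1 else 4]

/-- A bubble that joins the ends `j` and `j'`, where the boundary walk turns back (with a detour
through the edge `{a, b}` at `j`), and a plain arc that joins the ends `k` and `k'`. -/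
def cutTurns (j k k' : Fin 6) : Fin 6 → Fin 6 :=
  Equiv.swap 0 j ∘ Equiv.swap k k'

theorem cutTurns_injective (j k k' : Fin 6) : Function.Injective (cutTurns j k k') :=
  (Equiv.injective _).comp (Equiv.injective _)

/-- The list is the first return permutation of the outside of `K` on the half-edges `a, b, 1, 2, 3,
4`. It exchanges `a` and `b`, the two halves of the inner edge, so only the 24 permutations of the
four legs occur, and the identity is verified for each of them. -/
theorem vertexTurns_visitsAll : ∀ x y z w : Fin 6, [1, 0, x, y, z, w].Nodup →
    let T := fun τ : Fin 6 → Fin 6 => bif visitsAll (τ ∘ ![1, 0, x, y, z, w]) then (1 : ℤ) else 0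
    T (vertexTurns false false) - T (vertexTurns true false) -
        (T (vertexTurns false true) - T (vertexTurns true true)) =
      -(T (cutTurns 2 3 5) + T (cutTurns 3 2 4) - T (cutTurns 3 2 5) - T (cutTurns 2 3 4)) := by
  decide +kernel

theorem vertexTurns_injective : ∀ s t, Function.Injective (vertexTurns s t) := by
  decide +kernel

theorem vertexTurns_singleOrbit {π : Fin 6 → Fin 6} (hπ : Function.Injective π) (h0 : π 0 = 1)
    (h1 : π 1 = 0) :
    let T := fun τ : Fin 6 → Fin 6 => indicator01 (SingleOrbit (τ ∘ π))
    T (vertexTurns false false) - T (vertexTurns true false) -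
        (T (vertexTurns false true) - T (vertexTurns true true)) =
      -(T (cutTurns 2 3 5) + T (cutTurns 3 2 4) - T (cutTurns 3 2 5) - T (cutTurns 2 3 4)) := by
  have hfin : π = ![1, 0, π 2, π 3, π 4, π 5] := by
    funext r
    fin_cases r <;> simp [h0, h1]
  have hnd : [1, 0, π 2, π 3, π 4, π 5].Nodup := by
    have : [1, 0, π 2, π 3, π 4, π 5] = (List.finRange 6).map π := by
      simp [List.finRange_succ, h0, h1]
    rw [this]
    exact (List.nodup_finRange 6).map hπ
  have key := vertexTurns_visitsAll _ _ _ _ hnd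
  rw [← hfin] at key
  have hT : ∀ τ : Fin 6 → Fin 6, Function.Injective τ → indicator01 (SingleOrbit (τ ∘ π)) =
      (((bif visitsAll (τ ∘ π) then (1 : ℤ) else 0) : ℤ) : ℚ) := by
    intro τ hτ
    have := singleOrbit_iff_visitsAll (hτ.comp hπ)
    cases hv : visitsAll (τ ∘ π) with
    | true => rw [indicator01_true (this.2 hv)]; simp
    | false => rw [indicator01_false (by rw [this, hv]; simp)]; simp
  intro T
  simp only [T]
  rw [hT _ (vertexTurns_injective _ _), hT _ (vertexTurns_injective _ _),
    hT _ (vertexTurns_injective _ _), hT _ (vertexTurns_injective _ _),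
    hT _ (cutTurns_injective _ _ _), hT _ (cutTurns_injective _ _ _), hT _ (cutTurns_injective _ _ _),
    hT _ (cutTurns_injective _ _ _)]
  simp only at key
  exact_mod_cast key

namespace FeynmanDiagram

variable {H H' : Type} {F : FeynmanDiagram H}

/-! ### The fragment `K` -/

/-- The half-edges of the fragment `K`. -/
def ends (F : FeynmanDiagram H) (a b : H) : Fin 6 → H :=
  ![a, b, F.next a, F.next (F.next a), F.next b, F.next (F.next b)]

theorem range_ends (a b : H) : Set.range (F.ends a b) = F.vertex a ∪ F.vertex b := by
  ext x
  simp only [ends, Matrix.range_cons, Matrix.range_empty, Set.mem_union, Set.mem_singleton_iff,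
    mem_vertex, Set.mem_empty_iff_false]
  tauto

theorem ends_injective {a b : H} (h : F.HasK a b) : Function.Injective (F.ends a b) := by
  obtain ⟨ha, hb, hab, -⟩ := h
  have hnd : (List.ofFn (F.ends a b)).Nodup := by
    have hba : ∀ x ∈ F.vertex a, ∀ y ∈ F.vertex b, x ≠ y := by
      rintro x hx y hy rfl
      have := F.mem_vertex_comm.1 hy
      rw [F.vertex_eq_of_mem hx] at this
      exact hab this
    have self_ne : ∀ x, F.Trivalent x → x ≠ F.next x ∧ x ≠ F.next (F.next x) ∧
        F.next x ≠ F.next (F.next x) := fun x hx =>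
      ⟨fun e => hx e.symm, fun e => hx (F.next_next_eq_self_iff.1 e.symm),
        fun e => hx (F.next_injective e.symm)⟩
    have h1 := self_ne a ha
    have h2 := self_ne b hb
    simp only [vertex, SameVertex, Set.mem_ofPred_eq, forall_eq_or_imp, forall_eq] at hba
    simp only [ends, List.ofFn_succ, List.ofFn_zero, List.nodup_cons]
    simp
    tauto
  exact List.nodup_ofFn.1 hnd

open Classical in
/-- The boundary walk outside the fragment `K`: at the half-edges of the fragment it stops after
crossing the edge. -/
noncomputable def outerTour (F : FeynmanDiagram H) (a b : H) (S : Set H) (x : H) : H :=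
  if F.edge x ∈ F.vertex a ∪ F.vertex b then F.edge x else F.tour S x

theorem outerTour_of_mem {a b : H} (S : Set H) {x : H}
    (hx : F.edge x ∈ F.vertex a ∪ F.vertex b) : F.outerTour a b S x = F.edge x := if_pos hx

theorem outerTour_of_notMem {a b : H} (S : Set H) {x : H}
    (hx : F.edge x ∉ F.vertex a ∪ F.vertex b) : F.outerTour a b S x = F.tour S x := if_neg hx

theorem HasK.tour_mem_iff {a b : H} (h : F.HasK a b) (S : Set H) {x : H} :
    F.tour S x ∈ F.vertex a ∪ F.vertex b ↔ F.edge x ∈ F.vertex a ∪ F.vertex b := by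
  rw [Set.mem_union, tour_mem_vertex_iff S h.1, tour_mem_vertex_iff S h.2.1, Set.mem_union]

theorem HasK.outerTour_mem_iff {a b : H} (h : F.HasK a b) (S : Set H) {x : H} :
    F.outerTour a b S x ∈ F.vertex a ∪ F.vertex b ↔ F.edge x ∈ F.vertex a ∪ F.vertex b := by
  by_cases hx : F.edge x ∈ F.vertex a ∪ F.vertex b
  · rw [outerTour_of_mem S hx]
  · rw [outerTour_of_notMem S hx, h.tour_mem_iff]

theorem HasK.outerTour_injective {a b : H} (h : F.HasK a b) {S : Set H}
    (hS : S ∈ F.orientations) : Function.Injective (F.outerTour a b S) := by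
  intro x y e
  have := h.outerTour_mem_iff S (x := x)
  rw [e, h.outerTour_mem_iff] at this
  by_cases hx : F.edge x ∈ F.vertex a ∪ F.vertex b
  · rw [outerTour_of_mem S hx, outerTour_of_mem S (this.2 hx)] at e
    exact F.edge_injective e
  · rw [outerTour_of_notMem S hx, outerTour_of_notMem S (mt this.1 hx)] at e
    exact F.tour_injective hS e

/-- The boundary walk, with the fragment `K` replaced by `τ`. -/
noncomputable def replacedTour (F : FeynmanDiagram H) (a b : H) (τ : Fin 6 → Fin 6) (S : Set H) :
    H → H := insertMap (F.outerTour a b S) (F.ends a b) τ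

theorem HasK.replacedTour_of_eq {a b : H} (h : F.HasK a b) (τ : Fin 6 → Fin 6) (S : Set H) {x : H}
    {r : Fin 6} (hx : F.edge x = F.ends a b r) :
    F.replacedTour a b τ S x = F.ends a b (τ r) := by
  refine insertMap_of_eq (ends_injective h) τ ?_
  rw [outerTour_of_mem, hx]
  rw [hx, ← range_ends]
  exact ⟨r, rfl⟩

theorem HasK.replacedTour_of_notMem {a b : H} (h : F.HasK a b) (τ : Fin 6 → Fin 6) (S : Set H)
    {x : H} (hx : F.edge x ∉ F.vertex a ∪ F.vertex b) :
    F.replacedTour a b τ S x = F.tour S x := by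
  have h1 : F.outerTour a b S x = F.tour S x := outerTour_of_notMem S hx
  rw [replacedTour, insertMap_of_ne, h1]
  rw [h1, range_ends, h.tour_mem_iff]
  exact hx

/-- The bits `s` and `t` tell whether the vertices of `a` and of `b` keep their given order, and `S`
only governs the outside. The four choices at `K` thereby become four permutations inserted in one
and the same outer walk. -/
theorem HasK.tour_eq_replacedTour {a b : H} (h : F.HasK a b) {s t : Bool} {S S' : Set H}
    (hu : ∀ k ∈ F.vertex a, k ∈ S' ↔ s = true) (hv : ∀ k ∈ F.vertex b, k ∈ S' ↔ t = true)
    (hS : ∀ k, k ∉ F.vertex a ∪ F.vertex b → (k ∈ S' ↔ k ∈ S)) :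
    F.tour S' = F.replacedTour a b (vertexTurns s t) S := by
  funext x
  have ha := h.1
  have hb := h.2.1
  by_cases hx : F.edge x ∈ F.vertex a ∪ F.vertex b
  · have ht : F.Trivalent (F.edge x) := hx.elim
      (fun e => (F.trivalent_iff_of_mem_vertex e).2 ha)
      (fun e => (F.trivalent_iff_of_mem_vertex e).2 hb)
    rw [F.tour_of_trivalent _ ht]
    rw [← range_ends] at hx
    obtain ⟨r, hr⟩ := hx
    rw [h.replacedTour_of_eq _ _ hr.symm, ← hr]
    have ua : F.turn S' a = if s then F.next a else F.next (F.next a) := by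
      rw [turn]; simp [hu a (Or.inl rfl)]
    have ua1 : F.turn S' (F.next a) = if s then F.next (F.next a) else a := by
      rw [turn]; simp [hu _ (Or.inr (Or.inl rfl)), F.next_next_next]
    have ua2 : F.turn S' (F.next (F.next a)) = if s then a else F.next a := by
      rw [turn]; simp [hu _ (Or.inr (Or.inr rfl)), F.next_next_next]
    have ub : F.turn S' b = if t then F.next b else F.next (F.next b) := by
      rw [turn]; simp [hv b (Or.inl rfl)]
    have ub1 : F.turn S' (F.next b) = if t then F.next (F.next b) else b := by
      rw [turn]; simp [hv _ (Or.inr (Or.inl rfl)), F.next_next_next]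
    have ub2 : F.turn S' (F.next (F.next b)) = if t then b else F.next b := by
      rw [turn]; simp [hv _ (Or.inr (Or.inr rfl)), F.next_next_next]
    fin_cases r <;> cases s <;> cases t <;>
      simp [ends, vertexTurns, ua, ua1, ua2, ub, ub1, ub2]
  · rw [h.replacedTour_of_notMem _ _ hx, tour, tour]
    congr 1
    by_cases hk : F.edge x ∈ S
    · rw [turn_of_mem _ hk, turn_of_mem _ ((hS _ hx).2 hk)]
    · rw [turn_of_notMem _ hk, turn_of_notMem _ (mt (hS _ hx).1 hk)]

/-- The indicator of the diagram with the fragment `K` replaced by `τ`. -/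
noncomputable def replacedIndicator (F : FeynmanDiagram H) (a b : H) (τ : Fin 6 → Fin 6)
    (S : Set H) : ℚ := indicator01 (SingleOrbit (F.replacedTour a b τ S))

theorem HasK.replacedIndicator_eq {a b : H} (h : F.HasK a b) {S : Set H}
    (hS : S ∈ F.orientations) :
    let T := fun τ => F.replacedIndicator a b τ S
    T (vertexTurns false false) - T (vertexTurns true false) -
        (T (vertexTurns false true) - T (vertexTurns true true)) =
      -(T (cutTurns 2 3 5) + T (cutTurns 3 2 4) - T (cutTurns 3 2 5) - T (cutTurns 2 3 4)) := by
  have := F.finite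
  intro T
  rcases exists_return_insertMap (h.outerTour_injective hS) (ends_injective h) (by norm_num) with
    hno | ⟨π, hπ, hstep, hiff⟩
  -- Some orbit of the outer walk avoids the fragment, so none of the eight walks is connected.
  · have : ∀ τ, T τ = 0 := fun τ => indicator01_false (hno τ)
    simp only [this]
    norm_num
  · have hT : ∀ τ, T τ = indicator01 (SingleOrbit (τ ∘ π)) := fun τ => by
      simp only [T, replacedIndicator, replacedTour]
      rw [hiff]
    have h0 : π 0 = 1 := by
      refine hstep 0 1 ?_
      have e : F.edge (F.ends a b 0) = F.ends a b 1 := h.2.2.2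
      rw [outerTour_of_mem, e]
      rw [e, ← range_ends]
      exact ⟨1, rfl⟩
    have h1 : π 1 = 0 := by
      refine hstep 1 0 ?_
      have e : F.edge (F.ends a b 1) = F.ends a b 0 := by
        have : F.edge a = b := h.2.2.2
        change F.edge b = a
        rw [← this, F.edge_edge]
      rw [outerTour_of_mem, e]
      rw [e, ← range_ends]
      exact ⟨0, rfl⟩
    simp only [hT]
    exact vertexTurns_singleOrbit hπ h0 h1

/-- The contributions of the fragment `K`. -/
theorem HasK.conway_eq {a b : H} (h : F.HasK a b) : F.conway =
    -(F.orientationSum (F.vertex a ∪ F.vertex b) (F.replacedIndicator a b (cutTurns 2 3 5)) +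
      F.orientationSum (F.vertex a ∪ F.vertex b) (F.replacedIndicator a b (cutTurns 3 2 4)) -
      F.orientationSum (F.vertex a ∪ F.vertex b) (F.replacedIndicator a b (cutTurns 3 2 5)) -
      F.orientationSum (F.vertex a ∪ F.vertex b) (F.replacedIndicator a b (cutTurns 2 3 4))) := by
  have hab : b ∉ F.vertex a := h.2.2.1
  rw [conway, orientationSum_eq_two_vertices h.1 h.2.1 hab, ← orientationSum_add,
    ← orientationSum_sub, ← orientationSum_sub, neg_eq_neg_one_mul, ← orientationSum_const_mul]
  refine orientationSum_congr fun S hS hd => ?_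
  rw [Set.disjoint_union_right] at hd
  have hu : ∀ k ∈ F.vertex a, k ∉ S := fun k hk hk' => Set.disjoint_left.1 hd.1 hk' hk
  have hv : ∀ k ∈ F.vertex b, k ∉ S := fun k hk hk' => Set.disjoint_left.1 hd.2 hk' hk
  have huv : ∀ k ∈ F.vertex a, k ∉ F.vertex b := fun k hk hk' =>
    Set.disjoint_left.1 (F.disjoint_vertex hab) hk' hk
  have hvu : ∀ k ∈ F.vertex b, k ∉ F.vertex a := fun k hk hk' => huv k hk' hk
  have e1 : F.tour S = F.replacedTour a b (vertexTurns false false) S :=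
    h.tour_eq_replacedTour (fun k hk => by simp [hu k hk]) (fun k hk => by simp [hv k hk])
      (fun k hk => Iff.rfl)
  have e2 : F.tour (S ∪ F.vertex a) = F.replacedTour a b (vertexTurns true false) S :=
    h.tour_eq_replacedTour (fun k hk => by simp [hk]) (fun k hk => by simp [hv k hk, hvu k hk])
      (fun k hk => by
        rw [Set.mem_union] at hk
        simp only [Set.mem_union]
        tauto)
  have e3 : F.tour (S ∪ F.vertex b) = F.replacedTour a b (vertexTurns false true) S :=
    h.tour_eq_replacedTour (fun k hk => by simp [hu k hk, huv k hk]) (fun k hk => by simp [hk])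
      (fun k hk => by
        rw [Set.mem_union] at hk
        simp only [Set.mem_union]
        tauto)
  have e4 : F.tour (S ∪ F.vertex b ∪ F.vertex a) =
      F.replacedTour a b (vertexTurns true true) S :=
    h.tour_eq_replacedTour (fun k hk => by simp [hk]) (fun k hk => by simp [hk])
      (fun k hk => by
        rw [Set.mem_union] at hk
        simp only [Set.mem_union]
        tauto)
  have := h.replacedIndicator_eq hS
  simp only at this
  rw [e1, e2, e3, e4, neg_one_mul, ← this]
  rfl

/-- The cyclic order at a vertex which is joined to the bubble does not matter. -/
theorem HasK.orientationSum_cut_eq_zero {a b : H} (h : F.HasK a b) {τ : Fin 6 → Fin 6}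
    (hτ : Function.Injective τ) {j : Fin 6} (hj0 : j ≠ 0) (hj1 : j ≠ 1) (h0 : τ 0 = j)
    (hj : τ j = 0) (h1 : τ 1 = 1) (hc : F.Trivalent (F.edge (F.ends a b j)))
    (hcK : F.edge (F.ends a b j) ∉ F.vertex a ∪ F.vertex b) :
    F.orientationSum (F.vertex a ∪ F.vertex b) (F.replacedIndicator a b τ) = 0 := by
  set d := F.ends a b j with hd
  set c := F.edge d with hcd
  have hec : F.edge c = d := F.edge_edge d
  have hab : F.edge a = b := h.2.2.2
  have hba : F.edge b = a := by rw [← hab, F.edge_edge]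
  have hinj := ends_injective h
  have hends : ∀ r, F.ends a b r ∈ F.vertex a ∪ F.vertex b := fun r => by
    rw [← range_ends]
    exact ⟨r, rfl⟩
  have hdisj : Disjoint (F.vertex c) (F.vertex a ∪ F.vertex b) := by
    rw [Set.disjoint_union_right]
    exact ⟨F.disjoint_vertex fun hh => hcK (Or.inl hh),
      F.disjoint_vertex fun hh => hcK (Or.inr hh)⟩
  have hw : ∀ k ∈ F.vertex c, ∀ r, k ≠ F.ends a b r := by
    rintro k hk r rfl
    exact Set.disjoint_left.1 hdisj hk (hends r)
  have hwZ : ∀ k ∈ F.vertex c, k ∉ ({a, b} : Set H) := by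
    intro k hk
    simp only [Set.mem_insert_iff, Set.mem_singleton_iff, not_or]
    exact ⟨hw k hk 0, hw k hk 1⟩
  have hy : F.next c ∈ F.vertex c := Or.inr (Or.inl rfl)
  have hz : F.next (F.next c) ∈ F.vertex c := Or.inr (Or.inr rfl)
  have hdZ : d ∉ ({a, b} : Set H) := by
    simp only [Set.mem_insert_iff, Set.mem_singleton_iff, not_or]
    exact ⟨fun e => hj0 (hinj (hd.symm.trans e)), fun e => hj1 (hinj (hd.symm.trans e))⟩
  rw [orientationSum_eq_vertex hc hdisj, orientationSum_congr (g' := fun _ => 0 * 0),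
    orientationSum_const_mul, zero_mul]
  intro S hS hSd
  rw [Set.disjoint_union_right] at hSd
  have hwS : ∀ k ∈ F.vertex c, k ∉ S := fun k hk => Set.disjoint_right.1 hSd.2 hk
  rw [replacedIndicator, replacedIndicator, mul_zero, sub_eq_zero]
  congr 1
  rw [eq_iff_iff]
  -- The excursion into the cut arc runs through `c`, `a`, `b`, `d`. The detour over the inner edge
  -- keeps `a` and `b` from forming an orbit of their own.
  have xb : ∀ S, FirstExit (F.replacedTour a b τ S) {a, b} b d := by
    intro S
    refine .step (by simp) ?_
    rw [h.replacedTour_of_eq τ S (r := 0) hba, h0]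
    exact .here hdZ
  have xa : ∀ S, FirstExit (F.replacedTour a b τ S) {a, b} a d := by
    intro S
    refine .step (by simp) ?_
    rw [h.replacedTour_of_eq τ S (r := 1) hab, h1]
    exact xb S
  have xc : ∀ S, FirstExit (F.replacedTour a b τ S) {a, b} (F.replacedTour a b τ S c) d := by
    intro S
    rw [h.replacedTour_of_eq τ S (r := j) hec, hj]
    exact xa S
  have xZ : ∀ S, ∀ x ∈ ({a, b} : Set H), ∃ t, FirstExit (F.replacedTour a b τ S) {a, b} x t := by
    rintro S x (rfl | rfl)
    exacts [⟨_, xa S⟩, ⟨_, xb S⟩]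
  have hwt : ∀ k ∈ F.vertex c, F.Trivalent k := fun k hk =>
    (F.trivalent_iff_of_mem_vertex hk).2 hc
  have hwt' : ∀ x, F.edge x ∈ F.vertex c → ∀ S, F.replacedTour a b τ S x = F.turn S (F.edge x) := by
    intro x hx S
    rw [h.replacedTour_of_notMem τ S (Set.disjoint_left.1 hdisj hx),
      F.tour_of_trivalent _ (hwt _ hx)]
  have hself := F.self_mem_vertex c
  refine singleOrbit_congr_of_flip (Z := {a, b}) (c := c) (d := d) (y := F.next c)
    (z := F.next (F.next c)) (hwZ _ hy) (hwZ _ hz) hc (hw _ hy j)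
    (fun e => hc (F.next_next_eq_self_iff.1 e)) (hw _ hz j) (xc _) (xc _) ?_ ?_ (xZ _) (xZ _) ?_
  · rw [hwt' d hself, ← hcd, F.turn_of_notMem (hwS _ hself)]
  · rw [hwt' d hself, ← hcd, F.turn_union_vertex _ hself]
  · intro x hxZ hxc hxd
    simp only [Set.mem_insert_iff, Set.mem_singleton_iff, not_or] at hxZ
    by_cases hxw : F.edge x ∈ F.vertex c
    · rw [hwt' x hxw, hwt' x hxw, F.turn_of_notMem (hwS _ hxw), F.turn_union_vertex _ hxw]
      rcases hxw with e | e | e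
      · exact absurd (F.edge_injective (e.trans hcd)) hxd
      · rw [e]
        exact Or.inl ⟨F.next_next_next c, rfl⟩
      · rw [e, F.next_next_next]
        exact Or.inr (Or.inl ⟨rfl, F.next_next_next c⟩)
    · right; right
      by_cases hxK : F.edge x ∈ F.vertex a ∪ F.vertex b
      · rw [← range_ends] at hxK
        obtain ⟨r, hr⟩ := hxK
        have hr0 : r ≠ 0 := by
          rintro rfl
          refine hxZ.2 (F.edge_injective (hr.symm.trans ?_))
          exact hba.symm
        have hr1 : r ≠ 1 := by
          rintro rfl
          refine hxZ.1 (F.edge_injective (hr.symm.trans ?_))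
          exact hab.symm
        have hrj : r ≠ j := by
          rintro rfl
          exact hxc (F.edge_injective (hr.symm.trans hec.symm))
        have n0 : τ r ≠ 0 := fun e => hrj (hτ (e.trans hj.symm))
        have n1 : τ r ≠ 1 := fun e => hr1 (hτ (e.trans h1.symm))
        have nj : τ r ≠ j := fun e => hr0 (hτ (e.trans h0.symm))
        have hnot : F.ends a b (τ r) ∉ ({a, b} : Set H) := by
          simp only [Set.mem_insert_iff, Set.mem_singleton_iff, not_or]
          exact ⟨fun e => n0 (hinj e), fun e => n1 (hinj e)⟩
        rw [h.replacedTour_of_eq τ _ hr.symm, h.replacedTour_of_eq τ _ hr.symm]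
        exact ⟨_, fun e => hw c hself (τ r) e.symm, fun e => nj (hinj (e.trans hd)), .here hnot,
          .here hnot⟩
      · rw [h.replacedTour_of_notMem τ _ hxK, h.replacedTour_of_notMem τ _ hxK,
          tour_union_of_notMem hxw]
        have hnot : ∀ r, F.tour S x ≠ F.ends a b r := by
          intro r e
          refine hxK ((h.tour_mem_iff S).1 ?_)
          rw [e]
          exact hends r
        have hnot' : F.tour S x ∉ ({a, b} : Set H) := by
          simp only [Set.mem_insert_iff, Set.mem_singleton_iff, not_or]
          exact ⟨hnot 0, hnot 1⟩
        refine ⟨_, fun e => hxw ?_, hnot j, .here hnot', .here hnot'⟩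
        rw [← tour_mem_vertex_iff S hc, e]
        exact hself

theorem cutTurns_properties : ∀ j k k' : Fin 6, j ≠ 0 → j ≠ 1 → k ≠ 0 → k ≠ 1 → k' ≠ 0 → k' ≠ 1 →
    k ≠ j → k' ≠ j → cutTurns j k k' 0 = j ∧ cutTurns j k k' j = 0 ∧ cutTurns j k k' 1 = 1 ∧
      cutTurns j k k' k = k' ∧ cutTurns j k k' k' = k ∧
      ∀ r, r ≠ 0 → r ≠ j → r ≠ k → r ≠ k' → cutTurns j k k' r = r := by
  decide +kernel

/-- The expansion of `K` is applied to the central vertex and one of its neighbours. In each of the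
four terms the arc is cut at one of the two other half-edges of the central vertex, which leads to a
trivalent vertex outside `K`; the two cyclic orders there cancel. The sums over inserted
permutations make sense even when the replacement diagrams do not exist. -/
theorem HasTripodTree.conway_eq_zero {c : H} (h : F.HasTripodTree c) : F.conway = 0 := by
  obtain ⟨hc, h1, h2⟩ := h
  have self : F.SameVertex c c := Or.inl rfl
  have s1 : F.SameVertex c (F.next c) := Or.inr (Or.inl rfl)
  have s2 : F.SameVertex c (F.next (F.next c)) := Or.inr (Or.inr rfl)
  have hK : F.HasK c (F.edge c) := ⟨hc, (h1 c self).1, (h1 c self).2, rfl⟩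
  have key : ∀ p, F.SameVertex c p → c ≠ p → F.edge p ∉ F.vertex c ∪ F.vertex (F.edge c) := by
    rintro p hp hne (e | e)
    · exact (h1 p hp).2 e
    · exact h2 c p self hp hne e
  have k1 := key _ s1 (fun e => hc e.symm)
  have k2 := key _ s2 (fun e => hc (F.next_next_eq_self_iff.1 e.symm))
  have cut : ∀ j k k' : Fin 6, (j = 2 ∨ j = 3) → k ≠ 0 → k ≠ 1 → k' ≠ 0 → k' ≠ 1 → k ≠ j →
      k' ≠ j → F.orientationSum (F.vertex c ∪ F.vertex (F.edge c))
        (F.replacedIndicator c (F.edge c) (cutTurns j k k')) = 0 := by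
    intro j k k' hj hk0 hk1 hk0' hk1' hkj hkj'
    have hj01 : j ≠ 0 ∧ j ≠ 1 := by rcases hj with rfl | rfl <;> decide
    obtain ⟨p1, p2, p3, -⟩ := cutTurns_properties j k k' hj01.1 hj01.2 hk0 hk1 hk0' hk1' hkj hkj'
    refine hK.orientationSum_cut_eq_zero (cutTurns_injective _ _ _) hj01.1 hj01.2 p1 p2 p3 ?_ ?_
    · rcases hj with rfl | rfl
      exacts [(h1 _ s1).1, (h1 _ s2).1]
    · rcases hj with rfl | rfl
      exacts [k1, k2]
  rw [hK.conway_eq, cut, cut, cut, cut]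
  · norm_num
  all_goals decide

end FeynmanDiagram

/-! ### Replacement diagrams of the fragment `K` -/

namespace FeynmanDiagram

variable {H : Type} {F G : FeynmanDiagram H}

section SameVertices

theorem vertex_congr (hn : G.next = F.next) : G.vertex = F.vertex := by
  funext h
  ext k
  rw [mem_vertex, mem_vertex, hn]

theorem orientations_congr (hn : G.next = F.next) : G.orientations = F.orientations := by
  ext S
  simp only [orientations, Trivalent, hn]

theorem turn_congr (hn : G.next = F.next) : G.turn = F.turn := by
  funext S h
  simp only [turn, hn]

theorem around_congr (hw : G.wilson = F.wilson) : G.around = F.around := by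
  classical
  obtain ⟨L, hL⟩ := Quotient.exists_rep F.wilson
  have hL' : F.wilson = (L : Cycle H) := hL.symm
  rw [around_eq_formPerm _ hL', around_eq_formPerm _ (hw.trans hL')]

theorem orientationSum_congr_next (hn : G.next = F.next) (P : Set H) (g : Set H → ℚ) :
    G.orientationSum P g = F.orientationSum P g := by
  rw [orientationSum, orientationSum, orientations_congr hn]

end SameVertices

/-- With opposite orders in the bubble of `G`, both walks turn back at `p` and `p'`, and both
connect the outer ends of `q` and `q'`. They differ only in how they pass through `a`, `b`, `q`,
`q'`, so their first return maps to the other half-edges agree. -/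
theorem HasK.singleOrbit_replacement {a b : H} (h : F.HasK a b) {p p' q q' : H}
    (hG : F.IsKReplacement a b p p' q q' G) {j j' k k' : Fin 6} (hp : p = F.ends a b j)
    (hp' : p' = F.ends a b j') (hq : q = F.ends a b k) (hq' : q' = F.ends a b k')
    (hint : F.bubbleInterior p p' = {a, b, q, q'})
    (hk0 : k ≠ 0) (hk1 : k ≠ 1) (hk0' : k' ≠ 0) (hk1' : k' ≠ 1)
    {τ : Fin 6 → Fin 6} (t0 : τ 0 = j) (tj : τ j = 0) (t1 : τ 1 = 1) (tk : τ k = k')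
    (tk' : τ k' = k) (tj' : τ j' = j')
    (hends : F.vertex a ∪ F.vertex b = {a, b, p, p', q, q'})
    {S₀ S : Set H} (hS : S ∈ F.orientations) (hpp' : ¬ (p ∈ S ↔ p' ∈ S))
    (hSS₀ : ∀ x, x ∉ F.vertex a ∪ F.vertex b → (x ∈ S ↔ x ∈ S₀)) :
    SingleOrbit (G.tour S) ↔ SingleOrbit (F.replacedTour a b τ S₀) := by
  obtain ⟨hqq', hn, hw, hb, hqe, hrest⟩ := hG
  have hSG : S ∈ G.orientations := by rwa [orientations_congr hn]
  have hintG : G.bubbleInterior p p' = {a, b, q, q'} := by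
    rw [← hint, bubbleInterior, bubbleInterior, hn]
  obtain ⟨x1, x2, x3⟩ := hb.exit hSG hpp'
  have hedgeZ : ∀ x, G.edge x ∈ ({a, b, q, q'} : Set H) ↔ x ∈ ({a, b, q, q'} : Set H) := by
    intro x
    rw [← hintG, hb.edge_mem_interior_iff]
  have hpZ : p ∉ ({a, b, q, q'} : Set H) := by
    rw [← hintG]
    exact hb.notMem_interior
  have hpZ' : p' ∉ ({a, b, q, q'} : Set H) := by
    rw [← hintG, bubbleInterior_comm]
    exact hb.symm.notMem_interior
  rw [hintG] at x1 x2 x3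
  set Z : Set H := {a, b, q, q'} with hZ
  have hinj := ends_injective h
  have hab : F.edge a = b := h.2.2.2
  have hba : F.edge b = a := by rw [← hab, F.edge_edge]
  set V := F.replacedTour a b τ S₀ with hV
  have vb : FirstExit V Z b p := by
    refine .step (by simp [hZ]) ?_
    rw [hV, h.replacedTour_of_eq τ S₀ (r := 0) hba, t0, ← hp]
    exact .here hpZ
  have va : FirstExit V Z a p := by
    refine .step (by simp [hZ]) ?_
    rw [hV, h.replacedTour_of_eq τ S₀ (r := 1) hab, t1]
    exact vb
  have htour : ∀ x y, G.edge x = F.edge y → F.edge y ∉ F.vertex a ∪ F.vertex b →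
      G.tour S x = F.tour S₀ y := by
    intro x y e hy
    rw [tour, tour, around_congr hw, turn_congr hn, e]
    congr 1
    by_cases hk : F.edge y ∈ S
    · rw [turn_of_mem _ hk, turn_of_mem _ ((hSS₀ _ hy).1 hk)]
    · rw [turn_of_notMem _ hk, turn_of_notMem _ (mt (hSS₀ _ hy).2 hk)]
  -- Once both walks arrive at the same half-edge outside `Z`, they continue to the same point.
  have helper : ∀ x y, G.edge x = F.edge y → F.edge y ∉ Z →
      ∃ t, FirstExit (G.tour S) Z (G.tour S x) t ∧ FirstExit V Z (V y) t := by
    intro x y e hy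
    by_cases hyp : F.edge y = p
    · refine ⟨p, x1 x (e.trans hyp), ?_⟩
      rw [hV, h.replacedTour_of_eq τ S₀ (hyp.trans hp), tj]
      exact va
    by_cases hyp' : F.edge y = p'
    · refine ⟨p', x2 x (e.trans hyp'), ?_⟩
      rw [hV, h.replacedTour_of_eq τ S₀ (hyp'.trans hp'), tj', ← hp']
      exact .here hpZ'
    have hyK : F.edge y ∉ F.vertex a ∪ F.vertex b := by
      rw [hends]
      simp only [hZ, Set.mem_insert_iff, Set.mem_singleton_iff] at hy ⊢
      tauto
    have hnot : F.tour S₀ y ∉ Z := by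
      intro hh
      refine hyK ((h.tour_mem_iff S₀).1 ?_)
      rw [hends]
      simp only [hZ, Set.mem_insert_iff, Set.mem_singleton_iff] at hh ⊢
      tauto
    refine ⟨F.tour S₀ y, ?_, ?_⟩
    · rw [htour x y e hyK]
      exact .here hnot
    · rw [hV, h.replacedTour_of_notMem τ S₀ hyK]
      exact .here hnot
  have eqe : G.edge (F.edge q') = F.edge q := by rw [← hqe, G.edge_edge]
  have hqZ : q ∈ Z := by simp [hZ]
  have hqZ' : q' ∈ Z := by simp [hZ]
  have swap_edge : ∀ {x y : H}, F.edge x = y → x = F.edge y := fun e => by rw [← e, F.edge_edge]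
  have edge_q : F.edge q ∉ Z := by
    simp only [hZ, Set.mem_insert_iff, Set.mem_singleton_iff, not_or]
    refine ⟨fun e => hk1 ?_, fun e => hk0 ?_, F.edge_ne q, hqq'⟩
    · refine hinj (hq.symm.trans ((swap_edge e).trans hab))
    · refine hinj (hq.symm.trans ((swap_edge e).trans hba))
  have edge_q' : F.edge q' ∉ Z := by
    simp only [hZ, Set.mem_insert_iff, Set.mem_singleton_iff, not_or]
    refine ⟨fun e => hk1' ?_, fun e => hk0' ?_, fun e => hqq' (swap_edge e).symm, F.edge_ne q'⟩
    · refine hinj (hq'.symm.trans ((swap_edge e).trans hab))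
    · refine hinj (hq'.symm.trans ((swap_edge e).trans hba))
  obtain ⟨s, -, hs⟩ := helper _ q eqe edge_q
  obtain ⟨s', -, hs'⟩ := helper _ q' hqe edge_q'
  refine singleOrbit_congr_of_return (Z := Z) ?_ ?_ ?_
  · intro x hx
    by_cases hxq : F.edge x = q
    · have e : G.edge x = F.edge q' := by rw [swap_edge hxq, hqe]
      obtain ⟨t, h1, h2⟩ := helper x q' e edge_q'
      refine ⟨t, h1, ?_⟩
      rw [hV, h.replacedTour_of_eq τ S₀ (hxq.trans hq), tk, ← hq']
      exact .step hqZ' h2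
    by_cases hxq' : F.edge x = q'
    · have e : G.edge x = F.edge q := by rw [swap_edge hxq', eqe]
      obtain ⟨t, h1, h2⟩ := helper x q e edge_q
      refine ⟨t, h1, ?_⟩
      rw [hV, h.replacedTour_of_eq τ S₀ (hxq'.trans hq'), tk', ← hq]
      exact .step hqZ h2
    simp only [hZ, Set.mem_insert_iff, Set.mem_singleton_iff, not_or] at hx
    refine helper x x (hrest x hx.1 hx.2.1 hx.2.2.1 hx.2.2.2 ?_ ?_) ?_
    · rintro rfl
      exact hxq (F.edge_edge q)
    · rintro rfl
      exact hxq' (F.edge_edge q')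
    · simp only [hZ, Set.mem_insert_iff, Set.mem_singleton_iff, not_or]
      exact ⟨fun e => hx.2.1 ((swap_edge e).trans hab), fun e => hx.1 ((swap_edge e).trans hba),
        hxq, hxq'⟩
  · exact fun x hx => (x3 x hx).elim (fun e => ⟨_, e⟩) (fun e => ⟨_, e⟩)
  · rintro x (rfl | rfl | rfl | rfl)
    · exact ⟨_, va⟩
    · exact ⟨_, vb⟩
    · exact ⟨_, .step hqZ hs⟩
    · exact ⟨_, .step hqZ' hs'⟩

/-- The diagrams obtained by a replacement of the fragment `K`. -/
theorem HasK.conway_replacement {a b : H} (h : F.HasK a b) {j j' k k' : Fin 6}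
    (hjk : (j = 2 ∧ k = 3) ∨ (j = 3 ∧ k = 2)) (hjk' : (j' = 4 ∧ k' = 5) ∨ (j' = 5 ∧ k' = 4))
    (hG : F.IsKReplacement a b (F.ends a b j) (F.ends a b j') (F.ends a b k) (F.ends a b k') G) :
    G.conway = -2 * F.orientationSum (F.vertex a ∪ F.vertex b)
      (F.replacedIndicator a b (cutTurns j k k')) := by
  have hn := hG.2.1
  have hb := hG.2.2.2.1
  have hj : F.ends a b j ∈ F.vertex a := by
    rcases hjk with ⟨rfl, -⟩ | ⟨rfl, -⟩
    exacts [Or.inr (Or.inl rfl), Or.inr (Or.inr rfl)]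
  have hj' : F.ends a b j' ∈ F.vertex b := by
    rcases hjk' with ⟨rfl, -⟩ | ⟨rfl, -⟩
    exacts [Or.inr (Or.inl rfl), Or.inr (Or.inr rfl)]
  have hint : F.bubbleInterior (F.ends a b j) (F.ends a b j') =
      {a, b, F.ends a b k, F.ends a b k'} := by
    rcases hjk with ⟨rfl, rfl⟩ | ⟨rfl, rfl⟩ <;> rcases hjk' with ⟨rfl, rfl⟩ | ⟨rfl, rfl⟩ <;>
    · ext x
      simp only [bubbleInterior, ends, Set.mem_insert_iff, Set.mem_singleton_iff, Matrix.cons_val,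
        F.next_next_next]
      tauto
  have hends : F.vertex a ∪ F.vertex b =
      {a, b, F.ends a b j, F.ends a b j', F.ends a b k, F.ends a b k'} := by
    rcases hjk with ⟨rfl, rfl⟩ | ⟨rfl, rfl⟩ <;> rcases hjk' with ⟨rfl, rfl⟩ | ⟨rfl, rfl⟩ <;>
    · ext x
      simp only [Set.mem_union, mem_vertex, ends, Set.mem_insert_iff, Set.mem_singleton_iff,
        Matrix.cons_val]
      tauto
  have hj01 : j ≠ 0 ∧ j ≠ 1 := by rcases hjk with ⟨rfl, -⟩ | ⟨rfl, -⟩ <;> decide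
  have hk01 : k ≠ 0 ∧ k ≠ 1 := by rcases hjk with ⟨-, rfl⟩ | ⟨-, rfl⟩ <;> decide
  have hk01' : k' ≠ 0 ∧ k' ≠ 1 := by rcases hjk' with ⟨-, rfl⟩ | ⟨-, rfl⟩ <;> decide
  have hkj : k ≠ j := by rcases hjk with ⟨rfl, rfl⟩ | ⟨rfl, rfl⟩ <;> decide
  have hkj' : k' ≠ j := by
    rcases hjk with ⟨rfl, -⟩ | ⟨rfl, -⟩ <;> rcases hjk' with ⟨-, rfl⟩ | ⟨-, rfl⟩ <;> decide
  have hj'0 : j' ≠ 0 ∧ j' ≠ j ∧ j' ≠ k ∧ j' ≠ k' := by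
    rcases hjk with ⟨rfl, rfl⟩ | ⟨rfl, rfl⟩ <;> rcases hjk' with ⟨rfl, rfl⟩ | ⟨rfl, rfl⟩ <;> decide
  obtain ⟨t0, tj, t1, tk, tk', tr⟩ := cutTurns_properties j k k' hj01.1 hj01.2 hk01.1 hk01.2
    hk01'.1 hk01'.2 hkj hkj'
  have main : ∀ {S₀ S : Set H}, S ∈ F.orientations →
      ¬ (F.ends a b j ∈ S ↔ F.ends a b j' ∈ S) →
      (∀ x, x ∉ F.vertex a ∪ F.vertex b → (x ∈ S ↔ x ∈ S₀)) →
      (SingleOrbit (G.tour S) ↔ SingleOrbit (F.replacedTour a b (cutTurns j k k') S₀)) :=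
    fun hS hpp hSS => h.singleOrbit_replacement hG rfl rfl rfl rfl hint hk01.1 hk01.2 hk01'.1
      hk01'.2 t0 tj t1 tk tk' (tr j' hj'0.1 hj'0.2.1 hj'0.2.2.1 hj'0.2.2.2) hends hS hpp hSS
  have hva : G.vertex (F.ends a b j) = F.vertex a := by
    rw [vertex_congr hn, F.vertex_eq_of_mem hj]
  have hvb : G.vertex (F.ends a b j') = F.vertex b := by
    rw [vertex_congr hn, F.vertex_eq_of_mem hj']
  have hcong := hb.conway_eq
  rw [hva, hvb, orientationSum_congr_next hn] at hcong
  rw [hcong, ← orientationSum_const_mul]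
  refine orientationSum_congr fun S hS hd => ?_
  have hm := hb.mixed (S := S) (by rwa [hva, hvb])
  rw [hva, hvb] at hm
  -- The inserted permutation ignores the orders at `a` and `b`, so both mixed choices for the
  -- bubble give the same walk; hence the factor -2.
  rw [main (F.union_vertex_mem hS h.1) hm.1 (S₀ := S), main (F.union_vertex_mem hS h.2.1) hm.2
    (S₀ := S), replacedIndicator]
  · ring
  · exact fun x hx => or_iff_left fun e => hx (Or.inr e)
  · exact fun x hx => or_iff_left fun e => hx (Or.inl e)

end FeynmanDiagram

/-! ### The Alexander polynomial of singular braids -/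

/-! ### Rank one perturbations and minors of permutation matrices -/

section Determinants

open Matrix

/-- By the Schur complement this is the determinant of `N` bordered by the column `x` and a last row
`(-s y, 1)`. The parameter occurs in one row only, so the determinant is affine in `s` and is
interpolated between `s = 0` and `s = 1`. -/
theorem Matrix.det_add_smul_mul {n R : Type*} [Fintype n] [DecidableEq n] [CommRing R]
    (N : Matrix n n R) (x : Matrix n Unit R) (y : Matrix Unit n R) (s : R) :
    (N + s • (x * y)).det = (1 - s) * N.det + s * (N + x * y).det := by
  have key : ∀ s : R, (N + s • (x * y)).det =
      ((fromBlocks N x (-(0 : Matrix Unit n R)) 1).updateRow (Sum.inr ())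
        (Sum.elim (0 : n → R) (1 : Unit → R) + s • Sum.elim (-(y ())) (0 : Unit → R))).det := by
    intro s
    have : (fromBlocks N x (-(0 : Matrix Unit n R)) 1).updateRow (Sum.inr ())
        (Sum.elim (0 : n → R) (1 : Unit → R) + s • Sum.elim (-(y ())) (0 : Unit → R)) = fromBlocks N x (-(s • y)) 1 := by
      ext (i | i) (j | j)
      · simp [updateRow_apply]
      · simp [updateRow_apply]
      · simp [updateRow_apply]
      · simp [updateRow_apply]
    rw [this, det_fromBlocks_one₂₂]
    congr 1
    rw [Matrix.mul_neg, sub_neg_eq_add, Matrix.mul_smul]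
  have h0 := key 0
  have h1 := key 1
  rw [zero_smul, add_zero] at h0
  rw [one_smul] at h1
  rw [key s, h0, h1]
  simp only [det_updateRow_add, det_updateRow_smul]
  ring

/-- The minor of `1 - M` without the first row and column. -/
noncomputable def reducedDet {m : ℕ} {R : Type*} [CommRing R]
    (M : Matrix (Fin (m + 1)) (Fin (m + 1)) R) : R :=
  ((1 - M).submatrix Fin.succ Fin.succ).det

theorem reducedDet_map {m : ℕ} {R S : Type*} [CommRing R] [CommRing S] (f : R →+* S)
    (M : Matrix (Fin (m + 1)) (Fin (m + 1)) R) :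
    f (reducedDet M) = reducedDet (f.mapMatrix M) := by
  rw [reducedDet, reducedDet, RingHom.map_det]
  congr 1
  rw [← map_one f.mapMatrix, ← map_sub]
  rfl

/-- The minor is an affine function of a rank one perturbation. -/
theorem reducedDet_affine {m : ℕ} {R : Type*} [CommRing R]
    (A C : Matrix (Fin (m + 1)) (Fin (m + 1)) R) (x : Matrix (Fin (m + 1)) Unit R)
    (y : Matrix Unit (Fin (m + 1)) R) (s : R) :
    reducedDet (A * (1 - s • (x * y)) * C) =
      (1 - s) * reducedDet (A * C) + s * reducedDet (A * (1 - x * y) * C) := by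
  have key : ∀ s : R, (1 - A * (1 - s • (x * y)) * C).submatrix Fin.succ Fin.succ =
      (1 - A * C).submatrix Fin.succ Fin.succ +
        s • ((A * x).submatrix Fin.succ id * (y * C).submatrix id Fin.succ) := by
    intro s
    have : 1 - A * (1 - s • (x * y)) * C = (1 - A * C) + s • ((A * x) * (y * C)) := by
      simp only [Matrix.mul_sub, Matrix.sub_mul, Matrix.mul_one, Matrix.mul_smul, Matrix.smul_mul,
        Matrix.mul_assoc]
      abel
    rw [this]
    rfl
  have h1 := key 1
  simp only [one_smul] at h1
  rw [reducedDet, reducedDet, reducedDet, key s, h1, Matrix.det_add_smul_mul]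

theorem permMatrix_entry {n : Type*} [DecidableEq n] (σ : Equiv.Perm n) (a b : n) :
    σ.permMatrix ℚ a b = if σ a = b then 1 else 0 :=
  (PEquiv.toMatrix_apply _ a b).trans (by simp [eq_comm])

/-- For a permutation matrix, the minor tells whether the permutation is a cycle of maximal
length. -/
theorem reducedDet_permMatrix {m : ℕ} (σ : Equiv.Perm (Fin (m + 1))) :
    reducedDet (σ.permMatrix ℚ) = indicator01 (SingleOrbit σ) := by
  classical
  have entry : ∀ a b, (1 - σ.permMatrix ℚ) a b =
      (if a = b then 1 else 0) - (if σ a = b then 1 else 0) := by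
    intro a b
    rw [Matrix.sub_apply, Matrix.one_apply, permMatrix_entry]
  by_cases h : SingleOrbit σ
  · rw [indicator01_true h, reducedDet]
    have hex : ∀ a : Fin m, ∃ n, σ^[n] 0 = a.succ := fun a => h.exists_iterate σ.injective 0 _
    -- `b a` is the time at which the orbit of `0` first reaches `a.succ`. Since `σ` raises this
    -- time as long as it does not return to `0`, the minor is triangular with diagonal entries 1 in
    -- this order.
    set b : Fin m → ℕ := fun a => Nat.find (hex a) with hb
    have hbs : ∀ a, σ^[b a] 0 = a.succ := fun a => Nat.find_spec (hex a)
    have hbinj : Function.Injective b := by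
      intro a a' e
      have := hbs a
      rw [e, hbs a'] at this
      exact (Fin.succ_injective _ this).symm
    have hlt : ∀ a c : Fin m, σ a.succ = c.succ → b a < b c := by
      intro a c e
      have hc := hbs c
      cases hn : b c with
      | zero =>
        rw [hn] at hc
        exact absurd hc (Fin.succ_ne_zero c).symm
      | succ n =>
        rw [hn, Function.iterate_succ_apply', ← e] at hc
        exact Nat.lt_succ_of_le (Nat.find_min' (hex a) (σ.injective hc))
    have htri : ((1 - σ.permMatrix ℚ).submatrix Fin.succ Fin.succ).BlockTriangular b := by
      intro a c hac
      rw [submatrix_apply, entry, if_neg, if_neg, sub_zero]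
      · exact fun e => absurd (hlt a c e) hac.not_gt
      · exact fun e => hac.ne (by rw [Fin.succ_injective _ e])
    rw [htri.det]
    refine Finset.prod_eq_one fun n hn => ?_
    obtain ⟨a, -, rfl⟩ := Finset.mem_image.1 hn
    have : Subsingleton {x // b x = b a} := ⟨fun x y => Subtype.ext (hbinj (x.2.trans y.2.symm))⟩
    rw [Matrix.det_eq_elem_of_subsingleton _ ⟨a, rfl⟩]
    change (1 - σ.permMatrix ℚ) a.succ a.succ = 1
    rw [entry, if_pos rfl, if_neg, sub_zero]
    exact fun e => lt_irrefl _ (hlt a a e)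
  · rw [indicator01_false h, reducedDet, ← Matrix.exists_mulVec_eq_zero_iff]
    -- The indicator of the complement of the orbit of `0` is invariant under `σ`, so it is
    -- annihilated by `1 - σ`. It vanishes at `0` and therefore restricts to a kernel vector of the
    -- minor.
    set v : Fin (m + 1) → ℚ := fun p => if ∃ n, σ^[n] 0 = p then 0 else 1 with hv
    have hv0 : v 0 = 0 := if_pos ⟨0, rfl⟩
    have hvσ : ∀ p, v (σ p) = v p := by
      intro p
      have : (∃ n, σ^[n] 0 = σ p) ↔ ∃ n, σ^[n] 0 = p := by
        constructor
        · rintro ⟨n, hn⟩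
          obtain ⟨k, hk⟩ := exists_iterate_succ_eq σ.injective p
          refine ⟨k + n, ?_⟩
          rw [Function.iterate_add_apply, hn, ← Function.iterate_succ_apply, hk]
        · rintro ⟨n, rfl⟩
          exact ⟨n + 1, Function.iterate_succ_apply' _ _ _⟩
      simp only [hv, this]
    refine ⟨fun a => v a.succ, ?_, ?_⟩
    · intro hzero
      refine h (.of_iterate 0 fun p => ?_)
      by_contra hp
      have hp1 : v p = 1 := if_neg hp
      have hp0 : v p = 0 := by
        refine Fin.cases hv0 (fun a => ?_) p
        exact congrFun hzero a
      rw [hp0] at hp1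
      exact zero_ne_one hp1
    · funext a
      have hsum : ∑ q, (1 - σ.permMatrix ℚ) a.succ q * v q = 0 := by
        simp only [entry, sub_mul, Finset.sum_sub_distrib, ite_mul, one_mul, zero_mul,
          Finset.sum_ite_eq, Finset.mem_univ, if_true, hvσ, sub_self]
      rw [Fin.sum_univ_succ, hv0, mul_zero, zero_add] at hsum
      exact hsum

end Determinants

/-! ### The skein relation for Burau matrices -/

section Skein

open Matrix

theorem burau_true_apply {m : ℕ} (i : Fin m) (j k : Fin (m + 1)) : burau i true j k =
    if j = i.castSucc then
      if k = i.castSucc then 1 - LaurentPolynomial.T 1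
      else if k = i.succ then LaurentPolynomial.T 1 else 0
    else if j = i.succ then (if k = i.castSucc then 1 else 0)
    else if j = k then 1 else 0 := rfl

theorem burau_false_apply {m : ℕ} (i : Fin m) (j k : Fin (m + 1)) : burau i false j k =
    if j = i.castSucc then (if k = i.succ then 1 else 0)
    else if j = i.succ then
      if k = i.castSucc then LaurentPolynomial.T (-1)
      else if k = i.succ then 1 - LaurentPolynomial.T (-1) else 0
    else if j = k then 1 else 0 := rfl

theorem burau_false_eq {m : ℕ} (i : Fin m) : burau i false = 1 -
    (Matrix.of fun j (_ : Unit) => if j = i.castSucc then (1 : ℤ[T;T⁻¹]) else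
      if j = i.succ then -LaurentPolynomial.T (-1) else 0) *
    (Matrix.of fun (_ : Unit) k => if k = i.castSucc then (1 : ℤ[T;T⁻¹]) else
      if k = i.succ then -1 else 0) := by
  have hne : i.castSucc ≠ i.succ := Fin.castSucc_lt_succ.ne
  ext1 j k
  simp only [burau_false_apply, Matrix.sub_apply, Matrix.one_apply, Matrix.mul_apply, Matrix.of_apply,
    Finset.univ_unique, Finset.sum_singleton]
  by_cases hj : j = i.castSucc
  · subst hj
    by_cases hk : k = i.castSucc
    · subst hk
      simp [hne]
    · by_cases hk' : k = i.succ
      · subst hk'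
        simp [hne, hne.symm]
      · simp [hk, hk', Ne.symm hk]
  · by_cases hj' : j = i.succ
    · subst hj'
      by_cases hk : k = i.castSucc
      · subst hk
        simp [hne.symm]
      · by_cases hk' : k = i.succ
        · subst hk'
          simp [hne.symm]
        · simp [hk, hk', Ne.symm hk', hne.symm]
    · simp [hj, hj']

/-- The generator, its inverse and the identity lie on one line `1 - s (1 - burau i false)`, at `s =
t`, `1` and `0`, in a direction of rank one. As the minor is affine along this line, its three
values satisfy the skein relation. -/
theorem burau_true_eq {m : ℕ} (i : Fin m) : burau i true = 1 -
    (LaurentPolynomial.T 1 : ℤ[T;T⁻¹]) • (1 - burau i false) := by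
  have hne : i.castSucc ≠ i.succ := Fin.castSucc_lt_succ.ne
  have hT : (LaurentPolynomial.T 1 : ℤ[T;T⁻¹]) * LaurentPolynomial.T (-1) = 1 := by
    rw [← LaurentPolynomial.T_add]
    simp
  ext1 j k
  simp only [burau_true_apply, burau_false_apply, Matrix.sub_apply, Matrix.one_apply,
    Matrix.smul_apply, smul_eq_mul]
  by_cases hj : j = i.castSucc
  · subst hj
    by_cases hk : k = i.castSucc
    · subst hk
      simp [hne]
    · by_cases hk' : k = i.succ
      · subst hk'
        simp [hne, hne.symm]
      · simp [hk, hk', Ne.symm hk]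
  · by_cases hj' : j = i.succ
    · subst hj'
      by_cases hk : k = i.castSucc
      · subst hk
        simp [hne.symm, hT]
      · by_cases hk' : k = i.succ
        · subst hk'
          simp [hne.symm, hT]
        · simp [hk, hk', Ne.symm hk', hne.symm]
    · simp [hj, hj']

/-- The skein relation of the Alexander polynomial. -/
theorem reducedDet_skein {m : ℕ} (i : Fin m) (A C : Matrix (Fin (m + 1)) (Fin (m + 1)) ℤ[T;T⁻¹]) :
    reducedDet (A * burau i true * C) -
      LaurentPolynomial.T 1 * reducedDet (A * burau i false * C) =
      (1 - LaurentPolynomial.T 1) * reducedDet (A * C) := by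
  rw [burau_true_eq, burau_false_eq, sub_sub_cancel, reducedDet_affine]
  ring

end Skein

/-! ### Smoothing the double points, and the leading coefficient -/

namespace SingularBraid

variable {m : ℕ}

/-- The braid word in which all double points are smoothed. -/
def smoothing : SingularBraid m → List (Fin m × Bool)
  | [] => []
  | (i, .positive) :: w => (i, true) :: smoothing w
  | (i, .negative) :: w => (i, false) :: smoothing w
  | (_, .singular) :: w => smoothing w

/-- The permutation of the braid in which all double points are smoothed. -/
def smoothPerm : SingularBraid m → Equiv.Perm (Fin (m + 1))
  | [] => 1
  | (_, .singular) :: w => smoothPerm w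
  | (i, .positive) :: w => smoothPerm w * Equiv.swap i.castSucc i.succ
  | (i, .negative) :: w => smoothPerm w * Equiv.swap i.castSucc i.succ

/-- The sum over the resolutions, with one more factor and another normalisation. -/
noncomputable def resolutionSum (w : SingularBraid m) (c : ℤ)
    (A : Matrix (Fin (m + 1)) (Fin (m + 1)) ℤ[T;T⁻¹]) : ℤ[T;T⁻¹] :=
  ((resolutions w).map fun r => r.1 • (LaurentPolynomial.T ((c - writhe r.2) / 2) *
    reducedDet (A * (r.2.map fun c => burau c.1 c.2).prod))).sum

theorem alexander_eq_resolutionSum (w : SingularBraid m) :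
    w.alexander = w.resolutionSum m 1 := by
  simp only [alexander, resolutionSum, _root_.alexander, reducedDet, one_mul]

theorem writhe_cons (i : Fin m) (b : Bool) (r : List (Fin m × Bool)) :
    writhe ((i, b) :: r) = (if b then 1 else -1) + writhe r := by
  simp [writhe]

/-- The skein relation is applied to one double point at a time: each is smoothed at the cost of a
factor `1 - t`. The induction moves the letters already read into the matrix `A` and their writhe
into `c`, so both must be arbitrary; the exponent `e` does not depend on `A`. -/
theorem resolutionSum_eq (w : SingularBraid m) (c : ℤ) :
    ∃ e : ℤ, ∀ A : Matrix (Fin (m + 1)) (Fin (m + 1)) ℤ[T;T⁻¹], w.resolutionSum c A =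
      LaurentPolynomial.T e * (1 - LaurentPolynomial.T 1) ^ w.numSingular *
        reducedDet (A * (w.smoothing.map fun c => burau c.1 c.2).prod) := by
  induction w generalizing c with
  | nil =>
    refine ⟨(c - writhe ([] : List (Fin m × Bool))) / 2, fun A => ?_⟩
    simp [resolutionSum, resolutions, numSingular, smoothing]
  | cons x w ih =>
    obtain ⟨i, k⟩ := x
    have cons_eq : ∀ (b : Bool) A, ((resolutions w).map fun r => r.1 •
        (LaurentPolynomial.T ((c - writhe ((i, b) :: r.2)) / 2) *
          reducedDet (A * (((i, b) :: r.2).map fun c => burau c.1 c.2).prod))).sum =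
        resolutionSum w (c - if b then 1 else -1) (A * burau i b) := by
      intro b A
      simp only [resolutionSum, writhe_cons, List.map_cons, List.prod_cons, mul_assoc, sub_sub]
    cases k with
    | positive =>
      obtain ⟨e, he⟩ := ih (c - 1)
      refine ⟨e, fun A => ?_⟩
      have := cons_eq true A
      simp only [if_true] at this
      rw [resolutionSum, resolutions, List.map_map]
      simp only [Function.comp_def]
      rw [this, he]
      simp only [numSingular, smoothing, List.map_cons, List.prod_cons, mul_assoc]
    | negative =>
      obtain ⟨e, he⟩ := ih (c - -1)
      refine ⟨e, fun A => ?_⟩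
      have := cons_eq false A
      simp only [Bool.false_eq_true, if_false] at this
      rw [resolutionSum, resolutions, List.map_map]
      simp only [Function.comp_def]
      rw [this, he]
      simp only [numSingular, smoothing, List.map_cons, List.prod_cons, mul_assoc]
    | singular =>
      obtain ⟨e, he⟩ := ih (c - 1)
      refine ⟨e, fun A => ?_⟩
      have hneg : ∀ A, resolutionSum w (c - -1) A =
          LaurentPolynomial.T 1 * resolutionSum w (c - 1) A := by
        intro A
        rw [resolutionSum, resolutionSum, ← List.sum_map_mul_left]
        congr 1
        refine List.map_congr_left fun r _ => ?_
        -- Changing the crossing shifts the writhe by 2, so the rounded quotient shifts by exactly 1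
        -- whatever the parity. This is the factor `t` that the skein relation requires.
        have : (c - -1 - writhe r.2) / 2 = 1 + (c - 1 - writhe r.2) / 2 := by omega
        rw [this, LaurentPolynomial.T_add, mul_smul_comm]
        simp only [mul_assoc]
      have h1 := cons_eq true A
      have h2 := cons_eq false A
      simp only [if_true] at h1
      simp only [Bool.false_eq_true, if_false] at h2
      have hneg_sum : ((resolutions w).map fun r => (-r.1) •
        (LaurentPolynomial.T ((c - writhe ((i, false) :: r.2)) / 2) *
          reducedDet (A * (((i, false) :: r.2).map fun c => burau c.1 c.2).prod))).sum =
          -resolutionSum w (c - -1) (A * burau i false) := by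
        rw [← h2, ← neg_one_mul, ← List.sum_map_mul_left]
        simp only [neg_smul, neg_one_mul]
      rw [resolutionSum, resolutions, List.map_append, List.sum_append, List.map_map,
        List.map_map]
      simp only [Function.comp_def]
      rw [h1, hneg_sum, hneg, he, he]
      simp only [numSingular, smoothing]
      have := reducedDet_skein i A ((smoothing w).map fun c => burau c.1 c.2).prod
      linear_combination LaurentPolynomial.T e *
        (1 - LaurentPolynomial.T 1) ^ numSingular w * this

/-- The evaluation of Laurent polynomials at `t = e^z`. -/
noncomputable def evalExp : ℤ[T;T⁻¹] →+* ℚ⟦X⟧ :=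
  LaurentPolynomial.eval₂ (Int.castRingHom ℚ⟦X⟧) (PowerSeries.isUnit_exp ℚ).unit

theorem constantCoeff_evalExp_T (n : ℤ) :
    PowerSeries.constantCoeff (evalExp (LaurentPolynomial.T n)) = 1 := by
  have hu : Units.map (PowerSeries.constantCoeff (R := ℚ) : ℚ⟦X⟧ →* ℚ)
      (PowerSeries.isUnit_exp ℚ).unit = 1 := by
    ext
    simp
  rw [evalExp, LaurentPolynomial.eval₂_T]
  have := congrArg (fun u : ℚˣ => ((u ^ n : ℚˣ) : ℚ)) hu
  simpa [← map_zpow] using this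

theorem evalExp_one_sub_T : ∃ g : ℚ⟦X⟧, evalExp (1 - LaurentPolynomial.T 1) = PowerSeries.X * g ∧
    PowerSeries.constantCoeff g = -1 := by
  have h0 : PowerSeries.constantCoeff (evalExp (1 - LaurentPolynomial.T 1)) = 0 := by
    rw [map_sub, map_sub, constantCoeff_evalExp_T]
    simp
  obtain ⟨g, hg⟩ := PowerSeries.X_dvd_iff.2 h0
  refine ⟨g, hg, ?_⟩
  have h1 : PowerSeries.coeff 1 (evalExp (1 - LaurentPolynomial.T 1)) = -1 := by
    rw [map_sub, map_sub, evalExp, LaurentPolynomial.eval₂_T]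
    simp [PowerSeries.coeff_one, PowerSeries.coeff_exp]
  rwa [hg, ← zero_add 1, PowerSeries.coeff_succ_X_mul,
    PowerSeries.coeff_zero_eq_constantCoeff] at h1

/-- At `z = 0`, that is `t = 1`, a crossing of either sign becomes a transposition of the strands,
so the constant term of the minor sees only the permutation of the smoothed braid. -/
theorem map_burau (i : Fin m) (b : Bool) :
    ((PowerSeries.constantCoeff (R := ℚ)).comp evalExp).mapMatrix (burau i b) =
      (Equiv.swap i.castSucc i.succ).permMatrix ℚ := by
  have hne : i.castSucc ≠ i.succ := Fin.castSucc_lt_succ.ne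
  have hT := constantCoeff_evalExp_T
  ext j k
  rw [RingHom.mapMatrix_apply, Matrix.map_apply, permMatrix_entry]
  rw [RingHom.comp_apply]
  by_cases hj : j = i.castSucc
  · subst hj
    rw [Equiv.swap_apply_left]
    by_cases hk : k = i.castSucc
    · subst hk
      cases b <;> simp [burau_true_apply, burau_false_apply, hne, hne.symm, hT]
    · by_cases hk' : k = i.succ
      · subst hk'
        cases b <;> simp [burau_true_apply, burau_false_apply, hne.symm, hT]
      · cases b <;> simp [burau_true_apply, burau_false_apply, hk, hk', Ne.symm hk']
  · by_cases hj' : j = i.succ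
    · subst hj'
      rw [Equiv.swap_apply_right]
      by_cases hk : k = i.castSucc
      · subst hk
        cases b <;> simp [burau_true_apply, burau_false_apply, hne.symm, hT]
      · by_cases hk' : k = i.succ
        · subst hk'
          cases b <;> simp [burau_true_apply, burau_false_apply, hne, hne.symm, hT]
        · cases b <;>
            simp [burau_true_apply, burau_false_apply, hk, hk', Ne.symm hk, hne.symm]
    · rw [Equiv.swap_apply_of_ne_of_ne hj hj']
      by_cases hjk : j = k <;> cases b <;>
        simp [burau_true_apply, burau_false_apply, hj, hj', hjk]
      all_goals
        subst hjk
        simp [hj, hj']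

theorem map_burau_smoothing (w : SingularBraid m) :
    ((PowerSeries.constantCoeff (R := ℚ)).comp evalExp).mapMatrix
      (w.smoothing.map fun c => burau c.1 c.2).prod = w.smoothPerm.permMatrix ℚ := by
  induction w with
  | nil => simp [smoothing, smoothPerm]
  | cons x w ih =>
    obtain ⟨i, k⟩ := x
    cases k
    · rw [smoothing, smoothPerm, List.map_cons, List.prod_cons, map_mul, ih, map_burau,
        Matrix.permMatrix_mul]
    · rw [smoothing, smoothPerm, List.map_cons, List.prod_cons, map_mul, ih, map_burau,
        Matrix.permMatrix_mul]
    · rw [smoothing, smoothPerm, ih]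

theorem sign_of_singleOrbit (σ : Equiv.Perm (Fin (m + 1))) (h : SingleOrbit σ) :
    Equiv.Perm.sign σ = (-1) ^ m := by
  have hex := fun x y => h.exists_iterate σ.injective x y
  cases m with
  | zero =>
    have : σ = 1 := Equiv.ext fun x => by
      rw [Fin.eq_zero (σ x), Fin.eq_zero x]; rfl
    simp [this]
  | succ m =>
    have hfix : ∀ x, σ x ≠ x := by
      intro x hx
      obtain ⟨y, hy⟩ := exists_ne x
      obtain ⟨n, hn⟩ := hex x y
      rw [Function.iterate_fixed hx] at hn
      exact hy hn.symm
    have hc : σ.IsCycle := by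
      refine ⟨0, hfix 0, fun y _ => ?_⟩
      obtain ⟨n, hn⟩ := hex 0 y
      refine ⟨n, ?_⟩
      rw [zpow_natCast, Equiv.Perm.coe_pow, hn]
    have hs : σ.support = Finset.univ := by
      ext x
      simp [hfix]
    rw [hc.sign, hs, Finset.card_univ, Fintype.card_fin, pow_succ]
    simp

theorem sign_smoothPerm (w : SingularBraid m) :
    Equiv.Perm.sign (endpoint w) = Equiv.Perm.sign w.smoothPerm * (-1) ^ w.numSingular := by
  induction w with
  | nil => simp [endpoint, smoothPerm, numSingular]
  | cons x w ih =>
    obtain ⟨i, k⟩ := x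
    have hne : i.castSucc ≠ i.succ := Fin.castSucc_lt_succ.ne
    cases k <;> simp [endpoint, smoothPerm, numSingular, ih, Equiv.Perm.sign_swap hne, pow_succ]

theorem singleOrbit_endpoint {w : SingularBraid m} (hw : w.ClosesToKnot) :
    SingleOrbit (endpoint w) := by
  refine .of_iterate 0 fun y => ?_
  obtain ⟨k, hk⟩ := hw 0 y
  exact ⟨k, by rw [← Equiv.Perm.coe_pow, hk]⟩

/-- The symbol of the Alexander-Conway series: all double points are smoothed. -/
theorem coeff_alexanderSeries {w : SingularBraid m} (hw : w.ClosesToKnot) :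
    PowerSeries.coeff w.numSingular w.alexanderSeries =
      indicator01 (SingleOrbit w.smoothPerm) := by
  obtain ⟨e, he⟩ := w.resolutionSum_eq m
  obtain ⟨g, hg, hg1⟩ := evalExp_one_sub_T
  have h1 : w.alexanderSeries = evalExp w.alexander := rfl
  have hred : PowerSeries.constantCoeff (evalExp (reducedDet
      (w.smoothing.map fun c => burau c.1 c.2).prod)) = indicator01 (SingleOrbit w.smoothPerm) := by
    rw [← RingHom.comp_apply, reducedDet_map, map_burau_smoothing, reducedDet_permMatrix]
  rw [h1, alexander_eq_resolutionSum, he, one_mul, evalExp.map_mul, evalExp.map_mul,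
    evalExp.map_pow, hg, mul_pow, mul_left_comm, mul_assoc]
  have h2 := PowerSeries.coeff_X_pow_mul (evalExp (LaurentPolynomial.T e) *
    (g ^ w.numSingular * evalExp (reducedDet
      (w.smoothing.map fun c => burau c.1 c.2).prod))) w.numSingular 0
  rw [zero_add] at h2
  simp only [mul_assoc] at h2 ⊢
  rw [h2]
  rw [PowerSeries.coeff_zero_eq_constantCoeff, map_mul, map_mul, map_pow,
    constantCoeff_evalExp_T, hg1, hred, one_mul]
  -- The sign `(-1) ^ n` comes from `1 - e^z = -z + ...`. If the smoothing is a knot, its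
  -- permutation and that of `w` are both cycles through all strands and have equal signs. Smoothing
  -- omits one transposition per double point, so `n` is even.
  by_cases h : SingleOrbit w.smoothPerm
  · have hs := sign_smoothPerm w
    rw [sign_of_singleOrbit _ (singleOrbit_endpoint hw), sign_of_singleOrbit _ h] at hs
    have hone : ((-1 : ℤˣ)) ^ w.numSingular = 1 := by
      have := hs.symm
      rwa [mul_eq_left] at this
    have hone' : ((-1 : ℚ)) ^ w.numSingular = 1 := by
      have := congrArg (fun u : ℤˣ => ((u : ℤ) : ℚ)) hone
      simpa using this
    rw [hone', one_mul]
  · rw [indicator01_false h, mul_zero]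

end SingularBraid

/-! ### Strands of a braid in space-time -/

section SpaceTime

theorem FirstExit.of_iterate {X : Type*} {f : X → X} {Z : Set X} (n : ℕ) :
    ∀ x, (∀ j < n, f^[j] x ∈ Z) → f^[n] x ∉ Z → FirstExit f Z x (f^[n] x) := by
  induction n with
  | zero => exact fun x _ h => .here h
  | succ n ih =>
    intro x h h'
    exact .step (h 0 n.succ_pos) (ih (f x) (fun j hj => h (j + 1) (by omega)) h')

theorem FirstExit.congr {X : Type*} {f g : X → X} {Z : Set X} {x y : X}
    (h : FirstExit f Z x y) (hfg : ∀ x ∈ Z, f x = g x) : FirstExit g Z x y := by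
  induction h with
  | here hx => exact .here hx
  | step hx _ ih => exact .step hx (by rwa [← hfg _ hx])

theorem minimalPeriod_of_singleOrbit {X : Type*} [Fintype X] {f : X → X} (h : SingleOrbit f)
    (hf : Function.Injective f) (x : X) : Function.minimalPeriod f x = Fintype.card X := by
  refine le_antisymm Function.minimalPeriod_le_card ?_
  have hpos := Function.minimalPeriod_pos_of_mem_periodicPts (hf.mem_periodicPts x)
  have hs : Function.Surjective fun k : Fin (Function.minimalPeriod f x) => f^[(k : ℕ)] x := by
    intro y
    obtain ⟨n, hn⟩ := h.exists_iterate hf x y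
    exact ⟨⟨n % Function.minimalPeriod f x, Nat.mod_lt _ hpos⟩,
      (Function.iterate_mod_minimalPeriod_eq).trans hn⟩
  simpa using Fintype.card_le_of_surjective _ hs

variable {P : Type*}

/-- One step along the strands, which are permuted by `s j` at the time `j`. The time is
periodic. -/
def spaceTime (N : ℕ) (s : ℕ → Equiv.Perm P) (x : Fin (N + 1) × P) : Fin (N + 1) × P :=
  (x.1 + 1, s x.1 x.2)

/-- The position at the time `j` of the strand that starts in `p`. -/
def position (s : ℕ → Equiv.Perm P) : ℕ → P → P
  | 0, p => p
  | j + 1, p => s j (position s j p)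

theorem position_succ' (s : ℕ → Equiv.Perm P) (j : ℕ) (p : P) :
    position s (j + 1) p = position (fun j => s (j + 1)) j (s 0 p) := by
  induction j with
  | zero => rfl
  | succ j ih => rw [position, ih, position]

theorem spaceTime_injective (N : ℕ) (s : ℕ → Equiv.Perm P) :
    Function.Injective (spaceTime N s) := by
  rintro ⟨j, p⟩ ⟨j', p'⟩ h
  simp only [spaceTime, Prod.mk.injEq, add_left_inj] at h
  obtain ⟨rfl, h⟩ := h
  simpa using h

theorem iterate_spaceTime_fst (N : ℕ) (s : ℕ → Equiv.Perm P) (k : ℕ) (x : Fin (N + 1) × P) :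
    (((spaceTime N s)^[k] x).1 : ℕ) = (x.1 + k) % (N + 1) := by
  induction k with
  | zero => simp [Nat.mod_eq_of_lt x.1.2]
  | succ k ih =>
    rw [Function.iterate_succ_apply', spaceTime, Fin.val_add, ih, ← Nat.add_assoc, Nat.add_mod,
      Nat.mod_mod, Fin.val_one', Nat.mod_mod, ← Nat.add_mod]

theorem iterate_spaceTime_snd {N : ℕ} (s : ℕ → Equiv.Perm P) {j : ℕ} (hj : j ≤ N + 1) (p : P) :
    ((spaceTime N s)^[j] (0, p)).2 = position s j p := by
  induction j with
  | zero => rfl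
  | succ j ih =>
    rw [Function.iterate_succ_apply', spaceTime, position, ih (by omega), iterate_spaceTime_fst,
      Fin.val_zero, zero_add, Nat.mod_eq_of_lt (by omega)]

theorem iterate_spaceTime_period (N : ℕ) (s : ℕ → Equiv.Perm P) (p : P) :
    (spaceTime N s)^[N + 1] (0, p) = (0, position s (N + 1) p) := by
  refine Prod.ext (Fin.ext ?_) (iterate_spaceTime_snd s le_rfl p)
  rw [iterate_spaceTime_fst]
  simp

/-- Every strand passes the time 0 once per period, and the first return map there is the
permutation of the braid. In space-time the closed braid becomes the orbit of one map whose points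
include the individual passages through double points. -/
theorem singleOrbit_spaceTime (N : ℕ) (s : ℕ → Equiv.Perm P) :
    SingleOrbit (spaceTime N s) ↔ SingleOrbit (position s (N + 1)) := by
  refine singleOrbit_iff_of_return (Z := {x | x.1 ≠ 0}) (fun p => ((0 : Fin (N + 1)), p))
    (fun p q h => (Prod.mk.inj h).2) ?_ ?_ ?_
  · rintro ⟨j, p⟩
    simp [eq_comm]
  · intro p
    have h := FirstExit.of_iterate (f := spaceTime N s) (Z := {x | x.1 ≠ 0}) N
      (spaceTime N s (0, p)) ?_ ?_
    · rwa [← Function.iterate_succ_apply, iterate_spaceTime_period] at h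
    · intro j hj
      rw [← Function.iterate_succ_apply]
      intro e
      have := congrArg Fin.val e
      rw [iterate_spaceTime_fst, Fin.val_zero, zero_add, Nat.mod_eq_of_lt (by omega)] at this
      omega
    · rw [← Function.iterate_succ_apply, iterate_spaceTime_period]
      simp
  · rintro ⟨j, p⟩ -
    refine FirstExit.exists_of_iterate (N + 1 - j) _ fun h => h (Fin.ext ?_)
    rw [iterate_spaceTime_fst]
    simp [Nat.add_sub_cancel' j.2.le]

end SpaceTime

/-! ### Listing the visits of a periodic orbit -/

section FirstReturnList

variable {X : Type*} {f : X → X} {A : X → Prop} [DecidablePred A]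

/-- Between two consecutive listed points with the property `A`, the orbit only meets points without
it. -/
theorem isChain_filter_firstExit {l : List X} (h : l.IsChain fun x y => y = f x) :
    (l.filter A).IsChain fun x y => FirstExit f {x | ¬ A x} (f x) y := by
  have aux : ∀ (l : List X) (x : X), (x :: l).IsChain (fun x y => y = f x) →
      ∀ y ∈ (l.filter A).head?, FirstExit f {x | ¬ A x} (f x) y := by
    intro l
    induction l with
    | nil => simp
    | cons z l ih =>
      intro x hx y hy
      rw [List.isChain_cons_cons] at hx
      obtain ⟨rfl, hx⟩ := hx
      by_cases hz : A (f x)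
      · rw [List.filter_cons_of_pos (by simpa using hz)] at hy
        simp only [List.head?_cons, Option.mem_def, Option.some.injEq] at hy
        subst hy
        exact .here (by simpa using hz)
      · rw [List.filter_cons_of_neg (by simpa using hz)] at hy
        exact .step hz (ih _ hx y hy)
  induction l with
  | nil => simp
  | cons x l ih =>
    by_cases hx : A x
    · rw [List.filter_cons_of_pos (by simpa using hx), List.isChain_cons]
      exact ⟨aux l x h, ih h.tail⟩
    · rw [List.filter_cons_of_neg (by simpa using hx)]
      exact ih h.tail

/-- The points of a periodic orbit with a property, in order. -/
def visits (f : X → X) (A : X → Prop) [DecidablePred A] (N : ℕ) (x : X) : List X :=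
  ((List.range N).map fun n => f^[n] x).filter A

theorem firstExit_visits {N : ℕ} {x : X} (hN : f^[N] x = x) {r : ℕ}
    (hr : r < (visits f A N x).length) :
    FirstExit f {x | ¬ A x} (f (visits f A N x)[r])
      ((visits f A N x)[(r + 1) % (visits f A N x).length]'(Nat.mod_lt _ (by omega))) := by
  -- The orbit is followed for two periods, so that the last visit has a successor in the list,
  -- namely the first visit of the second period.
  have hchain : ((List.range (N + N)).map fun n => f^[n] x).IsChain fun x y => y = f x := by
    rw [List.isChain_map]
    refine (List.isChain_range _ _).2 fun n _ => ?_
    exact Function.iterate_succ_apply' _ _ _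
  have hdouble : ((List.range (N + N)).map fun n => f^[n] x).filter A =
      visits f A N x ++ visits f A N x := by
    rw [List.range_add, List.map_append, List.filter_append, List.map_map]
    have : ((fun n => f^[n] x) ∘ fun n => N + n) = fun n => f^[n] x := by
      funext n
      rw [Function.comp_apply, add_comm, Function.iterate_add_apply, hN]
    rw [this]
    rfl
  have h := isChain_filter_firstExit (A := A) hchain
  rw [hdouble, List.isChain_iff_getElem] at h
  have h' := h r (by rw [List.length_append]; omega)
  rw [List.getElem_append_left hr] at h'
  by_cases hr' : r + 1 < (visits f A N x).length
  · simp only [Nat.mod_eq_of_lt hr']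
    rwa [List.getElem_append_left hr'] at h'
  · have e : r + 1 = (visits f A N x).length := by omega
    rw [List.getElem_append_right (by omega)] at h'
    simpa [e] using h'

end FirstReturnList

/-! ### The symbol of the Alexander-Conway series on chord diagrams -/

theorem mem_visits {X : Type*} {f : X → X} {A : X → Prop} [DecidablePred A] [Fintype X]
    (h : SingleOrbit f) (hf : Function.Injective f) (x y : X) :
    y ∈ visits f A (Fintype.card X) x ↔ A y := by
  rw [visits, List.mem_filter, decide_eq_true_iff, and_iff_right_iff_imp]
  rintro -
  obtain ⟨n, rfl⟩ := h.exists_iterate hf x y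
  rw [← minimalPeriod_of_singleOrbit h hf x, List.mem_map]
  refine ⟨n % Function.minimalPeriod f x, ?_, Function.iterate_mod_minimalPeriod_eq⟩
  exact List.mem_range.2 (Nat.mod_lt _
    (Function.minimalPeriod_pos_of_mem_periodicPts (hf.mem_periodicPts x)))

theorem nodup_visits {X : Type*} {f : X → X} {A : X → Prop} [DecidablePred A] [Fintype X]
    (h : SingleOrbit f) (hf : Function.Injective f) (x : X) :
    (visits f A (Fintype.card X) x).Nodup := by
  refine List.Nodup.filter _ (List.Nodup.map_on ?_ List.nodup_range)
  intro a ha b hb e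
  rw [List.mem_range, ← minimalPeriod_of_singleOrbit h hf x] at ha hb
  exact Function.iterate_injOn_Iio_minimalPeriod ha hb e

namespace SingularBraid

variable {m : ℕ}

/-- The permutation of the positions at the letter `j`. -/
def crossing (w : SingularBraid m) (j : ℕ) : Equiv.Perm (Fin (m + 1)) :=
  w[j]?.elim 1 fun c => Equiv.swap c.1.castSucc c.1.succ

/-- The permutation of the positions at the letter `j` when the double points are smoothed. -/
def smoothedCrossing (w : SingularBraid m) (j : ℕ) : Equiv.Perm (Fin (m + 1)) :=
  w[j]?.elim 1 fun c => match c.2 with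
    | .singular => 1
    | _ => Equiv.swap c.1.castSucc c.1.succ

/-- The strand in the position `p` passes through a double point at the letter `j`. -/
def Passes (w : SingularBraid m) (j : ℕ) (p : Fin (m + 1)) : Prop :=
  ∃ i, w[j]? = some (i, .singular) ∧ (p = i.castSucc ∨ p = i.succ)

theorem smoothedCrossing_of_passes {w : SingularBraid m} {j : ℕ} {p : Fin (m + 1)}
    (h : w.Passes j p) : w.smoothedCrossing j p = p := by
  obtain ⟨i, hi, -⟩ := h
  rw [smoothedCrossing, hi]
  rfl

theorem smoothedCrossing_of_not_passes {w : SingularBraid m} {j : ℕ} {p : Fin (m + 1)}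
    (h : ¬ w.Passes j p) : w.smoothedCrossing j p = w.crossing j p := by
  rw [smoothedCrossing, crossing]
  cases hc : w[j]? with
  | none => rfl
  | some c =>
    obtain ⟨i, k⟩ := c
    cases k with
    | positive => rfl
    | negative => rfl
    | singular =>
      have h' : p ≠ i.castSucc ∧ p ≠ i.succ := by
        constructor
        · exact fun e => h ⟨i, hc, .inl e⟩
        · exact fun e => h ⟨i, hc, .inr e⟩
      exact (Equiv.swap_apply_of_ne_of_ne h'.1 h'.2).symm

theorem crossing_of_passes {w : SingularBraid m} {j : ℕ} {p q : Fin (m + 1)}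
    (hp : w.Passes j p) (hq : w.Passes j q) (h : p ≠ q) : w.crossing j p = q := by
  obtain ⟨i, hi, hp⟩ := hp
  obtain ⟨i', hi', hq⟩ := hq
  obtain rfl : i = i' := by simpa [hi] using hi'
  rw [crossing, hi]
  rcases hp with rfl | rfl <;> rcases hq with rfl | rfl
  · exact absurd rfl h
  · exact Equiv.swap_apply_left _ _
  · exact Equiv.swap_apply_right _ _
  · exact absurd rfl h

theorem position_crossing (w : SingularBraid m) :
    position w.crossing w.length = endpoint w := by
  induction w with
  | nil => rfl
  | cons c w ih =>
    funext p
    rw [List.length_cons, position_succ', endpoint, Equiv.Perm.mul_apply, ← ih]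
    rfl

theorem position_smoothedCrossing (w : SingularBraid m) :
    position w.smoothedCrossing w.length = w.smoothPerm := by
  induction w with
  | nil => rfl
  | cons c w ih =>
    obtain ⟨i, k⟩ := c
    funext p
    rw [List.length_cons, position_succ']
    cases k <;> rw [smoothPerm] <;> try rw [Equiv.Perm.mul_apply]
    all_goals
      rw [← ih]
      rfl

open Classical in
theorem encounters_eq (w : SingularBraid m) (k : ℕ) (p : Fin (m + 1)) :
    encounters w k p = ((List.range w.length).filter fun j =>
      w.Passes j (position w.crossing j p)).map (k + ·) := by
  induction w generalizing k p with
  | nil => rfl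
  | cons c w ih =>
    obtain ⟨i, kind⟩ := c
    have hsucc : ((List.map Nat.succ (List.range w.length)).filter fun j =>
        Passes ((i, kind) :: w) j (position (crossing ((i, kind) :: w)) j p)).map (k + ·) =
        encounters w (k + 1) (Equiv.swap i.castSucc i.succ p) := by
      rw [ih, List.filter_map, List.map_map]
      have h1 : ((k + ·) ∘ Nat.succ) = (k + 1 + ·) := by
        funext n
        simp only [Function.comp_apply]
        omega
      rw [h1]
      congr 1
      refine List.filter_congr fun n _ => ?_
      simp only [Function.comp_apply, Nat.succ_eq_add_one]
      rw [position_succ']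
      rfl
    rw [List.length_cons, List.range_succ_eq_map, List.filter_cons]
    have h0 : Passes ((i, kind) :: w) 0 (position (crossing ((i, kind) :: w)) 0 p) ↔
        kind = .singular ∧ (p = i.castSucc ∨ p = i.succ) := by
      rw [position, Passes]
      simp only [List.getElem?_cons_zero, Option.some.injEq, Prod.mk.injEq]
      constructor
      · rintro ⟨i, ⟨rfl, h⟩, h'⟩
        exact ⟨h, h'⟩
      · exact fun h => ⟨i, ⟨rfl, h.1⟩, h.2⟩
    cases kind with
    | positive => simp [h0, encounters, hsucc]
    | negative => simp [h0, encounters, hsucc]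
    | singular =>
      rw [encounters]
      by_cases hp : p = i.castSucc ∨ p = i.succ
      · simp only [h0, hp, and_self, decide_true, if_true, List.map_cons, hsucc, add_zero]
      · simp only [h0, hp, and_false, decide_false, if_false, hsucc, Bool.false_eq_true]
        rw [not_or] at hp
        rw [Equiv.swap_apply_of_ne_of_ne hp.1 hp.2]

-- One period in space-time is one turn around the braid axis, after which the strand continues from
-- the position moved by `endpoint w`. The passages on the turn `r` are those listed by
-- `encounters`. With `m + 1` turns this is the Gauss word.
open Classical in
theorem map_visits_eq {w : SingularBraid m} {N : ℕ} (hN : w.length = N + 1) (r : ℕ) :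
    (visits (spaceTime N w.crossing) (fun x => w.Passes x.1 x.2) (r * (N + 1)) (0, 0)).map
      (fun x => (x.1 : ℕ)) =
      (List.range r).flatMap fun r => encounters w 0 ((endpoint w ^ r) 0) := by
  have hturn : ∀ r, (spaceTime N w.crossing)^[r * (N + 1)] (0, 0) = (0, (endpoint w ^ r) 0) := by
    have hend := position_crossing w
    rw [hN] at hend
    intro r
    induction r with
    | zero => simp
    | succ r ih =>
      rw [Nat.add_mul, one_mul, Nat.add_comm (r * (N + 1)), Function.iterate_add_apply, ih,
        iterate_spaceTime_period, hend, pow_succ', Equiv.Perm.mul_apply]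
  induction r with
  | zero => simp [visits]
  | succ r ih =>
    rw [List.range_succ, List.flatMap_append, ← ih, Nat.add_mul, one_mul, visits, List.range_add,
      List.map_append, List.filter_append, List.map_append]
    congr 1
    rw [List.flatMap_cons, List.flatMap_nil, List.append_nil, encounters_eq, List.map_map,
      List.filter_map, List.map_map, hN]
    have hit : ∀ n < N + 1, (spaceTime N w.crossing)^[r * (N + 1) + n] (0, 0) =
        (Fin.ofNat (N + 1) n, position w.crossing n ((endpoint w ^ r) 0)) := by
      intro n hn
      rw [add_comm (r * (N + 1)), Function.iterate_add_apply, hturn]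
      refine Prod.ext (Fin.ext ?_) (iterate_spaceTime_snd _ hn.le _)
      rw [iterate_spaceTime_fst]
      simp
    have hfilter : (List.range (N + 1)).filter ((fun x : Fin (N + 1) × Fin (m + 1) =>
          decide (w.Passes x.1 x.2)) ∘
          ((fun n => (spaceTime N w.crossing)^[n] (0, 0)) ∘ fun x => r * (N + 1) + x)) =
        (List.range (N + 1)).filter fun j =>
          w.Passes j (position w.crossing j ((endpoint w ^ r) 0)) := by
      refine List.filter_congr fun n hn => ?_
      rw [List.mem_range] at hn
      simp only [Function.comp_apply, decide_eq_decide]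
      rw [hit n hn]
      simp [Nat.mod_eq_of_lt hn]
    rw [hfilter]
    refine List.map_congr_left fun n hn => ?_
    have hn' := List.mem_range.1 (List.mem_of_mem_filter hn)
    simp only [Function.comp_apply]
    rw [hit n hn']
    simp [Nat.mod_eq_of_lt hn']

/-- The smoothing of all double points of a singular knot has one component if and only if the
ribbon graph of the chord diagram has one boundary component. -/
theorem singleOrbit_smoothPerm_iff {w : SingularBraid m} (hw : w.ClosesToKnot) {H : Type}
    {D : FeynmanDiagram H} (hD : w.HasChordDiagram D) :
    SingleOrbit w.smoothPerm ↔ SingleOrbit (D.tour ∅) := by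
  classical
  obtain ⟨hchord, f, hf, hff⟩ := hD
  obtain ⟨ys, hys⟩ := Quotient.exists_rep D.wilson
  replace hys : D.wilson = ↑ys := hys.symm
  have hrot : ys.map f ~r gaussWord w := by
    rw [hys, Cycle.map_coe, Cycle.coe_eq_coe] at hf
    exact hf
  obtain ⟨n, hn⟩ := hrot
  -- The Wilson cycle determines a list only up to rotation; the rotation is chosen so that the
  -- labels spell the Gauss word itself.
  rw [← List.map_rotate] at hn
  obtain ⟨xs, hxs⟩ : ∃ xs, xs = ys.rotate n := ⟨_, rfl⟩
  have hwil : D.wilson = ↑xs := by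
    rw [hys, hxs, Cycle.coe_eq_coe]
    exact ⟨n, rfl⟩
  rw [← hxs] at hn
  have hmem : ∀ h, h ∈ xs := by
    intro h
    have := (D.mem_wilson h).2 (hchord h)
    rwa [hwil, Cycle.mem_coe_iff] at this
  have hnodup : xs.Nodup := by
    have := D.nodup_wilson
    rwa [hwil, Cycle.nodup_coe_iff] at this
  cases hN : w.length with
  | zero =>
    -- The period in space-time has to be positive, so the empty word is treated apart: there are no
    -- chords and nothing is smoothed.
    rw [List.length_eq_zero_iff] at hN
    subst hN
    have : IsEmpty H := ⟨fun h => by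
      have := hmem h
      rw [List.eq_nil_of_map_eq_nil (f := f) (l := xs) (by simp [hn, gaussWord, encounters])] at this
      simp at this⟩
    exact iff_of_true (singleOrbit_endpoint hw) (singleOrbit_of_isEmpty _)
  | succ N =>
    have hΦ : SingleOrbit (spaceTime N w.crossing) := by
      rw [singleOrbit_spaceTime, ← hN, position_crossing]
      exact singleOrbit_endpoint hw
    have hΦi := spaceTime_injective N w.crossing
    rw [← position_smoothedCrossing, hN, ← singleOrbit_spaceTime]
    set A : Fin (N + 1) × Fin (m + 1) → Prop := fun x => w.Passes x.1 x.2 with hA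
    have hcard : Fintype.card (Fin (N + 1) × Fin (m + 1)) = (m + 1) * (N + 1) := by
      rw [Fintype.card_prod, Fintype.card_fin, Fintype.card_fin, mul_comm]
    have hper := Function.iterate_minimalPeriod (f := spaceTime N w.crossing) (x := (0, 0))
    rw [minimalPeriod_of_singleOrbit hΦ hΦi] at hper
    obtain ⟨V, hreturn, hVmem, hVnodup, hVmap⟩ : ∃ V : List (Fin (N + 1) × Fin (m + 1)),
        (∀ r (hr : r < V.length), FirstExit (spaceTime N w.crossing) {x | ¬ A x}
          (spaceTime N w.crossing V[r])
          (V[(r + 1) % V.length]'(Nat.mod_lt _ (by omega)))) ∧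
        (∀ x, x ∈ V ↔ A x) ∧ V.Nodup ∧ V.map (fun x => (x.1 : ℕ)) = xs.map f := by
      refine ⟨_, fun r hr => firstExit_visits (A := A) hper hr, mem_visits hΦ hΦi (0, 0),
        nodup_visits hΦ hΦi (0, 0), ?_⟩
      rw [hn, hcard]
      exact map_visits_eq hN (m + 1)
    have hlen : V.length = xs.length := by
      simpa using congrArg List.length hVmap
    have hσ : ∀ x, ¬ A x → spaceTime N w.smoothedCrossing x = spaceTime N w.crossing x := by
      intro x hx
      rw [spaceTime, spaceTime, smoothedCrossing_of_not_passes hx]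
    choose idx hidx using fun h => List.mem_iff_getElem.1 (hmem h)
    choose hidx hidx' using hidx
    have hidx_get : ∀ r (hr : r < xs.length), idx xs[r] = r := by
      intro r hr
      exact (hnodup.getElem_inj_iff).1 (hidx' xs[r])
    set i : H → Fin (N + 1) × Fin (m + 1) := fun h => V[idx h]'(by rw [hlen]; exact hidx h) with hi
    have hi_inj : Function.Injective i := by
      intro h k e
      have := (hVnodup.getElem_inj_iff).1 e
      rw [← hidx' h, ← hidx' k]
      simp only [this]
    have hAi : ∀ h, A (i h) := fun h => (hVmem _).1 (List.getElem_mem _)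
    have hrange : ∀ x, A x ↔ x ∈ Set.range i := by
      intro x
      constructor
      · intro hx
        obtain ⟨r, hr, rfl⟩ := List.mem_iff_getElem.1 ((hVmem x).2 hx)
        rw [hlen] at hr
        refine ⟨xs[r], ?_⟩
        simp only [hi, hidx_get]
      · rintro ⟨h, rfl⟩
        exact hAi h
    have hif : ∀ h, ((i h).1 : ℕ) = f h := by
      intro h
      have : (V.map fun x => (x.1 : ℕ))[idx h]'(by rw [List.length_map, hlen]; exact hidx h) =
          (xs.map f)[idx h]'(by rw [List.length_map]; exact hidx h) := by
        simp only [hVmap]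
      rw [List.getElem_map, List.getElem_map, hidx'] at this
      exact this
    have haround : ∀ h, FirstExit (spaceTime N w.crossing) {x | ¬ A x}
        (spaceTime N w.crossing (i h)) (i (D.around h)) := by
      intro h
      have h1 := hreturn (idx h) (by rw [hlen]; exact hidx h)
      have h2 : i (D.around h) = V[(idx h + 1) % V.length]'(by
          rw [hlen]; exact Nat.mod_lt _ (by have := hidx h; omega)) := by
        have h3 : D.around h = xs[(idx h + 1) % xs.length]'(
            Nat.mod_lt _ (by have := hidx h; omega)) := by
          rw [D.around_eq_formPerm hwil]
          conv_lhs => rw [← hidx' h]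
          exact List.formPerm_apply_getElem _ hnodup _ _
        simp only [hi, h3, hidx_get, hlen]
      rw [h2]
      exact h1
    -- At a smoothed double point the strand keeps its position. This is where the other strand
    -- through the double point would have gone, so smoothing means crossing the chord and
    -- continuing from its other end.
    have hstep : ∀ h, spaceTime N w.smoothedCrossing (i h) =
        spaceTime N w.crossing (i (D.edge h)) := by
      intro h
      have h1 : (i (D.edge h)).1 = (i h).1 := by
        apply Fin.ext
        rw [hif, hif]
        exact (hff _ _).2 (.inr (D.edge_edge h).symm)
      have h2 : (i (D.edge h)).2 ≠ (i h).2 := fun e => D.edge_ne h (hi_inj (Prod.ext h1 e))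
      have h3 := hAi (D.edge h)
      have h4 := hAi h
      simp only [hA] at h3 h4
      rw [spaceTime, spaceTime, smoothedCrossing_of_passes h4]
      rw [h1] at h3 ⊢
      rw [crossing_of_passes h3 h4 h2]
    by_cases hH : Nonempty H
    · obtain ⟨h₀⟩ := hH
      refine singleOrbit_iff_of_return (Z := {x | ¬ A x}) i hi_inj ?_ ?_ ?_
      · intro x
        rw [← hrange]
        exact not_not
      · intro h
        rw [hstep, D.tour_of_leg ∅ (hchord _)]
        exact (haround _).congr fun x hx => (hσ x hx).symm
      · intro x hx
        obtain ⟨n, hn⟩ := hΦ.exists_iterate hΦi x (i h₀)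
        obtain ⟨y, hy⟩ := FirstExit.exists_of_iterate (f := spaceTime N w.crossing)
          (Z := {x | ¬ A x}) n x (by rw [hn]; exact not_not.2 (hAi h₀))
        exact ⟨y, hy.congr fun x hx => (hσ x hx).symm⟩
    -- Without double points the smoothing is the knot itself.
    · rw [not_nonempty_iff] at hH
      have : spaceTime N w.smoothedCrossing = spaceTime N w.crossing := by
        funext x
        refine hσ x fun hx => ?_
        obtain ⟨h, -⟩ := (hrange x).1 hx
        exact isEmptyElim h
      rw [this]
      exact iff_of_true hΦ (singleOrbit_of_isEmpty _)

end SingularBraid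

namespace FeynmanDiagram

theorem IsChordDiagram.conway_eq {H : Type} {D : FeynmanDiagram H} (hD : D.IsChordDiagram) :
    D.conway = indicator01 (SingleOrbit (D.tour ∅)) := by
  have : {S | S ∈ D.orientations ∧ Disjoint S ∅} = {∅} := by
    ext S
    constructor
    · rintro ⟨h, -⟩
      exact Set.eq_empty_of_forall_notMem fun x hx => h.1 x hx (hD x)
    · rintro rfl
      exact ⟨⟨by simp, by simp⟩, Set.disjoint_empty _⟩
  rw [conway, orientationSum, this, finsum_mem_singleton]
  simp

theorem conway_eq_coeff {m : ℕ} {w : SingularBraid m} {H : Type} {D : FeynmanDiagram H}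
    (hw : w.ClosesToKnot) (hD : w.HasChordDiagram D) :
    D.conway = PowerSeries.coeff w.numSingular w.alexanderSeries := by
  rw [SingularBraid.coeff_alexanderSeries hw, hD.1.conway_eq,
    SingularBraid.singleOrbit_smoothPerm_iff hw hD]

end FeynmanDiagram

/-! ### Chord diagrams are realized by singular braids -/

namespace SingularBraid

variable {m : ℕ}

theorem endpoint_append (u v : SingularBraid m) :
    endpoint (u ++ v) = endpoint v * endpoint u := by
  induction u with
  | nil => rfl
  | cons c u ih => rw [List.cons_append, endpoint, ih, endpoint, mul_assoc]

theorem encounters_append (u v : SingularBraid m) (k : ℕ) (p : Fin (m + 1)) :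
    encounters (u ++ v) k p =
      encounters u k p ++ encounters v (k + u.length) (endpoint u p) := by
  induction u generalizing k p with
  | nil => rfl
  | cons c u ih =>
    obtain ⟨i, kind⟩ := c
    have hk : k + (u.length + 1) = k + 1 + u.length := by omega
    cases kind with
    | positive => simp only [List.cons_append, encounters, ih, List.length_cons, hk]; rfl
    | negative => simp only [List.cons_append, encounters, ih, List.length_cons, hk]; rfl
    | singular =>
      simp only [List.cons_append, encounters, ih, List.length_cons, hk]
      by_cases hp : p = i.castSucc ∨ p = i.succ
      · simp only [if_pos hp, List.cons_append]
        rfl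
      · simp only [if_neg hp]
        rw [not_or] at hp
        rw [endpoint, Equiv.Perm.mul_apply, Equiv.swap_apply_of_ne_of_ne hp.1 hp.2]

/-- Every permutation is the permutation of a braid without double points. -/
theorem exists_endpoint_eq (π : Equiv.Perm (Fin (m + 1))) :
    ∃ u : SingularBraid m, endpoint u = π ∧ ∀ k p, encounters u k p = [] := by
  have hπ : π ∈ Submonoid.closure
      (Set.range fun i : Fin m => Equiv.swap i.castSucc i.succ) := by
    rw [Equiv.Perm.mclosure_swap_castSucc_succ]
    trivial
  induction hπ using Submonoid.closure_induction with
  | mem x hx =>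
    obtain ⟨i, rfl⟩ := hx
    exact ⟨[(i, .positive)], one_mul _, fun _ _ => rfl⟩
  | one => exact ⟨[], rfl, fun _ _ => rfl⟩
  | mul x y _ _ hx hy =>
    obtain ⟨u, rfl, hu⟩ := hx
    obtain ⟨v, rfl, hv⟩ := hy
    exact ⟨v ++ u, endpoint_append v u, fun k p => by rw [encounters_append, hu, hv]; rfl⟩

/-- A pure braid with one double point, at which two given strands meet. -/
theorem exists_meeting {p q : Fin (m + 1)} (hpq : p ≠ q) :
    ∃ (w : SingularBraid m) (j : ℕ), endpoint w = 1 ∧ j < w.length ∧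
      ∀ k r, encounters w k r = if r = p ∨ r = q then [k + j] else [] := by
  obtain ⟨i⟩ : Nonempty (Fin m) := by
    cases m with
    | zero => exact absurd ((Fin.eq_zero p).trans (Fin.eq_zero q).symm) hpq
    | succ m => exact ⟨0⟩
  have hne : i.castSucc ≠ i.succ := Fin.castSucc_lt_succ.ne
  obtain ⟨π, hp, hq⟩ : ∃ π : Equiv.Perm (Fin (m + 1)), π p = i.castSucc ∧ π q = i.succ := by
    refine ⟨Equiv.swap i.succ (Equiv.swap i.castSucc p q) * Equiv.swap i.castSucc p, ?_, ?_⟩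
    · rw [Equiv.Perm.mul_apply, Equiv.swap_apply_right]
      refine Equiv.swap_apply_of_ne_of_ne hne fun e => hpq ?_
      rw [← Equiv.swap_apply_right i.castSucc p] at e
      exact (Equiv.swap _ _).injective (by rwa [Equiv.swap_apply_right] at e ⊢)
    · rw [Equiv.Perm.mul_apply, Equiv.swap_apply_right]
  obtain ⟨u, hu, hu'⟩ := exists_endpoint_eq π
  obtain ⟨v, hv, hv'⟩ := exists_endpoint_eq (Equiv.swap i.castSucc i.succ * π)⁻¹
  refine ⟨u ++ (i, .singular) :: v, u.length, ?_, by simp, fun k r => ?_⟩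
  · rw [endpoint_append, endpoint, hu, hv, mul_assoc, inv_mul_cancel]
  · rw [encounters_append, hu', List.nil_append, encounters, hu]
    have : (π r = i.castSucc ∨ π r = i.succ) ↔ (r = p ∨ r = q) := by
      rw [← hp, ← hq, π.injective.eq_iff, π.injective.eq_iff]
    simp only [this, hv']

/-- One pure braid with a single meeting is concatenated for each entry of `l`, which contains at
most one end of each chord of the involution `ε`. A strand that belongs to a listed chord meets
exactly one double point, and `g` records its number. The bound `k ≤ g p` keeps these numbers apart
from those of a braid placed in front. -/
theorem exists_pure_braid (ε : Fin (m + 1) → Fin (m + 1)) (hε : ∀ p, ε (ε p) = p)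
    (hε' : ∀ p, ε p ≠ p) (l : List (Fin (m + 1))) (hl : l.Pairwise fun p q => q ≠ p ∧ q ≠ ε p) :
    ∃ w : SingularBraid m, endpoint w = 1 ∧ ∀ k, ∃ g : Fin (m + 1) → ℕ,
      (∀ p, encounters w k p = if p ∈ l ∨ ε p ∈ l then [g p] else []) ∧ (∀ p, k ≤ g p) ∧
      ∀ p q, (p ∈ l ∨ ε p ∈ l) → (q ∈ l ∨ ε q ∈ l) → (g p = g q ↔ q = p ∨ q = ε p) := by
  induction l with
  | nil => exact ⟨[], rfl, fun k => ⟨fun _ => k, by simp [encounters]⟩⟩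
  | cons a l ih =>
    rw [List.pairwise_cons] at hl
    obtain ⟨w, hw, hw'⟩ := ih hl.2
    obtain ⟨b, j, hb, hj, hb'⟩ := exists_meeting (hε' a).symm
    refine ⟨b ++ w, by rw [endpoint_append, hb, hw, mul_one], fun k => ?_⟩
    -- The later numbers start at `k + b.length`, beyond the number `k + j` of the new double point,
    -- since `j < b.length`.
    obtain ⟨g, hg, hgk, hgg⟩ := hw' (k + b.length)
    have hεa : ∀ p, ε p = a ↔ p = ε a := fun p =>
      ⟨fun e => by rw [← e, hε], fun e => by rw [e, hε]⟩
    have hmem : ∀ p, (p ∈ a :: l ∨ ε p ∈ a :: l) ↔ (p = a ∨ p = ε a) ∨ (p ∈ l ∨ ε p ∈ l) := by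
      intro p
      rw [List.mem_cons, List.mem_cons, hεa]
      tauto
    have hnot : ∀ p, (p = a ∨ p = ε a) → ¬ (p ∈ l ∨ ε p ∈ l) := by
      rintro p (rfl | rfl) (h | h)
      · exact (hl.1 _ h).1 rfl
      · exact (hl.1 _ h).2 rfl
      · exact (hl.1 _ h).2 rfl
      · rw [hε] at h
        exact (hl.1 _ h).1 rfl
    refine ⟨fun p => if p = a ∨ p = ε a then k + j else g p, fun p => ?_, fun p => ?_, ?_⟩
    · rw [encounters_append, hb', hb, Equiv.Perm.one_apply, hg]
      simp only [hmem]
      by_cases hp : p = a ∨ p = ε a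
      · rw [if_pos hp, if_neg (hnot p hp), if_pos (.inl hp), if_pos hp, List.append_nil]
      · rw [if_neg hp, if_neg hp, List.nil_append]
        simp only [hp, false_or]
    · have := hgk p
      beta_reduce
      split_ifs <;> omega
    · intro p q hp hq
      rw [hmem] at hp hq
      by_cases hpa : p = a ∨ p = ε a <;> by_cases hqa : q = a ∨ q = ε a
      · simp only [if_pos hpa, if_pos hqa, true_iff]
        rcases hpa with rfl | rfl <;> rcases hqa with rfl | rfl <;> simp [hε]
      · have := hgk q
        simp only [if_pos hpa, if_neg hqa]
        refine iff_of_false (by omega) fun h => hqa ?_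
        rcases hpa with rfl | rfl
        · exact h
        · rw [hε] at h
          exact h.symm
      · have := hgk p
        simp only [if_neg hpa, if_pos hqa]
        refine iff_of_false (by omega) fun h => hpa ?_
        rcases h with rfl | rfl
        · exact hqa
        · rw [hεa] at hqa
          rcases hqa with h | h
          · exact .inr h
          · refine .inl ?_
            rw [← hε p, h, hε]
      · simp only [if_neg hpa, if_neg hqa]
        exact hgg p q (hp.resolve_left hpa) (hq.resolve_left hqa)

theorem val_finRotate_pow (k : ℕ) (p : Fin (m + 1)) :
    ((finRotate (m + 1) ^ k) p : ℕ) = (p + k) % (m + 1) := by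
  induction k with
  | zero => simp [Nat.mod_eq_of_lt p.2]
  | succ k ih =>
    rw [pow_succ', Equiv.Perm.mul_apply, finRotate_apply, Fin.val_add, ih, ← Nat.add_assoc,
      Nat.add_mod, Nat.mod_mod, Fin.val_one', Nat.mod_mod, ← Nat.add_mod]

/-- Every chord diagram is the chord diagram of a singular knot. -/
theorem exists_hasChordDiagram {H : Type} {D : FeynmanDiagram H} (hD : D.IsChordDiagram) :
    ∃ (m : ℕ) (w : SingularBraid m), w.ClosesToKnot ∧ w.HasChordDiagram D := by
  obtain ⟨xs, hxs⟩ := Quotient.exists_rep D.wilson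
  replace hxs : D.wilson = ↑xs := hxs.symm
  have hmem : ∀ h, h ∈ xs := by
    intro h
    have := (D.mem_wilson h).2 (hD h)
    rwa [hxs, Cycle.mem_coe_iff] at this
  have hnodup : xs.Nodup := by
    have := D.nodup_wilson
    rwa [hxs, Cycle.nodup_coe_iff] at this
  cases hm : xs.length with
  | zero =>
    rw [List.length_eq_zero_iff] at hm
    subst hm
    have : IsEmpty H := ⟨fun h => by simpa using hmem h⟩
    exact ⟨0, [], fun p q => ⟨0, (Fin.eq_zero _).trans (Fin.eq_zero _).symm⟩, hD, isEmptyElim, by rw [hxs]; rfl,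
      isEmptyElim⟩
  | succ m =>
    obtain ⟨e, he⟩ : ∃ e : Fin (m + 1) ≃ H, List.ofFn e = xs := by
      classical
      refine ⟨(finCongr hm.symm).trans (hnodup.getEquivOfForallMemList xs hmem), ?_⟩
      refine List.ext_getElem (by simp [hm]) fun n h1 h2 => ?_
      rw [List.getElem_ofFn]
      rfl
    set ε : Fin (m + 1) → Fin (m + 1) := fun p => e.symm (D.edge (e p)) with hε
    have hεε : ∀ p, ε (ε p) = p := fun p => by simp [hε, D.edge_edge]
    have hεne : ∀ p, ε p ≠ p := fun p h => D.edge_ne (e p) ((e.symm_apply_eq).1 h)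
    -- There is one strand for each leg, and a chord is represented by the smaller of its two ends.
    -- Hence every strand meets exactly one double point.
    obtain ⟨w, hw, hw'⟩ := exists_pure_braid ε hεε hεne
      ((Finset.univ.filter fun p => p < ε p).toList) (by
        refine (Finset.nodup_toList _).imp_of_mem fun {p q} hp hq hpq => ⟨hpq.symm, ?_⟩
        rintro rfl
        simp only [Finset.mem_toList, Finset.mem_filter, Finset.mem_univ, true_and, hεε] at hp hq
        exact absurd hp hq.not_gt)
    have hall : ∀ p, p ∈ (Finset.univ.filter fun p => p < ε p).toList ∨
        ε p ∈ (Finset.univ.filter fun p => p < ε p).toList := by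
      intro p
      simp only [Finset.mem_toList, Finset.mem_filter, Finset.mem_univ, true_and, hεε]
      exact (hεne p).symm.lt_or_gt
    obtain ⟨g, hg, -, hgg⟩ := hw' 0
    simp only [hall, if_true, true_implies] at hg hgg
    obtain ⟨c, hc, hc'⟩ := exists_endpoint_eq (finRotate (m + 1))
    have hend : endpoint (w ++ c) = finRotate (m + 1) := by
      rw [endpoint_append, hw, hc, mul_one]
    -- The braid `c` closes the pure braid up to a knot that traverses the strands in the order 0,
    -- 1, 2, ..., which is the order of the legs. The strand `p` is led to `q` by `m + 1 - p + q`
    -- rotations; the summand `m + 1` avoids truncated subtraction.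
    refine ⟨m, w ++ c, fun p q => ⟨m + 1 - p + q, Fin.ext ?_⟩, hD, fun h => g (e.symm h), ?_, ?_⟩
    · rw [hend, val_finRotate_pow, ← Nat.add_assoc, Nat.add_sub_cancel' p.2.le, Nat.add_mod_left,
        Nat.mod_eq_of_lt q.2]
    · rw [hxs, ← he, Cycle.map_coe, List.map_ofFn, gaussWord]
      congr 1
      have : ∀ r, encounters (w ++ c) 0 ((endpoint (w ++ c) ^ r) 0) =
          [g ((finRotate (m + 1) ^ r) 0)] := by
        intro r
        rw [encounters_append, hc', List.append_nil, hg, hend]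
      simp only [this, ← List.map_eq_flatMap]
      refine List.ext_getElem (by simp) fun n h1 h2 => ?_
      simp only [List.getElem_ofFn, List.getElem_map, List.getElem_range, Function.comp_apply,
        Equiv.symm_apply_apply]
      congr 1
      apply Fin.ext
      rw [val_finRotate_pow]
      simp only [List.length_ofFn] at h1
      simp [Nat.mod_eq_of_lt h1]
    · intro h k
      rw [hgg]
      simp only [hε, Equiv.apply_symm_apply, EmbeddingLike.apply_eq_iff_eq]

end SingularBraid

/-! ### Uniqueness of the Alexander-Conway series -/

namespace FeynmanDiagram

variable {H : Type} (Y : FeynmanDiagram H)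

theorem exists_wilson_eq {l : H} (hl : Y.next l = l) : ∃ L : List H, Y.wilson = ↑(l :: L) := by
  obtain ⟨ys, hys⟩ := Quotient.exists_rep Y.wilson
  replace hys : Y.wilson = ↑ys := hys.symm
  have hmem := (Y.mem_wilson l).2 hl
  rw [hys, Cycle.mem_coe_iff] at hmem
  obtain ⟨A, B, rfl⟩ := List.append_of_mem hmem
  refine ⟨B ++ A, ?_⟩
  rw [hys, Cycle.coe_eq_coe]
  exact List.isRotated_append

/-- A leg which is joined to a trivalent vertex can be removed by opening this vertex. -/
theorem exists_isOpening {l : H} (hl : Y.next l = l) (ht : Y.Trivalent (Y.edge l)) {L : List H}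
    (hL : Y.wilson = ↑(l :: L)) {x y : H} (hxy : x ≠ y)
    (hv : ∀ h, h ∈ Y.vertex (Y.edge l) ↔ h = Y.edge l ∨ h = x ∨ h = y)
    (hx : x ≠ Y.edge l) (hy : y ≠ Y.edge l) :
    ∃ D : FeynmanDiagram {h // h ≠ l ∧ h ≠ Y.edge l}, Y.IsOpening l L x y D := by
  classical
  have := Y.finite
  have hlv : l ∉ Y.vertex (Y.edge l) := fun h => (Y.trivalent_iff_of_mem_vertex h).2 ht hl
  have hedge : ∀ h : {h // h ≠ l ∧ h ≠ Y.edge l}, Y.edge h ≠ l ∧ Y.edge h ≠ Y.edge l := by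
    rintro ⟨h, h1, h2⟩
    exact ⟨fun e => h2 (by rw [← e, Y.edge_edge]), fun e => h1 (Y.edge_injective e)⟩
  have hnext : ∀ h : {h // h ≠ l ∧ h ≠ Y.edge l}, h.1 ∉ Y.vertex (Y.edge l) →
      Y.next h ≠ l ∧ Y.next h ≠ Y.edge l := by
    rintro ⟨h, h1, h2⟩ h3
    refine ⟨fun e => h1 (Y.next_injective (e.trans hl.symm)), fun e => h3 ?_⟩
    rw [← Y.next_mem_vertex_iff, e]
    exact Y.self_mem_vertex _
  have hxl : x ≠ l := fun e => hlv ((hv l).2 (.inr (.inl e.symm)))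
  have hyl : y ≠ l := fun e => hlv ((hv l).2 (.inr (.inr e.symm)))
  have hlegs : ∀ h, h = l ∨ h ∈ L ↔ Y.next h = h := by
    intro h
    rw [← Y.mem_wilson, hL, Cycle.mem_coe_iff, List.mem_cons]
  have hLnodup : l ∉ L ∧ L.Nodup := by
    have := Y.nodup_wilson
    rwa [hL, Cycle.nodup_coe_iff, List.nodup_cons] at this
  have hLv : ∀ h ∈ L, h ∉ Y.vertex (Y.edge l) := fun h hh hm =>
    (Y.trivalent_iff_of_mem_vertex hm).2 ht ((hlegs h).1 (.inr hh))
  have hLmem : ∀ h ∈ L, h ≠ l ∧ h ≠ Y.edge l := fun h hh =>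
    ⟨fun e => hLnodup.1 (e ▸ hh), fun e => hLv h hh (e ▸ Y.self_mem_vertex _)⟩
  obtain ⟨L', rfl⟩ : ∃ L' : List {h // h ≠ l ∧ h ≠ Y.edge l}, L'.map Subtype.val = L :=
    ⟨L.pmap Subtype.mk hLmem, by simp [List.map_pmap]⟩
  set nx : {h // h ≠ l ∧ h ≠ Y.edge l} → {h // h ≠ l ∧ h ≠ Y.edge l} := fun h =>
    if hh : h.1 ∈ Y.vertex (Y.edge l) then h else ⟨Y.next h, hnext h hh⟩ with hnx
  have nx_mem : ∀ h, h.1 ∈ Y.vertex (Y.edge l) → nx h = h := fun h hh => dif_pos hh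
  have nx_notMem : ∀ h, h.1 ∉ Y.vertex (Y.edge l) → (nx h).1 = Y.next h := fun h hh => by
    simp only [hnx, dif_neg hh]
  have nx_vertex : ∀ h, h.1 ∉ Y.vertex (Y.edge l) → (nx h).1 ∉ Y.vertex (Y.edge l) :=
    fun h hh => by rwa [nx_notMem h hh, Y.next_mem_vertex_iff]
  have hlist : ((⟨x, hxl, hx⟩ :: ⟨y, hyl, hy⟩ :: L' :
      List {h // h ≠ l ∧ h ≠ Y.edge l})).map Subtype.val = x :: y :: L'.map Subtype.val := rfl
  refine ⟨{ finite := inferInstance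
            edge := fun h => ⟨Y.edge h, hedge h⟩
            edge_edge := fun h => Subtype.ext (Y.edge_edge h)
            edge_ne := fun h e => Y.edge_ne h (congrArg Subtype.val e)
            next := nx
            next_next_next := ?_
            wilson := ↑((⟨x, hxl, hx⟩ :: ⟨y, hyl, hy⟩ :: L' :
              List {h // h ≠ l ∧ h ≠ Y.edge l}))
            nodup_wilson := ?_
            mem_wilson := ?_
            exists_leg := ?_ }, Subtype.val, Subtype.val_injective, ?_, fun h => rfl, ?_, ?_, hL,
            ?_⟩
  · intro h
    by_cases hh : h.1 ∈ Y.vertex (Y.edge l)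
    · rw [nx_mem h hh, nx_mem h hh, nx_mem h hh]
    · apply Subtype.ext
      rw [nx_notMem _ (nx_vertex _ (nx_vertex _ hh)), nx_notMem _ (nx_vertex _ hh),
        nx_notMem _ hh, Y.next_next_next]
  · rw [Cycle.nodup_coe_iff]
    refine List.Nodup.of_map Subtype.val ?_
    rw [hlist]
    refine List.nodup_cons.2 ⟨?_, List.nodup_cons.2 ⟨fun h => ?_, hLnodup.2⟩⟩
    · rw [List.mem_cons, not_or]
      exact ⟨hxy, fun h => hLv x h ((hv x).2 (.inr (.inl rfl)))⟩
    · exact hLv y h ((hv y).2 (.inr (.inr rfl)))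
  · intro h
    rw [Cycle.mem_coe_iff, ← List.mem_map_of_injective Subtype.val_injective, hlist,
      List.mem_cons, List.mem_cons]
    by_cases hh : h.1 ∈ Y.vertex (Y.edge l)
    · rw [nx_mem h hh]
      refine iff_of_true ?_ rfl
      rcases (hv h).1 hh with e | e | e
      · exact absurd e h.2.2
      · exact .inl e
      · exact .inr (.inl e)
    · rw [Subtype.ext_iff, nx_notMem h hh, ← hlegs]
      have h1 : h.1 ≠ x := fun e => hh ((hv _).2 (.inr (.inl e)))
      have h2 : h.1 ≠ y := fun e => hh ((hv _).2 (.inr (.inr e)))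
      have h3 := h.2.1
      tauto
  · intro h
    obtain ⟨z, hz, hpath⟩ := Y.exists_leg h
    -- A path to a leg in `Y` is followed until it ends or meets the opened vertex, where the
    -- remaining half-edges have become legs. The deleted leg could only be reached through that
    -- vertex.
    have key : ∀ a, Relation.ReflTransGen (fun x y => y = Y.edge x ∨ y = Y.next x) a z →
        ∀ h : {h // h ≠ l ∧ h ≠ Y.edge l}, h.1 = a → ∃ l', nx l' = l' ∧ Relation.ReflTransGen
          (fun x y => y = ⟨Y.edge x, hedge x⟩ ∨ y = nx x) h l' := by
      intro a ha
      induction ha using Relation.ReflTransGen.head_induction_on with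
      | refl =>
        rintro h rfl
        refine ⟨h, ?_, .refl⟩
        by_cases hh : h.1 ∈ Y.vertex (Y.edge l)
        · exact nx_mem h hh
        · exact Subtype.ext ((nx_notMem h hh).trans hz)
      | head hstep _ ih =>
        rintro h rfl
        by_cases hh : h.1 ∈ Y.vertex (Y.edge l)
        · exact ⟨h, nx_mem h hh, .refl⟩
        · rcases hstep with e | e
          · obtain ⟨l', hl', hp⟩ := ih ⟨Y.edge h, hedge h⟩ e.symm
            exact ⟨l', hl', .head (.inl rfl) hp⟩
          · obtain ⟨l', hl', hp⟩ := ih (nx h) ((nx_notMem h hh).trans e.symm)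
            exact ⟨l', hl', .head (.inr rfl) hp⟩
    exact key h hpath h rfl
  · intro h
    rw [Subtype.range_coe_subtype]
    rfl
  · exact fun h hh => nx_mem h hh
  · exact fun h hh => nx_notMem h hh
  · exact congrArg _ hlist

/-- Otherwise a path that starts at a trivalent vertex would stay at trivalent vertices and never
reach a leg. This provides the place where the three-term relation can be applied. -/
theorem exists_leg_edge_trivalent (hY : ¬ Y.IsChordDiagram) :
    ∃ l, Y.next l = l ∧ Y.Trivalent (Y.edge l) := by
  by_contra! hno
  rw [IsChordDiagram, not_forall] at hY
  obtain ⟨h, hh⟩ := hY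
  obtain ⟨z, hz, hpath⟩ := Y.exists_leg h
  have key : Y.Trivalent z := by
    clear hz
    induction hpath with
    | refl => exact hh
    | tail _ hstep ih =>
      rcases hstep with rfl | rfl
      · intro e
        have := hno _ e
        rw [Y.edge_edge] at this
        exact this ih
      · exact ih.next
  exact key hz

end FeynmanDiagram

/-- Induction on the number of half-edges: the values on chord diagrams are prescribed by the
singular knots that realise them, and in any other diagram an opening at a leg removes two
half-edges. -/
theorem IsAlexanderConwaySeries.unique {C C' : (H : Type) → FeynmanDiagram H → ℚ}
    (hC : IsAlexanderConwaySeries C) (hC' : IsAlexanderConwaySeries C') : C = C' := by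
  have key : ∀ (n : ℕ) (H : Type) (F : FeynmanDiagram H), Nat.card H = n → C H F = C' H F := by
    intro n
    induction n using Nat.strong_induction_on with
    | _ n ih =>
      rintro H F rfl
      by_cases hF : F.IsChordDiagram
      · obtain ⟨m, w, hw, hw'⟩ := SingularBraid.exists_hasChordDiagram hF
        rw [hC.symbol m w H F hw hw', hC'.symbol m w H F hw hw']
      · obtain ⟨l, hl, ht⟩ := F.exists_leg_edge_trivalent hF
        obtain ⟨L, hL⟩ := F.exists_wilson_eq hl
        have h1 : F.next (F.edge l) ≠ F.edge l := ht
        have h2 : F.next (F.next (F.edge l)) ≠ F.edge l := fun e =>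
          h1 (F.next_next_eq_self_iff.1 e)
        have h3 : F.next (F.next (F.edge l)) ≠ F.next (F.edge l) := fun e =>
          h1 (F.next_injective e)
        obtain ⟨P, hP⟩ := F.exists_isOpening hl ht hL h3
          (fun h => by rw [F.mem_vertex]; tauto) h2 h1
        obtain ⟨X, hX⟩ := F.exists_isOpening hl ht hL h3.symm (fun h => F.mem_vertex) h1 h2
        have hcard : Nat.card {h // h ≠ l ∧ h ≠ F.edge l} < Nat.card H := by
          have := F.finite
          exact Finite.card_subtype_lt (x := l) (by simp)
        rw [hC.three_term _ _ _ F P X l L hl ht hP hX, hC'.three_term _ _ _ F P X l L hl ht hP hX,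
          ih _ hcard _ P rfl, ih _ hcard _ X rfl]
  funext H F
  exact key _ H F rfl

/-! ### Existence, and the four relations -/

theorem isAlexanderConwaySeries_conway :
    IsAlexanderConwaySeries fun _ F => F.conway where
  equivalent _ _ _ _ h := FeynmanDiagram.conway_eq_of_equivalent h
  symbol _ _ _ _ hw hD := FeynmanDiagram.conway_eq_coeff hw hD
  three_term _ _ _ _ _ _ _ _ hl ha hP hX := FeynmanDiagram.conway_three_term hl ha hP hX

theorem proposition7p1 :
    (∃! C : (H : Type) → FeynmanDiagram H → ℚ, IsAlexanderConwaySeries C) ∧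
    ∀ C : (H : Type) → FeynmanDiagram H → ℚ, IsAlexanderConwaySeries C →
      -- a chord with a bubble can be deleted at the cost of a factor `-2`
      (∀ (H H₀ : Type) (F : FeynmanDiagram H) (F₀ : FeynmanDiagram H₀) (l l' : H),
        F.IsBubbleChordDeletion l l' F₀ → C H F = -2 * C H₀ F₀) ∧
      -- a bubble on an edge which meets a trivalent vertex gives zero
      (∀ (H : Type) (F : FeynmanDiagram H) (p p' : H),
        F.IsBubble p p' → F.Trivalent (F.edge p') → C H F = 0) ∧
      -- a trivalent vertex joined to three trivalent vertices gives zero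
      (∀ (H : Type) (F : FeynmanDiagram H) (c : H), F.HasTripodTree c → C H F = 0) ∧
      -- the fragment `K` with legs 1, 2, 3, 4 is one half of
      -- (bubble 1-3, arc 2-4) + (arc 1-3, bubble 2-4) - (bubble 2-3, arc 1-4)
      -- - (arc 2-3, bubble 1-4)
      (∀ (H : Type) (F G₁ G₂ G₃ G₄ : FeynmanDiagram H) (a b : H), F.HasK a b →
        ∀ p₁ p₂ p₃ p₄ : H,
        p₁ = F.next a → p₂ = F.next (F.next a) → p₃ = F.next b → p₄ = F.next (F.next b) →
        F.IsKReplacement a b p₁ p₃ p₂ p₄ G₁ →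
        F.IsKReplacement a b p₂ p₄ p₁ p₃ G₂ →
        F.IsKReplacement a b p₂ p₃ p₁ p₄ G₃ →
        F.IsKReplacement a b p₁ p₄ p₂ p₃ G₄ →
        C H F = 1 / 2 * (C H G₁ + C H G₂ - C H G₃ - C H G₄)) := by
  refine ⟨⟨_, isAlexanderConwaySeries_conway, fun C hC =>
    hC.unique isAlexanderConwaySeries_conway⟩, fun C hC => ?_⟩
  -- By uniqueness the given series is `conway`, so the relations are needed only for the explicit
  -- formula.
  obtain rfl := hC.unique isAlexanderConwaySeries_conway
  refine ⟨fun H H₀ F F₀ l l' h => h.conway_eq, fun H F p p' h hp => h.conway_eq_zero hp,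
    fun H F c h => h.conway_eq_zero, ?_⟩
  rintro H F G₁ G₂ G₃ G₄ a b h p₁ p₂ p₃ p₄ rfl rfl rfl rfl h₁ h₂ h₃ h₄
  have e₁ := h.conway_replacement (j := 2) (j' := 4) (k := 3) (k' := 5) (by simp) (by simp) h₁
  have e₂ := h.conway_replacement (j := 3) (j' := 5) (k := 2) (k' := 4) (by simp) (by simp) h₂
  have e₃ := h.conway_replacement (j := 3) (j' := 4) (k := 2) (k' := 5) (by simp) (by simp) h₃
  have e₄ := h.conway_replacement (j := 2) (j' := 5) (k := 3) (k' := 4) (by simp) (by simp) h₄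
  beta_reduce
  -- `F` is minus the signed sum of the four cut patterns, and each replacement diagram is -2 times
  -- its pattern; the quotient of the two factors is 1/2.
  rw [h.conway_eq, e₁, e₂, e₃, e₄]
  ring
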